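/- Consider topic models of the following kind. The vocabulary has $W$ words, there are $K$ topics, and the topic matrix $\beta\in\mathbb R_{\ge 0}^{W\times K}$ has columns that sum to $1$. The topic proportions of a document are drawn from a prior, which is a probability measure on the simplex in $\mathbb R^K$ with mean vector $a$, all of whose entries are strictly positive. Let $R=\mathbb E[\theta\theta^\top]$ for $\theta$ drawn from the prior, and let $R'=\operatorname{diag}(a)^{-1}R\operatorname{diag}(a)^{-1}$. A corpus consists of $M$ documents of $N\ge 2$ words each. The topic proportions $\theta_1,\dots,\theta_M$ are drawn independently from the prior, and, given these, the $N$ words of document $m$ are drawn independently from the distribution $\beta\theta_m$, independently for different documents. Word $i$ is a novel word of topic $k$ if $\beta_{ik}>0$ and $\beta_{il}=0$ for all $l\ne k$; $\beta$ is separable if every topic has a novel word. A matrix is simplicial if there is $\gamma>0$ such that each of its rows is at Euclidean distance at least $\gamma$ from the convex hull of the remaining rows (no requirement if there are no remaining rows). The empirical word co-occurrence counts of a corpus form the $W\times W$ matrix whose $(i,j)$ entry is the number of ordered pairs of distinct positions in the same document that carry the words $i$ and $j$. There is a single algorithm (a deterministic program for a random-access machine with words of $O(\log(W+M+K+N+2))$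 bits and unit-cost arithmetic), which is given $W,K,N,M$ and a corpus and does not know the model, with the following properties. 1. On every input it halts after at most $C\,(W+M+K+N+1)^2$ steps, where $C$ is an absolute constant. 2. Its output, a set of words, depends on the corpus only through the empirical word co-occurrence counts (besides $W,K,N,M$). 3. For every fixed $W$, $K$, $N\ge 2$ and every topic model as above for which $\beta$ is separable and $R'$ is simplicial, the probability that the output is exactly the set of all novel words of the $K$ topics tends to $1$ as $M\to\infty$. -/

import Mathlib

open MeasureTheory Filter Topology

/-! ## Separable topic models -/

/-- A topic model with a vocabulary of `W` words and `K` topics: a column-stochastic topic matrix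
and a prior on the topic proportions of a document, i.e. a probability measure on the simplex,
under which every topic has positive mean weight. -/
structure TopicModel (W K : ℕ) where
  topic : Matrix (Fin W) (Fin K) ℝ
  topic_nonneg : ∀ i k, 0 ≤ topic i k
  topic_sum : ∀ k, ∑ i, topic i k = 1
  prior : Measure (Fin K → ℝ)
  prior_prob : IsProbabilityMeasure prior
  prior_simplex : ∀ᵐ θ ∂prior, θ ∈ stdSimplex ℝ (Fin K)
  mean_pos : ∀ k, 0 < ∫ θ, θ k ∂prior

/-- Word `i` is a novel word of topic `k`: it has positive probability in topic `k` only. -/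
def IsNovelWord {W K : ℕ} (β : Matrix (Fin W) (Fin K) ℝ) (i : Fin W) (k : Fin K) : Prop :=
  0 < β i k ∧ ∀ l, l ≠ k → β i l = 0

/-- A topic matrix is separable if every topic has a novel word. -/
def IsSeparableTopics {W K : ℕ} (β : Matrix (Fin W) (Fin K) ℝ) : Prop :=
  ∀ k, ∃ i, IsNovelWord β i k

/-- The set of all novel words of all the topics. -/
def novelWords {W K : ℕ} (β : Matrix (Fin W) (Fin K) ℝ) : Set (Fin W) :=
  {i | ∃ k, IsNovelWord β i k}

/-- A matrix is simplicial if for some `γ > 0` each row is at Euclidean distance at least `γ` from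
the convex hull of the remaining rows (if there are no remaining rows, nothing is required). -/
def IsSimplicialMatrix {m n : ℕ} (A : Matrix (Fin m) (Fin n) ℝ) : Prop :=
  ∃ γ : ℝ, 0 < γ ∧ ∀ i : Fin m,
    ∀ y ∈ convexHull ℝ ((fun j : Fin m => WithLp.toLp 2 (A j)) '' {j | j ≠ i}),
      γ ≤ dist (WithLp.toLp 2 (A i) : EuclideanSpace ℝ (Fin n)) y

namespace TopicModel

variable {W K : ℕ} (T : TopicModel W K)

/-- The expectation of the prior. -/
noncomputable def mean (k : Fin K) : ℝ := ∫ θ, θ k ∂T.prior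

/-- The correlation matrix (matrix of second moments) of the prior. -/
noncomputable def corr : Matrix (Fin K) (Fin K) ℝ :=
  Matrix.of fun k l => ∫ θ, θ k * θ l ∂T.prior

/-- The normalized correlation matrix `diag(a)⁻¹ R diag(a)⁻¹`. -/
noncomputable def normCorr : Matrix (Fin K) (Fin K) ℝ :=
  Matrix.diagonal (fun k => (T.mean k)⁻¹) * T.corr * Matrix.diagonal (fun k => (T.mean k)⁻¹)

/-- The law of one document of `N` words: topic proportions `θ` are drawn from the prior, and then
the `N` words are drawn independently from the distribution `β θ` on the vocabulary. -/
noncomputable def docLaw (N : ℕ) : Measure (Fin N → Fin W) :=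
  ∑ d : Fin N → Fin W,
    (∫⁻ θ, ∏ t, ENNReal.ofReal ((T.topic.mulVec θ) (d t)) ∂T.prior) • Measure.dirac d

end TopicModel

/-- A corpus of `M` documents of `N` words each over the vocabulary `Fin W`; `D m t` is the word at
position `t` of document `m`. -/
abbrev Corpus (W N M : ℕ) : Type := Fin M → Fin N → Fin W

/-- The law of a corpus of `M` independent documents. -/
noncomputable def TopicModel.corpusLaw {W K : ℕ} (T : TopicModel W K) (N M : ℕ) :
    Measure (Corpus W N M) :=
  Measure.pi fun _ : Fin M => T.docLaw N

/-- The empirical word co-occurrence counts: entry `(i, j)` is the number of ordered pairs of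
distinct positions in the same document that carry the words `i` and `j`. -/
def cooccurrence {W N M : ℕ} (D : Corpus W N M) : Matrix (Fin W) (Fin W) ℕ :=
  Matrix.of fun i j =>
    ∑ m : Fin M, ∑ s : Fin N, ∑ t : Fin N, if s ≠ t ∧ D m s = i ∧ D m t = j then 1 else 0

/-! ## A word RAM with a step count

Deterministic programs over natural numbers, with registers, random-access arrays, arithmetic,
branching and loops. Each operation takes one step. Every number that is handled has to fit into
a machine word, that is, to be at most a bound `B`. -/

namespace WordRAM

/-- Arithmetic operations: addition, truncated subtraction, multiplication, integer division. -/
inductive Op where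
  | add | sub | mul | div

/-- The value of an operation. -/
def Op.apply : Op → ℕ → ℕ → ℕ
  | .add, a, b => a + b
  | .sub, a, b => a - b
  | .mul, a, b => a * b
  | .div, a, b => a / b

/-- The memory: registers, and arrays of cells. A program mentions only finitely many registers
and finitely many arrays. -/
structure Memory where
  reg : ℕ → ℕ
  arr : ℕ → ℕ → ℕ

/-- Expressions: a literal, the content of a register, the content of the cell of an array at a
computed address, or an arithmetic operation. -/
inductive Expr where
  | lit (n : ℕ)
  | reg (x : ℕ)
  | cell (a : ℕ) (e : Expr)
  | bin (o : Op) (e f : Expr)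

/-- The value of an expression. -/
def Expr.eval (s : Memory) : Expr → ℕ
  | .lit n => n
  | .reg x => s.reg x
  | .cell a e => s.arr a (e.eval s)
  | .bin o e f => o.apply (e.eval s) (f.eval s)

/-- The number of steps to evaluate an expression: one for each literal, access or operation. -/
def Expr.cost : Expr → ℕ
  | .lit _ => 1
  | .reg _ => 1
  | .cell _ e => e.cost + 1
  | .bin _ e f => e.cost + f.cost + 1

/-- All numbers, including addresses, met in the evaluation of an expression are at most `B`. -/
def Expr.Fits (B : ℕ) (s : Memory) : Expr → Prop
  | .lit n => n ≤ B
  | .reg x => s.reg x ≤ B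
  | .cell a e => e.Fits B s ∧ s.arr a (e.eval s) ≤ B
  | .bin o e f => e.Fits B s ∧ f.Fits B s ∧ o.apply (e.eval s) (f.eval s) ≤ B

/-- Programs. -/
inductive Program where
  | skip
  | assign (x : ℕ) (e : Expr)
  | store (a : ℕ) (addr e : Expr)
  | seq (p q : Program)
  | cond (e : Expr) (p q : Program)
  | loop (e : Expr) (p : Program)

/-- Write `v` into register `x`. -/
def Memory.setReg (s : Memory) (x v : ℕ) : Memory :=
  { s with reg := Function.update s.reg x v }

/-- Write `v` into cell `i` of array `a`. -/
def Memory.setCell (s : Memory) (a i v : ℕ) : Memory :=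
  { s with arr := Function.update s.arr a (Function.update (s.arr a) i v) }

/-- `Runs B p s t s'`: started in memory `s`, the program `p` halts after exactly `t` steps in
memory `s'`, and all numbers that it handles are at most `B`. Conditions are true if nonzero. -/
inductive Runs (B : ℕ) : Program → Memory → ℕ → Memory → Prop
  | skip (s : Memory) : Runs B .skip s 1 s
  | assign (s : Memory) (x : ℕ) (e : Expr) (he : e.Fits B s) :
      Runs B (.assign x e) s (e.cost + 1) (s.setReg x (e.eval s))
  | store (s : Memory) (a : ℕ) (i e : Expr) (hi : i.Fits B s) (he : e.Fits B s) :
      Runs B (.store a i e) s (i.cost + e.cost + 1) (s.setCell a (i.eval s) (e.eval s))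
  | seq (p q : Program) (s s' s'' : Memory) (t t' : ℕ)
      (hp : Runs B p s t s') (hq : Runs B q s' t' s'') :
      Runs B (.seq p q) s (t + t') s''
  | cond_true (e : Expr) (p q : Program) (s s' : Memory) (t : ℕ)
      (hf : e.Fits B s) (he : e.eval s ≠ 0) (hp : Runs B p s t s') :
      Runs B (.cond e p q) s (e.cost + 1 + t) s'
  | cond_false (e : Expr) (p q : Program) (s s' : Memory) (t : ℕ)
      (hf : e.Fits B s) (he : e.eval s = 0) (hq : Runs B q s t s') :
      Runs B (.cond e p q) s (e.cost + 1 + t) s'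
  | loop_true (e : Expr) (p : Program) (s s' s'' : Memory) (t t' : ℕ)
      (hf : e.Fits B s) (he : e.eval s ≠ 0) (hp : Runs B p s t s')
      (hl : Runs B (.loop e p) s' t' s'') :
      Runs B (.loop e p) s (e.cost + 1 + t + t') s''
  | loop_false (e : Expr) (p : Program) (s : Memory)
      (hf : e.Fits B s) (he : e.eval s = 0) :
      Runs B (.loop e p) s (e.cost + 1) s

/-- The initial memory: registers `0, 1, 2, 3` hold `W, K, N, M`; cell `m * N + t` of array `0`
holds the word at position `t` of document `m`; everything else is zero. -/
def input {W N M : ℕ} (K : ℕ) (D : Corpus W N M) : Memory where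
  reg x := match x with
    | 0 => W
    | 1 => K
    | 2 => N
    | 3 => M
    | _ => 0
  arr a i := match a with
    | 0 => ∑ m : Fin M, ∑ t : Fin N, if (m : ℕ) * N + (t : ℕ) = i then (D m t : ℕ) else 0
    | _ => 0

/-- The set of words that is read off the final memory: those marked by a nonzero entry in
array `1`. -/
def output (W : ℕ) (s : Memory) : Set (Fin W) := {i | s.arr 1 (i : ℕ) ≠ 0}

/-- Started on the corpus `D`, with `K` given, and with words of `O(log (W + M + K + N))` bits
(numbers up to `(W + M + K + N + 2) ^ c`), the program halts within `τ` steps and outputs `S`. -/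
def Outputs (p : Program) (c : ℕ) {W N M : ℕ} (K : ℕ) (D : Corpus W N M) (τ : ℕ)
    (S : Set (Fin W)) : Prop :=
  ∃ (t : ℕ) (s : Memory),
    Runs ((W + M + K + N + 2) ^ c) p (input K D) t s ∧ t ≤ τ ∧ output W s = S

end WordRAM

/-! ## The search for novel words

The rows of the co-occurrence matrix, normalized to sum `1`, converge to points of which exactly
those that belong to novel words are extreme. For every word, a perceptron with margin looks for a
direction in which its row exceeds all rows that are not close to it, and the word is accepted if
the perceptron makes few mistakes. -/

/-! Divide the co-occurrence probabilities of a word `i` with all words by the frequency of `i`.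
With `β` the topic matrix and `a` the prior mean, the resulting row is a convex combination of one
point per topic (a normalized row of `R βᵀ`), with weights proportional to `β i k * a k`. A novel
word sits at the point of its topic. As `R'` is simplicial, each of its rows lies outside the closed
convex hull of the others, and Hahn-Banach provides a strictly separating functional. The coordinate
of a topic point at a novel word is an entry of `R'` times a positive factor that depends on that
word only, so the functional carries over to the topic points (`exists_separating`). Hence the row
of a novel word can be separated from every different row (`exists_separating_novel`), while the row
of any other word of positive frequency is a convex combination of rows of novel words, all
different from it (`exists_convex_combination`).

A perceptron tells the two cases apart. For word `i` it seeks a direction `u` with `⟨u, pᵢ - pⱼ⟩ >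
1` for all words `j` whose empirical row `pⱼ` is not close to `pᵢ`; close rows are exempt because
novel words of one topic share their limit row. If a direction `g` separates with margin one, then
after `n` mistakes `⟨g, u⟩ ≥ n` and `‖u‖² ≤ (W + 2) n`, so `n` is bounded independently of `M`
(`mistakes_le`). If `pᵢ` is almost a convex combination of far rows, averaging the inequalities
shows that no round is free of mistakes (`le_mistakes`). So the number of mistakes is compared with
the number `T` of rounds.

The choice `T = ⌈M ^ (1/4)⌉` balances everything. It tends to infinity and so exceeds the perceptron
bound. The direction has entries at most `T * W`, so the rows are needed up to an error of order `1
/ T`; Chebyshev's inequality gives this since `T² / M → 0`. The threshold `M ^ (-1/4)` for closeness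
tends to zero but is not below the resulting error.

Counting takes order `M * N²` steps and the search order `W³ * T`, up to lower-order terms. The
program gives up unless `(W + N + 1) ^ 4 ≤ M`, which makes both `O(M²)` and holds eventually for
fixed `W` and `N`. It is verified by tracing every loop through explicit states. -/

/-- The co-occurrence counts (flattened, row by row) together with their row sums. -/
structure CoocData where
  W : ℕ
  M : ℕ
  C : ℕ → ℕ
  c : ℕ → ℕ

/-- The state of the perceptron: positive and negative parts of the direction, and the number of
mistakes made so far. -/
structure Perceptron where
  pos : ℕ → ℕ
  neg : ℕ → ℕ
  mistakes : ℕ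

/-- The initial state of the perceptron. -/
def Perceptron.init : Perceptron := ⟨fun _ => 0, fun _ => 0, 0⟩

namespace CoocData

variable (d : CoocData)

/-- Row `i`, normalized to sum about `M`. -/
def row (i l : ℕ) : ℕ := d.M * d.C (i * d.W + l) / d.c i

/-- The positive part of the inner product of the direction with the difference of two rows, up to
coordinate `k`. -/
def dotPos (σ : Perceptron) (i j k : ℕ) : ℕ :=
  ∑ l ∈ Finset.range k, (σ.pos l * d.row i l + σ.neg l * d.row j l)

/-- The negative part of the inner product of the direction with the difference of two rows, up to
coordinate `k`. -/
def dotNeg (σ : Perceptron) (i j k : ℕ) : ℕ :=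
  ∑ l ∈ Finset.range k, (σ.pos l * d.row j l + σ.neg l * d.row i l)

/-- The `ℓ¹` distance of two rows, up to coordinate `k`. -/
def gap (i j k : ℕ) : ℕ :=
  ∑ l ∈ Finset.range k, ((d.row i l - d.row j l) + (d.row j l - d.row i l))

/-- Nonzero if word `j` occurs, its row is not close to that of word `i`, and it is not exceeded
with margin `M ^ 2` by row `i` in the direction of the perceptron. -/
def violation (σ : Perceptron) (i j : ℕ) : ℕ :=
  d.c j * (d.gap i j d.W * d.gap i j d.W * d.gap i j d.W * d.gap i j d.W - d.M * d.M * d.M) *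
    (d.dotNeg σ i j d.W + d.M * d.M + 1 - d.dotPos σ i j d.W)

/-- The direction after a mistake. -/
def update (σ : Perceptron) (i j k : ℕ) : Perceptron where
  pos l := if l < k then σ.pos l + d.row i l else σ.pos l
  neg l := if l < k then σ.neg l + d.row j l else σ.neg l
  mistakes := σ.mistakes + 1

/-- One step of the perceptron for word `i`, at word `j`. -/
def step (i : ℕ) (σ : Perceptron) (j : ℕ) : Perceptron :=
  if d.violation σ i j = 0 then σ else d.update σ i j d.W

/-- The first `k` steps of a round. -/
def pass (i : ℕ) (σ : Perceptron) : ℕ → Perceptron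
  | 0 => σ
  | k + 1 => d.step i (pass i σ k) k

/-- The state after a number of rounds. -/
def rounds (i : ℕ) : ℕ → Perceptron
  | 0 => .init
  | r + 1 => d.pass i (rounds i r) d.W

end CoocData

/-! ### The number of rounds -/

theorem exists_le_pow_four (M : ℕ) : ∃ r : ℕ, M ≤ r * r * r * r :=
  ⟨M, by rcases Nat.eq_zero_or_pos M with rfl | h
         · simp
         · nlinarith [Nat.mul_le_mul h h, Nat.mul_le_mul (Nat.mul_le_mul h h) h]⟩

/-- The number of rounds: the fourth root of the number of documents, rounded up. -/
def numRounds (M : ℕ) : ℕ := Nat.find (exists_le_pow_four M)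

theorem le_numRounds_pow (M : ℕ) :
    M ≤ numRounds M * numRounds M * numRounds M * numRounds M :=
  Nat.find_spec (exists_le_pow_four M)

theorem pow_lt_of_lt_numRounds {M r : ℕ} (h : r < numRounds M) : r * r * r * r < M :=
  not_le.1 (Nat.find_min (exists_le_pow_four M) h)

theorem numRounds_le (M : ℕ) : numRounds M ≤ M := by
  refine Nat.find_min' (exists_le_pow_four M) ?_
  rcases Nat.eq_zero_or_pos M with rfl | h
  · simp
  · nlinarith [Nat.mul_le_mul h h, Nat.mul_le_mul (Nat.mul_le_mul h h) h]

/-- By minimality the predecessor of the number of rounds has fourth power below `M`, and rounding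
up at most doubles it. -/
theorem numRounds_pow_four_le {M : ℕ} (hM : 1 ≤ M) : numRounds M ^ 4 ≤ 16 * M := by
  obtain h | h := Nat.lt_or_ge (numRounds M) 2
  · have : numRounds M ^ 4 ≤ 1 ^ 4 := Nat.pow_le_pow_left (by omega) 4
    omega
  · have h1 := pow_lt_of_lt_numRounds (M := M) (r := numRounds M - 1) (by omega)
    have h2 : numRounds M ≤ 2 * (numRounds M - 1) := by omega
    have h3 := Nat.pow_le_pow_left h2 4
    have h4 : (2 * (numRounds M - 1)) ^ 4 = 16 * ((numRounds M - 1) * (numRounds M - 1) *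
      (numRounds M - 1) * (numRounds M - 1)) := by ring
    omega

/-- The co-occurrence data of a matrix of counts. -/
def coocData {W : ℕ} (M : ℕ) (A : Matrix (Fin W) (Fin W) ℕ) : CoocData where
  W := W
  M := M
  C a := ∑ i : Fin W, ∑ j : Fin W, (if (i : ℕ) * W + (j : ℕ) = a then 1 else 0) * A i j
  c a := ∑ i : Fin W, ∑ j : Fin W, (if (i : ℕ) = a then 1 else 0) * A i j

/-- The novel words that are found: nothing if the number of documents is too small for the counts
to be reliable, and otherwise the words for which the perceptron makes fewer mistakes than it goes
through rounds. -/
def recoverNovelWords (W _K N M : ℕ) (A : Matrix (Fin W) (Fin W) ℕ) : Set (Fin W) :=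
  {i | (W + N + 1) * (W + N + 1) * (W + N + 1) * (W + N + 1) ≤ M ∧
    (coocData M A).c i *
      (numRounds M - ((coocData M A).rounds i (numRounds M)).mistakes) ≠ 0}

/-! ## Running times of programs -/

namespace WordRAM

/-- All numbers in memory are at most `V`. -/
def Memory.Bdd (V : ℕ) (s : Memory) : Prop := (∀ x, s.reg x ≤ V) ∧ ∀ a i, s.arr a i ≤ V

/-- All literals of an expression are at most `2`. -/
def Expr.SmallLits : Expr → Bool
  | .lit n => decide (n ≤ 2)
  | .reg _ => true
  | .cell _ e => e.SmallLits
  | .bin _ e f => e.SmallLits && f.SmallLits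

theorem Expr.cost_pos (e : Expr) : 1 ≤ e.cost := by
  cases e <;> simp [Expr.cost]

/-- For bounds that are at least `2`, a sum is at most a product, so no operation does worse than
multiplying the bounds. -/
theorem Op.apply_le_pow {V a b x y : ℕ} (hV : 2 ≤ V) (hx : 1 ≤ x) (hy : 1 ≤ y) (o : Op)
    (ha : a ≤ V ^ x) (hb : b ≤ V ^ y) : o.apply a b ≤ V ^ (x + y + 1) := by
  have h1 : V ^ x * V ^ y ≤ V ^ (x + y + 1) := by
    rw [← pow_add]; exact Nat.pow_le_pow_right (by omega) (by omega)
  have h2 : 2 ≤ V ^ x := hV.trans (Nat.le_self_pow (by omega) V)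
  have h3 : 2 ≤ V ^ y := hV.trans (Nat.le_self_pow (by omega) V)
  have h4 : V ^ x + V ^ y ≤ V ^ x * V ^ y := by nlinarith
  have h5 := Nat.mul_le_mul ha hb
  have h6 := Nat.div_le_self a b
  cases o <;> simp only [Op.apply] <;> omega

/-- Each step of evaluation costs at most one more factor `V`. Word-size obligations thereby reduce
to a bound on the memory and a numerical check of the cost. -/
theorem Expr.fits_and_eval_le {V : ℕ} (hV : 2 ≤ V) {s : Memory} (hs : s.Bdd V) {q : ℕ} :
    ∀ e : Expr, e.SmallLits = true → e.cost ≤ q → e.Fits (V ^ q) s ∧ e.eval s ≤ V ^ e.cost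
  | .lit n, hl, hq => by
      have hn : n ≤ V := (by simpa [SmallLits] using hl : n ≤ 2).trans hV
      simp only [cost] at hq
      exact ⟨hn.trans (Nat.le_self_pow (by omega) V), by simpa [eval, cost] using hn⟩
  | .reg x, _, hq => by
      simp only [cost] at hq
      exact ⟨(hs.1 x).trans (Nat.le_self_pow (by omega) V), by simpa [eval, cost] using hs.1 x⟩
  | .cell a e, hl, hq => by
      simp only [cost] at hq
      have h := fits_and_eval_le hV hs (q := q) e hl (by omega)
      exact ⟨⟨h.1, (hs.2 a _).trans (Nat.le_self_pow (by omega) V)⟩,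
        (hs.2 a _).trans (Nat.le_self_pow (by simp [cost]) V)⟩
  | .bin o e f, hl, hq => by
      simp only [cost] at hq
      simp only [SmallLits, Bool.and_eq_true] at hl
      have h := fits_and_eval_le hV hs (q := q) e hl.1 (by omega)
      have h' := fits_and_eval_le hV hs (q := q) f hl.2 (by omega)
      have := Op.apply_le_pow hV e.cost_pos f.cost_pos o h.2 h'.2
      exact ⟨⟨h.1, h'.1, this.trans (Nat.pow_le_pow_right (by omega) hq)⟩, this⟩

theorem Expr.fits {V : ℕ} (hV : 2 ≤ V) {s : Memory} (hs : s.Bdd V) {q : ℕ} (e : Expr)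
    (hl : e.SmallLits = true) (hq : e.cost ≤ q) : e.Fits (V ^ q) s :=
  (e.fits_and_eval_le hV hs hl hq).1

/-- The program runs from one memory to another within `τ` steps. -/
def Reach (B : ℕ) (p : Program) (τ : ℕ) (s s' : Memory) : Prop :=
  ∃ t, t ≤ τ ∧ Runs B p s t s'

namespace Reach

variable {B τ τ' : ℕ} {p q : Program} {s s' s'' : Memory} {e : Expr}

theorem mono (h : Reach B p τ s s') (hτ : τ ≤ τ') : Reach B p τ' s s' :=
  let ⟨t, ht, hr⟩ := h
  ⟨t, ht.trans hτ, hr⟩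

theorem seq (h : Reach B p τ s s') (h' : Reach B q τ' s' s'') :
    Reach B (.seq p q) (τ + τ') s s'' :=
  let ⟨_, ht, hr⟩ := h
  let ⟨_, ht', hr'⟩ := h'
  ⟨_, add_le_add ht ht', .seq _ _ _ _ _ _ _ hr hr'⟩

theorem skip : Reach B .skip 1 s s := ⟨1, le_rfl, .skip s⟩

theorem cond_true (hf : e.Fits B s) (he : e.eval s ≠ 0) (h : Reach B p τ s s') :
    Reach B (.cond e p q) (e.cost + 1 + τ) s s' :=
  let ⟨_, ht, hr⟩ := h
  ⟨_, by omega, .cond_true _ _ _ _ _ _ hf he hr⟩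

theorem cond_false (hf : e.Fits B s) (he : e.eval s = 0) (h : Reach B q τ s s') :
    Reach B (.cond e p q) (e.cost + 1 + τ) s s' :=
  let ⟨_, ht, hr⟩ := h
  ⟨_, by omega, .cond_false _ _ _ _ _ _ hf he hr⟩

/-- The sequence `f` is the loop invariant in explicit form; the last summand of the time pays for
the final, failing test. -/
theorem loop (f : ℕ → Memory) (n : ℕ) (hf : ∀ k ≤ n, e.Fits B (f k))
    (ht : ∀ k < n, e.eval (f k) ≠ 0) (hn : e.eval (f n) = 0)
    (hp : ∀ k < n, Reach B p τ (f k) (f (k + 1))) :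
    Reach B (.loop e p) (n * (e.cost + 1 + τ) + (e.cost + 1)) (f 0) (f n) := by
  suffices h : ∀ m k, k + m = n →
      Reach B (.loop e p) (m * (e.cost + 1 + τ) + (e.cost + 1)) (f k) (f n) from
    h n 0 (by omega)
  intro m
  induction m with
  | zero =>
      rintro k rfl
      exact ⟨_, by simp, .loop_false _ _ _ (hf _ (by omega)) hn⟩
  | succ m ih =>
      intro k hk
      obtain ⟨t, htt, hr⟩ := hp k (by omega)
      obtain ⟨t', htt', hr'⟩ := ih (k + 1) (by omega)
      refine ⟨_, ?_, .loop_true _ _ _ _ _ _ _ (hf k (by omega)) (ht k (by omega)) hr hr'⟩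
      rw [Nat.succ_mul]
      omega

variable {V : ℕ}

/-- The exponent `60` is a common bound for the costs of all expressions in the program, so one word
size serves every instruction. -/
theorem assign (hV : 2 ≤ V) (hs : s.Bdd V) (x : ℕ) (e : Expr)
    (hl : e.SmallLits = true := by rfl) (hq : e.cost ≤ 60 := by decide) :
    Reach (V ^ 60) (.assign x e) 61 s (s.setReg x (e.eval s)) :=
  ⟨_, by omega, .assign _ _ _ (e.fits hV hs hl hq)⟩

theorem store (hV : 2 ≤ V) (hs : s.Bdd V) (a : ℕ) (i e : Expr)
    (hl : i.SmallLits = true := by rfl) (hq : i.cost ≤ 60 := by decide)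
    (hl' : e.SmallLits = true := by rfl) (hq' : e.cost ≤ 60 := by decide) :
    Reach (V ^ 60) (.store a i e) 121 s (s.setCell a (i.eval s) (e.eval s)) :=
  ⟨_, by omega, .store _ _ _ _ (i.fits hV hs hl hq) (e.fits hV hs hl' hq')⟩

end Reach

end WordRAM

/-! ## The program -/

namespace NovelWordProgram

open WordRAM

/-- The memory of the program: the input, loop counters `i`, `r`, `j`, `l`, accumulators `A`, `B`,
`F`, the number of mistakes `n`, and the arrays. -/
@[ext]
structure State where
  W : ℕ
  K : ℕ
  N : ℕ
  M : ℕ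
  i : ℕ
  r : ℕ
  j : ℕ
  l : ℕ
  A : ℕ
  B : ℕ
  F : ℕ
  n : ℕ
  inp : ℕ → ℕ
  out : ℕ → ℕ
  C : ℕ → ℕ
  c : ℕ → ℕ
  P : ℕ → ℕ
  Q : ℕ → ℕ

namespace State

/-- The memory that represents a state. -/
def mem (st : State) : Memory where
  reg x := match x with
    | 0 => st.W
    | 1 => st.K
    | 2 => st.N
    | 3 => st.M
    | 4 => st.i
    | 5 => st.r
    | 6 => st.j
    | 7 => st.l
    | 8 => st.A
    | 9 => st.B
    | 10 => st.F
    | 11 => st.n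
    | _ => 0
  arr a := match a with
    | 0 => st.inp
    | 1 => st.out
    | 2 => st.C
    | 3 => st.c
    | 4 => st.P
    | 5 => st.Q
    | _ => fun _ => 0

/-- All numbers in a state are at most `V`. -/
structure Ok (V : ℕ) (st : State) : Prop where
  W : st.W ≤ V
  K : st.K ≤ V
  N : st.N ≤ V
  M : st.M ≤ V
  i : st.i ≤ V
  r : st.r ≤ V
  j : st.j ≤ V
  l : st.l ≤ V
  A : st.A ≤ V
  B : st.B ≤ V
  F : st.F ≤ V
  n : st.n ≤ V
  inp : ∀ a, st.inp a ≤ V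
  out : ∀ a, st.out a ≤ V
  C : ∀ a, st.C a ≤ V
  c : ∀ a, st.c a ≤ V
  P : ∀ a, st.P a ≤ V
  Q : ∀ a, st.Q a ≤ V

theorem Ok.bdd {V : ℕ} {st : State} (h : st.Ok V) : st.mem.Bdd V := by
  obtain ⟨h0, h1, h2, h3, h4, h5, h6, h7, h8, h9, h10, h11, k0, k1, k2, k3, k4, k5⟩ := h
  constructor
  · intro x
    simp only [mem]
    split <;> first | assumption | exact Nat.zero_le _
  · intro a i
    simp only [mem]
    split <;> first | exact Nat.zero_le _ | apply_assumption

variable (st : State) (v x : ℕ)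

/-- This and `mem_setCell_eq` turn memory writes into record updates of `State`, after which most
comparisons of states hold by `rfl`. -/
theorem mem_setReg_eq {s : Memory} {f : ℕ → ℕ} (h : ∀ y, s.reg y = f y) {st : State}
    (hr : ∀ y, Function.update f x v y = st.mem.reg y) (ha : s.arr = st.mem.arr) :
    s.setReg x v = st.mem := by
  rcases s with ⟨r, a⟩
  obtain rfl : r = f := funext h
  simp only [Memory.setReg]
  rw [show Function.update r x v = st.mem.reg from funext hr]
  simp only at ha
  rw [ha]

theorem setReg_i : st.mem.setReg 4 v = { st with i := v }.mem := by
  refine mem_setReg_eq _ _ (fun _ => rfl) (fun y => ?_) rfl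
  simp only [Function.update_apply, mem]
  split_ifs with h
  · subst h; rfl
  · split <;> first | rfl | exact absurd rfl h

theorem setReg_r : st.mem.setReg 5 v = { st with r := v }.mem := by
  refine mem_setReg_eq _ _ (fun _ => rfl) (fun y => ?_) rfl
  simp only [Function.update_apply, mem]
  split_ifs with h
  · subst h; rfl
  · split <;> first | rfl | exact absurd rfl h

theorem setReg_j : st.mem.setReg 6 v = { st with j := v }.mem := by
  refine mem_setReg_eq _ _ (fun _ => rfl) (fun y => ?_) rfl
  simp only [Function.update_apply, mem]
  split_ifs with h
  · subst h; rfl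
  · split <;> first | rfl | exact absurd rfl h

theorem setReg_l : st.mem.setReg 7 v = { st with l := v }.mem := by
  refine mem_setReg_eq _ _ (fun _ => rfl) (fun y => ?_) rfl
  simp only [Function.update_apply, mem]
  split_ifs with h
  · subst h; rfl
  · split <;> first | rfl | exact absurd rfl h

theorem setReg_A : st.mem.setReg 8 v = { st with A := v }.mem := by
  refine mem_setReg_eq _ _ (fun _ => rfl) (fun y => ?_) rfl
  simp only [Function.update_apply, mem]
  split_ifs with h
  · subst h; rfl
  · split <;> first | rfl | exact absurd rfl h

theorem setReg_B : st.mem.setReg 9 v = { st with B := v }.mem := by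
  refine mem_setReg_eq _ _ (fun _ => rfl) (fun y => ?_) rfl
  simp only [Function.update_apply, mem]
  split_ifs with h
  · subst h; rfl
  · split <;> first | rfl | exact absurd rfl h

theorem setReg_F : st.mem.setReg 10 v = { st with F := v }.mem := by
  refine mem_setReg_eq _ _ (fun _ => rfl) (fun y => ?_) rfl
  simp only [Function.update_apply, mem]
  split_ifs with h
  · subst h; rfl
  · split <;> first | rfl | exact absurd rfl h

theorem setReg_n : st.mem.setReg 11 v = { st with n := v }.mem := by
  refine mem_setReg_eq _ _ (fun _ => rfl) (fun y => ?_) rfl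
  simp only [Function.update_apply, mem]
  split_ifs with h
  · subst h; rfl
  · split <;> first | rfl | exact absurd rfl h

theorem mem_setCell_eq {s : Memory} {a i w : ℕ} {st : State}
    (hr : s.reg = st.mem.reg)
    (ha : ∀ y, Function.update s.arr a (Function.update (s.arr a) i w) y = st.mem.arr y) :
    s.setCell a i w = st.mem := by
  rcases s with ⟨r, b⟩
  simp only [Memory.setCell]
  rw [show Function.update b a (Function.update (b a) i w) = st.mem.arr from funext ha]
  simp only at hr
  rw [hr]

theorem setCell_out : st.mem.setCell 1 x v = { st with out := Function.update st.out x v }.mem := by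
  refine mem_setCell_eq rfl (fun y => ?_)
  rw [Function.update_apply]
  split_ifs with h
  · subst h; rfl
  · simp only [mem]
    split <;> first | rfl | exact absurd rfl h

theorem setCell_C : st.mem.setCell 2 x v = { st with C := Function.update st.C x v }.mem := by
  refine mem_setCell_eq rfl (fun y => ?_)
  rw [Function.update_apply]
  split_ifs with h
  · subst h; rfl
  · simp only [mem]
    split <;> first | rfl | exact absurd rfl h

theorem setCell_c : st.mem.setCell 3 x v = { st with c := Function.update st.c x v }.mem := by
  refine mem_setCell_eq rfl (fun y => ?_)
  rw [Function.update_apply]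
  split_ifs with h
  · subst h; rfl
  · simp only [mem]
    split <;> first | rfl | exact absurd rfl h

theorem setCell_P : st.mem.setCell 4 x v = { st with P := Function.update st.P x v }.mem := by
  refine mem_setCell_eq rfl (fun y => ?_)
  rw [Function.update_apply]
  split_ifs with h
  · subst h; rfl
  · simp only [mem]
    split <;> first | rfl | exact absurd rfl h

theorem setCell_Q : st.mem.setCell 5 x v = { st with Q := Function.update st.Q x v }.mem := by
  refine mem_setCell_eq rfl (fun y => ?_)
  rw [Function.update_apply]
  split_ifs with h
  · subst h; rfl
  · simp only [mem]
    split <;> first | rfl | exact absurd rfl h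

end State

end NovelWordProgram

namespace WordRAM

/-- Sum of two expressions. -/
abbrev Expr.add (e f : Expr) : Expr := .bin .add e f

/-- Truncated difference of two expressions. -/
abbrev Expr.sub (e f : Expr) : Expr := .bin .sub e f

/-- Product of two expressions. -/
abbrev Expr.mul (e f : Expr) : Expr := .bin .mul e f

/-- Quotient of two expressions. -/
abbrev Expr.div (e f : Expr) : Expr := .bin .div e f

theorem Reach.loop_of_eq {B τ : ℕ} {p : Program} {s s' : Memory} {e : Expr} (f : ℕ → Memory)
    (n q : ℕ) (hq : e.cost = q) (h0 : f 0 = s) (hn : f n = s') (hf : ∀ k ≤ n, e.Fits B (f k))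
    (ht : ∀ k < n, e.eval (f k) ≠ 0) (he : e.eval (f n) = 0)
    (hp : ∀ k < n, Reach B p τ (f k) (f (k + 1))) :
    Reach B (.loop e p) (n * (q + 1 + τ) + (q + 1)) s s' := by
  subst h0 hn hq
  exact Reach.loop f n hf ht he hp

end WordRAM

/-! ### The counting phase of the program -/

namespace NovelWordProgram

open WordRAM WordRAM.Expr

theorem reach_congr {B τ : ℕ} {p : Program} {s : Memory} {st st' : State}
    (h : Reach B p τ s st.mem) (hst : st = st') : Reach B p τ s st'.mem := hst ▸ h

/-- Register `W`. -/
abbrev eW : Expr := .reg 0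
/-- Register `N`. -/
abbrev eN : Expr := .reg 2
/-- Register `M`. -/
abbrev eM : Expr := .reg 3
/-- Register `i`. -/
abbrev eI : Expr := .reg 4
/-- Register `r`. -/
abbrev eR : Expr := .reg 5
/-- Register `j`. -/
abbrev eJ : Expr := .reg 6
/-- Register `l`. -/
abbrev eL : Expr := .reg 7
/-- Register `A`. -/
abbrev eA : Expr := .reg 8
/-- Register `B`. -/
abbrev eB : Expr := .reg 9
/-- Register `F`. -/
abbrev eF : Expr := .reg 10
/-- Register `n`. -/
abbrev eMist : Expr := .reg 11

/-- Word number `t` of document `i`. -/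
def eWord (t : Expr) : Expr := .cell 0 (add (mul eI eN) t)

/-- The address of the pair of words at positions `r` and `j` of document `i`. -/
def ePair : Expr := add (mul (eWord eR) eW) (eWord eJ)

/-- Count the pair of positions `r` and `j` of document `i`. -/
def countStep : Program :=
  .seq (.cond (add (sub eR eJ) (sub eJ eR))
    (.seq (.store 2 ePair (add (.cell 2 ePair) (.lit 1)))
      (.store 3 (eWord eR) (add (.cell 3 (eWord eR)) (.lit 1)))) .skip)
    (.assign 6 (add eJ (.lit 1)))

/-- Count the pairs with first position `r` of document `i`. -/
def countPosition : Program :=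
  .seq (.loop (sub eN eJ) countStep) (.seq (.assign 6 (.lit 0)) (.assign 5 (add eR (.lit 1))))

/-- Count the pairs in document `i`. -/
def countDocument : Program :=
  .seq (.loop (sub eN eR) countPosition)
    (.seq (.assign 5 (.lit 0)) (.assign 4 (add eI (.lit 1))))

/-- Count all pairs. -/
def countAll : Program :=
  .seq (.loop (sub eM eI) countDocument) (.assign 4 (.lit 0))

/-- Whether the pair of positions `s`, `t` of document `m` is to be counted at address `a`, where
`g` computes the address from the pair of words. -/
def hit (g : ℕ → ℕ → ℕ) (inp : ℕ → ℕ) (N m s t a : ℕ) : ℕ :=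
  if s ≠ t ∧ g (inp (m * N + s)) (inp (m * N + t)) = a then 1 else 0

/-- The number of hits with first position `s`. -/
def hitsAt (g : ℕ → ℕ → ℕ) (inp : ℕ → ℕ) (N m s k a : ℕ) : ℕ :=
  ∑ t ∈ Finset.range k, hit g inp N m s t a

/-- The number of hits in document `m`. -/
def hitsIn (g : ℕ → ℕ → ℕ) (inp : ℕ → ℕ) (N m k a : ℕ) : ℕ :=
  ∑ s ∈ Finset.range k, hitsAt g inp N m s N a

/-- The number of hits in the first `k` documents. -/
def hits (g : ℕ → ℕ → ℕ) (inp : ℕ → ℕ) (N k a : ℕ) : ℕ :=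
  ∑ m ∈ Finset.range k, hitsIn g inp N m N a

section Bounds

variable (g : ℕ → ℕ → ℕ) (inp : ℕ → ℕ) (N m s k a : ℕ)

theorem hitsAt_le : hitsAt g inp N m s k a ≤ k := by
  refine (Finset.sum_le_card_nsmul _ _ 1 fun t _ => ?_).trans (by simp)
  unfold hit
  split_ifs <;> omega

theorem hitsIn_le : hitsIn g inp N m k a ≤ k * N := by
  refine (Finset.sum_le_card_nsmul _ _ N fun t _ => ?_).trans (by simp)
  exact hitsAt_le _ _ _ _ _ _ _

theorem hits_le : hits g inp N k a ≤ k * (N * N) := by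
  refine (Finset.sum_le_card_nsmul _ _ (N * N) fun t _ => ?_).trans (by simp)
  exact hitsIn_le _ _ _ _ _ _

end Bounds

/-- The address of a pair of words. -/
def pairAddr (W x y : ℕ) : ℕ := x * W + y

/-- The address of the first word. -/
def wordAddr (x _y : ℕ) : ℕ := x

variable {V : ℕ}

theorem countStep_reach (hV : 2 ≤ V) (st : State) (h : st.Ok V)
    (hC : ∀ a, st.C a + 1 ≤ V) (hc : ∀ a, st.c a + 1 ≤ V) :
    Reach (V ^ 60) countStep 400 st.mem
      { st with
        j := st.j + 1
        C := fun a => st.C a + hit (pairAddr st.W) st.inp st.N st.i st.r st.j a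
        c := fun a => st.c a + hit wordAddr st.inp st.N st.i st.r st.j a }.mem := by
  -- Subtraction is truncated, so the sum of both differences vanishes only for equal positions.
  have hcond : (add (sub eR eJ) (sub eJ eR)).eval st.mem = (st.r - st.j) + (st.j - st.r) := rfl
  by_cases hr : st.r = st.j
  · have hh := ((Reach.cond_false (p := (.seq (.store 2 ePair (add (.cell 2 ePair) (.lit 1)))
        (.store 3 (eWord eR) (add (.cell 3 (eWord eR)) (.lit 1)))))
      (Expr.fits hV h.bdd (add (sub eR eJ) (sub eJ eR)) rfl (by decide)) (by rw [hcond]; omega)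
      Reach.skip).seq (Reach.assign hV h.bdd 6 (add eJ (.lit 1)))).mono (τ' := 400) (by decide)
    rw [State.setReg_j] at hh
    refine reach_congr hh ?_
    have h0 : ∀ g a, hit g st.inp st.N st.i st.r st.j a = 0 := fun g a => by simp [hit, hr]
    simp only [h0]
    rfl
  · let p := ePair.eval st.mem
    let w := (eWord eR).eval st.mem
    have h1 : ({ st with C := Function.update st.C p (st.C p + 1) } : State).Ok V :=
      { h with
        C := fun a => by
          simp only [Function.update_apply]
          split_ifs
          · exact hC _
          · exact h.C a }
    have h2 : ({ st with
        C := Function.update st.C p (st.C p + 1)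
        c := Function.update st.c w (st.c w + 1) } : State).Ok V :=
      { h1 with
        c := fun a => by
          simp only [Function.update_apply]
          split_ifs
          · exact hc _
          · exact h.c a }
    have e1 := Reach.store hV h.bdd 2 ePair (add (.cell 2 ePair) (.lit 1))
    rw [State.setCell_C] at e1
    have e2 := Reach.store hV h1.bdd 3 (eWord eR) (add (.cell 3 (eWord eR)) (.lit 1))
    rw [State.setCell_c] at e2
    have e3 := Reach.assign hV h2.bdd 6 (add eJ (.lit 1))
    rw [State.setReg_j] at e3
    have := ((Reach.cond_true (q := .skip) (Expr.fits hV h.bdd (add (sub eR eJ) (sub eJ eR)) rfl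
      (by decide)) (by rw [hcond]; omega) (e1.seq e2)).seq e3).mono (τ' := 400) (by decide)
    refine reach_congr this ?_
    have hu : ∀ (f : ℕ → ℕ) (b : ℕ), (fun a => f a + if b = a then 1 else 0) =
        Function.update f b (f b + 1) := by
      intro f b
      funext a
      rw [Function.update_apply]
      by_cases hab : a = b
      · simp [hab]
      · simp [hab, Ne.symm hab]
    have h0 : ∀ g a, hit g st.inp st.N st.i st.r st.j a =
        if g (st.inp (st.i * st.N + st.r)) (st.inp (st.i * st.N + st.j)) = a then 1 else 0 :=
      fun g a => by simp [hit, hr]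
    simp only [h0, hu]
    rfl

/-- Counters are zero on entry and reset on exit, so that the loops nest. The slack required in the
bounds for the counts is room for the increments made inside the loop. -/
theorem countPosition_reach (hV : 2 ≤ V) (st : State) (h : st.Ok V) (hj : st.j = 0)
    (hN : st.N + 1 ≤ V)
    (hC : ∀ a, st.C a + (st.N + 1) ≤ V) (hc : ∀ a, st.c a + (st.N + 1) ≤ V) :
    Reach (V ^ 60) countPosition (st.N * 410 + 200) st.mem
      { st with
        r := st.r + 1
        C := fun a => st.C a + hitsAt (pairAddr st.W) st.inp st.N st.i st.r st.N a
        c := fun a => st.c a + hitsAt wordAddr st.inp st.N st.i st.r st.N a }.mem := by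
  let f : ℕ → State := fun k =>
    { st with
      j := k
      C := fun a => st.C a + hitsAt (pairAddr st.W) st.inp st.N st.i st.r k a
      c := fun a => st.c a + hitsAt wordAddr st.inp st.N st.i st.r k a }
  have hf : ∀ k ≤ st.N, (f k).Ok V := fun k hk =>
    { h with
      j := by show k ≤ V; omega
      C := fun a => by
        have := hC a
        have := hitsAt_le (pairAddr st.W) st.inp st.N st.i st.r k a
        show st.C a + _ ≤ V
        omega
      c := fun a => by
        have := hc a
        have := hitsAt_le wordAddr st.inp st.N st.i st.r k a
        show st.c a + _ ≤ V
        omega }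
  have e1 : Reach (V ^ 60) (.loop (sub eN eJ) countStep) (st.N * 404 + 4) st.mem (f st.N).mem := by
    refine Reach.loop_of_eq (τ := 400) (fun k => (f k).mem) st.N 3 rfl ?_ rfl
      (fun k hk => Expr.fits hV (hf k hk).bdd _ rfl (by decide))
      (fun k hk => ?_) ?_ (fun k hk => ?_)
    · exact congrArg State.mem (by apply State.ext <;> first | rfl | exact hj.symm)
    · show st.N - k ≠ 0
      omega
    · show st.N - st.N = 0
      omega
    · have := countStep_reach hV (f k) (hf k hk.le)
        (fun a => by
          have := hC a
          have := hitsAt_le (pairAddr st.W) st.inp st.N st.i st.r k a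
          show st.C a + _ + 1 ≤ V
          omega)
        (fun a => by
          have := hc a
          have := hitsAt_le wordAddr st.inp st.N st.i st.r k a
          show st.c a + _ + 1 ≤ V
          omega)
      refine reach_congr this ?_
      simp only [f, hitsAt, Finset.sum_range_succ, add_assoc]
  have e2 := Reach.assign hV (hf st.N le_rfl).bdd 6 (.lit 0)
  rw [State.setReg_j] at e2
  have h2 : ({ f st.N with j := 0 } : State).Ok V := { hf st.N le_rfl with j := Nat.zero_le _ }
  have e3 := Reach.assign hV h2.bdd 5 (add eR (.lit 1))
  rw [State.setReg_r] at e3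
  have := (e1.seq (e2.seq e3)).mono (τ' := st.N * 410 + 200) (by
    omega)
  refine reach_congr this ?_
  apply State.ext <;> first | rfl | exact hj.symm

theorem countDocument_reach (hV : 2 ≤ V) (st : State) (h : st.Ok V) (hj : st.j = 0)
    (hr : st.r = 0) (hN : st.N + 1 ≤ V)
    (hC : ∀ a, st.C a + (st.N * st.N + 1) ≤ V) (hc : ∀ a, st.c a + (st.N * st.N + 1) ≤ V) :
    Reach (V ^ 60) countDocument (st.N * (st.N * 410 + 210) + 200) st.mem
      { st with
        i := st.i + 1
        C := fun a => st.C a + hitsIn (pairAddr st.W) st.inp st.N st.i st.N a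
        c := fun a => st.c a + hitsIn wordAddr st.inp st.N st.i st.N a }.mem := by
  let f : ℕ → State := fun k =>
    { st with
      r := k
      C := fun a => st.C a + hitsIn (pairAddr st.W) st.inp st.N st.i k a
      c := fun a => st.c a + hitsIn wordAddr st.inp st.N st.i k a }
  have hmul : ∀ k ≤ st.N, k * st.N ≤ st.N * st.N := fun k hk => Nat.mul_le_mul_right _ hk
  have hf : ∀ k ≤ st.N, (f k).Ok V := fun k hk =>
    { h with
      r := by show k ≤ V; omega
      C := fun a => by
        have := hC a
        have := hitsIn_le (pairAddr st.W) st.inp st.N st.i k a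
        have := hmul k hk
        show st.C a + _ ≤ V
        omega
      c := fun a => by
        have := hc a
        have := hitsIn_le wordAddr st.inp st.N st.i k a
        have := hmul k hk
        show st.c a + _ ≤ V
        omega }
  have e1 : Reach (V ^ 60) (.loop (sub eN eR) countPosition)
      (st.N * (4 + (st.N * 410 + 200)) + 4) st.mem (f st.N).mem := by
    refine Reach.loop_of_eq (τ := st.N * 410 + 200) (fun k => (f k).mem) st.N 3 rfl ?_ rfl
      (fun k hk => Expr.fits hV (hf k hk).bdd _ rfl (by decide))
      (fun k hk => ?_) ?_ (fun k hk => ?_)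
    · exact congrArg State.mem (by apply State.ext <;> first | rfl | exact hr.symm)
    · show st.N - k ≠ 0
      omega
    · show st.N - st.N = 0
      omega
    · have hk1 := hmul (k + 1) hk
      rw [Nat.succ_mul] at hk1
      have := countPosition_reach hV (f k) (hf k hk.le) hj hN
        (fun a => by
          have := hC a
          have := hitsIn_le (pairAddr st.W) st.inp st.N st.i k a
          show st.C a + _ + (st.N + 1) ≤ V
          omega)
        (fun a => by
          have := hc a
          have := hitsIn_le wordAddr st.inp st.N st.i k a
          show st.c a + _ + (st.N + 1) ≤ V
          omega)
      refine reach_congr this ?_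
      simp only [f, hitsIn, Finset.sum_range_succ, add_assoc]
  have e2 := Reach.assign hV (hf st.N le_rfl).bdd 5 (.lit 0)
  rw [State.setReg_r] at e2
  have h2 : ({ f st.N with r := 0 } : State).Ok V := { hf st.N le_rfl with r := Nat.zero_le _ }
  have e3 := Reach.assign hV h2.bdd 4 (add eI (.lit 1))
  rw [State.setReg_i] at e3
  have := (e1.seq (e2.seq e3)).mono (τ' := st.N * (st.N * 410 + 210) + 200) (by
    rw [add_assoc]
    exact Nat.add_le_add (Nat.mul_le_mul_left _ (by linarith)) (by norm_num))
  refine reach_congr this ?_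
  apply State.ext <;> first | rfl | exact hr.symm

theorem countAll_reach (hV : 2 ≤ V) (st : State) (h : st.Ok V) (hj : st.j = 0)
    (hr : st.r = 0) (hi : st.i = 0) (hC0 : st.C = fun _ => 0) (hc0 : st.c = fun _ => 0)
    (hN : st.N + 1 ≤ V) (hM : st.M * (st.N * st.N) + st.M + 1 ≤ V) :
    Reach (V ^ 60) countAll (st.M * (st.N * (st.N * 410 + 210) + 210) + 200) st.mem
      { st with
        C := hits (pairAddr st.W) st.inp st.N st.M
        c := hits wordAddr st.inp st.N st.M }.mem := by
  let f : ℕ → State := fun k =>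
    { st with
      i := k
      C := hits (pairAddr st.W) st.inp st.N k
      c := hits wordAddr st.inp st.N k }
  have hmul : ∀ k ≤ st.M, k * (st.N * st.N) ≤ st.M * (st.N * st.N) :=
    fun k hk => Nat.mul_le_mul_right _ hk
  have hf : ∀ k ≤ st.M, (f k).Ok V := fun k hk =>
    { h with
      i := by show k ≤ V; omega
      C := fun a => by
        have := hits_le (pairAddr st.W) st.inp st.N k a
        have := hmul k hk
        show hits _ _ _ _ _ ≤ V
        omega
      c := fun a => by
        have := hits_le wordAddr st.inp st.N k a
        have := hmul k hk
        show hits _ _ _ _ _ ≤ V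
        omega }
  have e1 : Reach (V ^ 60) (.loop (sub eM eI) countDocument)
      (st.M * (4 + (st.N * (st.N * 410 + 210) + 200)) + 4) st.mem (f st.M).mem := by
    refine Reach.loop_of_eq (τ := st.N * (st.N * 410 + 210) + 200) (fun k => (f k).mem) st.M 3 rfl ?_ rfl
      (fun k hk => Expr.fits hV (hf k hk).bdd _ rfl (by decide))
      (fun k hk => ?_) ?_ (fun k hk => ?_)
    · exact congrArg State.mem (by
        apply State.ext <;> first | rfl | exact hi.symm | exact hC0.symm | exact hc0.symm)
    · show st.M - k ≠ 0
      omega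
    · show st.M - st.M = 0
      omega
    · have hk1 := hmul (k + 1) hk
      rw [Nat.succ_mul] at hk1
      have := countDocument_reach hV (f k) (hf k hk.le) hj hr hN
        (fun a => by
          have := hits_le (pairAddr st.W) st.inp st.N k a
          show hits _ _ _ _ _ + (st.N * st.N + 1) ≤ V
          omega)
        (fun a => by
          have := hits_le wordAddr st.inp st.N k a
          show hits _ _ _ _ _ + (st.N * st.N + 1) ≤ V
          omega)
      refine reach_congr this ?_
      apply State.ext <;> first | rfl | exact funext fun a => (Finset.sum_range_succ _ _).symm
  have e2 := Reach.assign hV (hf st.M le_rfl).bdd 4 (.lit 0)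
  rw [State.setReg_i] at e2
  have := (e1.seq e2).mono (τ' := st.M * (st.N * (st.N * 410 + 210) + 210) + 200) (by
    rw [add_assoc]
    exact Nat.add_le_add (Nat.mul_le_mul_left _ (by linarith)) (by norm_num))
  refine reach_congr this ?_
  apply State.ext <;> first | rfl | exact hi.symm

end NovelWordProgram

/-! ### Size of the numbers handled by the perceptron -/

namespace CoocData

variable (d : CoocData)

/-- The direction of the perceptron is bounded in terms of the number of mistakes, and vanishes
outside the vocabulary. -/
structure Tame (σ : Perceptron) : Prop where
  pos_le : ∀ l, σ.pos l ≤ σ.mistakes * d.M ^ 3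
  neg_le : ∀ l, σ.neg l ≤ σ.mistakes * d.M ^ 3
  pos_eq : ∀ l, d.W ≤ l → σ.pos l = 0
  neg_eq : ∀ l, d.W ≤ l → σ.neg l = 0

variable {d}

/-- A quotient is at most its numerator. This crude bound needs no relation between counts and row
sums and covers division by zero. -/
theorem row_le (hC : ∀ a, d.C a ≤ d.M ^ 2) (i l : ℕ) : d.row i l ≤ d.M ^ 3 := by
  refine (Nat.div_le_self _ _).trans ?_
  calc d.M * d.C (i * d.W + l) ≤ d.M * d.M ^ 2 := Nat.mul_le_mul_left _ (hC _)
    _ = d.M ^ 3 := by ring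

theorem tame_init : d.Tame .init := ⟨by simp [Perceptron.init], by simp [Perceptron.init],
  fun _ _ => rfl, fun _ _ => rfl⟩

theorem update_pos_le (hC : ∀ a, d.C a ≤ d.M ^ 2) {σ : Perceptron} (hσ : d.Tame σ) (i j k l : ℕ) :
    (d.update σ i j k).pos l ≤ (σ.mistakes + 1) * d.M ^ 3 := by
  have h := hσ.pos_le l
  have h' := row_le hC i l
  simp only [update, Nat.succ_mul]
  split_ifs <;> omega

theorem update_neg_le (hC : ∀ a, d.C a ≤ d.M ^ 2) {σ : Perceptron} (hσ : d.Tame σ) (i j k l : ℕ) :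
    (d.update σ i j k).neg l ≤ (σ.mistakes + 1) * d.M ^ 3 := by
  have h := hσ.neg_le l
  have h' := row_le hC j l
  simp only [update, Nat.succ_mul]
  split_ifs <;> omega

theorem tame_step (hC : ∀ a, d.C a ≤ d.M ^ 2) {σ : Perceptron} (hσ : d.Tame σ) (i j : ℕ) :
    d.Tame (d.step i σ j) := by
  unfold step
  split_ifs
  · exact hσ
  · refine ⟨update_pos_le hC hσ i j _, update_neg_le hC hσ i j _, fun l hl => ?_, fun l hl => ?_⟩
    · simp only [update, not_lt.2 hl, if_false, hσ.pos_eq l hl]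
    · simp only [update, not_lt.2 hl, if_false, hσ.neg_eq l hl]

theorem tame_pass (hC : ∀ a, d.C a ≤ d.M ^ 2) {σ : Perceptron} (hσ : d.Tame σ) (i k : ℕ) :
    d.Tame (d.pass i σ k) := by
  induction k with
  | zero => exact hσ
  | succ k ih => exact tame_step hC ih i k

theorem tame_rounds (hC : ∀ a, d.C a ≤ d.M ^ 2) (i r : ℕ) : d.Tame (d.rounds i r) := by
  induction r with
  | zero => exact tame_init
  | succ r ih => exact tame_pass hC ih i _

theorem mistakes_step_le (i : ℕ) (σ : Perceptron) (j : ℕ) :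
    (d.step i σ j).mistakes ≤ σ.mistakes + 1 := by
  unfold step
  split_ifs
  · omega
  · exact le_rfl

theorem mistakes_pass_le (i : ℕ) (σ : Perceptron) (k : ℕ) :
    (d.pass i σ k).mistakes ≤ σ.mistakes + k := by
  induction k with
  | zero => exact le_rfl
  | succ k ih =>
      have := mistakes_step_le (d := d) i (d.pass i σ k) k
      show (d.step i _ k).mistakes ≤ _
      omega

theorem mistakes_rounds_le (i r : ℕ) : (d.rounds i r).mistakes ≤ r * d.W := by
  induction r with
  | zero => simp [rounds, Perceptron.init]
  | succ r ih =>
      have := mistakes_pass_le (d := d) i (d.rounds i r) d.W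
      rw [Nat.succ_mul]
      show (d.pass i _ _).mistakes ≤ _
      omega

section Bounds

variable (hC : ∀ a, d.C a ≤ d.M ^ 2) (hW : d.W ≤ d.M) {σ : Perceptron}
  (hσ : d.Tame σ) (hn : σ.mistakes ≤ d.M ^ 2)

include hσ hn

theorem Tame.pos_le_pow (l : ℕ) : σ.pos l ≤ d.M ^ 5 :=
  (hσ.pos_le l).trans ((Nat.mul_le_mul_right _ hn).trans (by rw [← pow_add]))

theorem Tame.neg_le_pow (l : ℕ) : σ.neg l ≤ d.M ^ 5 :=
  (hσ.neg_le l).trans ((Nat.mul_le_mul_right _ hn).trans (by rw [← pow_add]))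

include hC hW

/-- At most `M ^ 2` mistakes keep the direction below `M ^ 5`, rows are at most `M ^ 3`, and there
are at most `M` coordinates with two products each. -/
theorem dotPos_le (i j : ℕ) {k : ℕ} (hk : k ≤ d.W) : d.dotPos σ i j k ≤ 2 * d.M ^ 9 := by
  refine (Finset.sum_le_card_nsmul _ _ (2 * d.M ^ 8) fun l _ => ?_).trans ?_
  · have h1 := Nat.mul_le_mul (hσ.pos_le_pow hn l) (row_le hC i l)
    have h2 := Nat.mul_le_mul (hσ.neg_le_pow hn l) (row_le hC j l)
    rw [← pow_add] at h1 h2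
    norm_num at h1 h2
    omega
  · rw [Finset.card_range, smul_eq_mul]
    calc k * (2 * d.M ^ 8) ≤ d.M * (2 * d.M ^ 8) := Nat.mul_le_mul_right _ (hk.trans hW)
      _ = 2 * d.M ^ 9 := by ring

theorem dotNeg_le (i j : ℕ) {k : ℕ} (hk : k ≤ d.W) : d.dotNeg σ i j k ≤ 2 * d.M ^ 9 := by
  refine (Finset.sum_le_card_nsmul _ _ (2 * d.M ^ 8) fun l _ => ?_).trans ?_
  · have h1 := Nat.mul_le_mul (hσ.pos_le_pow hn l) (row_le hC j l)
    have h2 := Nat.mul_le_mul (hσ.neg_le_pow hn l) (row_le hC i l)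
    rw [← pow_add] at h1 h2
    norm_num at h1 h2
    omega
  · rw [Finset.card_range, smul_eq_mul]
    calc k * (2 * d.M ^ 8) ≤ d.M * (2 * d.M ^ 8) := Nat.mul_le_mul_right _ (hk.trans hW)
      _ = 2 * d.M ^ 9 := by ring

end Bounds

/-- The sum is of order `M ^ 4` only; it is weakened so that one bound serves all accumulators. -/
theorem gap_le (hC : ∀ a, d.C a ≤ d.M ^ 2) (hM : 1 ≤ d.M) (hW : d.W ≤ d.M) (i j : ℕ) {k : ℕ}
    (hk : k ≤ d.W) : d.gap i j k ≤ 2 * d.M ^ 9 := by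
  refine (Finset.sum_le_card_nsmul _ _ (2 * d.M ^ 3) fun l _ => ?_).trans ?_
  · have h1 := row_le hC i l
    have h2 := row_le hC j l
    omega
  · rw [Finset.card_range, smul_eq_mul]
    calc k * (2 * d.M ^ 3) ≤ d.M * (2 * d.M ^ 3) := Nat.mul_le_mul_right _ (hk.trans hW)
      _ = 2 * d.M ^ 4 := by ring
      _ ≤ 2 * d.M ^ 9 := Nat.mul_le_mul_left _ (Nat.pow_le_pow_right hM (by norm_num))

end CoocData

/-! ### The search phase of the program -/

namespace NovelWordProgram

open WordRAM WordRAM.Expr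

/-- Entry `l` of the normalized row of a word. -/
def eRow (x : Expr) : Expr := div (mul eM (.cell 2 (add (mul x eW) eL))) (.cell 3 x)

/-- Accumulate the inner products and the distance at coordinate `l`. -/
def dotStep : Program :=
  .seq (.assign 8 (add eA (add (mul (.cell 4 eL) (eRow eI)) (mul (.cell 5 eL) (eRow eJ)))))
    (.seq (.assign 9 (add eB (add (mul (.cell 4 eL) (eRow eJ)) (mul (.cell 5 eL) (eRow eI)))))
      (.seq (.assign 10 (add eF (add (sub (eRow eI) (eRow eJ)) (sub (eRow eJ) (eRow eI)))))
        (.assign 7 (add eL (.lit 1)))))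

/-- Update the direction at coordinate `l`. -/
def updateStep : Program :=
  .seq (.store 4 eL (add (.cell 4 eL) (eRow eI)))
    (.seq (.store 5 eL (add (.cell 5 eL) (eRow eJ))) (.assign 7 (add eL (.lit 1))))

/-- Nonzero if the direction has to be updated. -/
def eViolation : Expr :=
  mul (mul (.cell 3 eJ) (sub (mul (mul (mul eF eF) eF) eF) (mul (mul eM eM) eM)))
    (sub (add (add eB (mul eM eM)) (.lit 1)) eA)

/-- Update the direction. -/
def updateAll : Program :=
  .seq (.loop (sub eW eL) updateStep) (.seq (.assign 7 (.lit 0)) (.assign 11 (add eMist (.lit 1))))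

/-- Reset the accumulators and go on to the next word. -/
def advance : Program :=
  .seq (.assign 8 (.lit 0)) (.seq (.assign 9 (.lit 0)) (.seq (.assign 10 (.lit 0))
    (.assign 6 (add eJ (.lit 1)))))

/-- One step of the perceptron. -/
def perceptronStep : Program :=
  .seq (.loop (sub eW eL) dotStep) (.seq (.assign 7 (.lit 0))
    (.seq (.cond eViolation updateAll .skip) advance))

/-- One round of the perceptron. -/
def perceptronRound : Program :=
  .seq (.loop (sub eW eJ) perceptronStep) (.seq (.assign 6 (.lit 0)) (.assign 5 (add eR (.lit 1))))

/-- Reset the direction at coordinate `l`. -/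
def resetStep : Program :=
  .seq (.store 4 eL (.lit 0)) (.seq (.store 5 eL (.lit 0)) (.assign 7 (add eL (.lit 1))))

/-- Decide whether word `i` is novel. -/
def searchWord : Program :=
  .seq (.loop (sub eM (mul (mul (mul eR eR) eR) eR)) perceptronRound)
    (.seq (.store 1 eI (mul (.cell 3 eI) (sub eR eMist)))
      (.seq (.loop (sub eW eL) resetStep)
        (.seq (.assign 7 (.lit 0)) (.seq (.assign 5 (.lit 0)) (.seq (.assign 11 (.lit 0))
          (.assign 4 (add eI (.lit 1))))))))

/-- Decide for all words whether they are novel. -/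
def searchAll : Program := .loop (sub eW eI) searchWord

/-- The co-occurrence data in memory. -/
def State.data (st : State) : CoocData := ⟨st.W, st.M, st.C, st.c⟩

/-- A state in the course of the search. -/
def State.search (st : State) (i r j : ℕ) (σ : Perceptron) (out : ℕ → ℕ) : State :=
  { st with
    i := i
    r := r
    j := j
    l := 0
    A := 0
    B := 0
    F := 0
    n := σ.mistakes
    P := σ.pos
    Q := σ.neg
    out := out }

/-- The bounds for the input and the counts under which the search is run. -/
structure State.Sized (V : ℕ) (st : State) : Prop where
  large : 2 * st.M ^ 9 + 2 ≤ V
  one_le : 1 ≤ st.M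
  W_le : st.W ≤ st.M
  C_le : ∀ a, st.C a ≤ st.M ^ 2
  c_le : ∀ a, st.c a ≤ st.M ^ 2
  K_le : st.K ≤ V
  N_le : st.N ≤ V
  inp_le : ∀ a, st.inp a ≤ V

variable {V : ℕ} {st : State}

theorem State.Sized.pow_le (h : st.Sized V) {k : ℕ} (hk : k ≤ 9) : st.M ^ k + 2 ≤ V := by
  have := h.large
  have := Nat.pow_le_pow_right h.one_le hk
  omega

theorem State.Sized.M_le (h : st.Sized V) : st.M + 2 ≤ V := by
  simpa using h.pow_le (k := 1) (by norm_num)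

theorem State.Sized.two_le (h : st.Sized V) : 2 ≤ V := by
  have := h.M_le
  omega

theorem State.Sized.ok (h : st.Sized V) {i r j : ℕ} {σ : Perceptron} {out : ℕ → ℕ}
    (hi : i ≤ V) (hr : r ≤ V) (hj : j ≤ V) (hσ : st.data.Tame σ) (hn : σ.mistakes ≤ st.M ^ 2)
    (ho : ∀ a, out a ≤ V) : (st.search i r j σ out).Ok V where
  W := by have := h.W_le; have := h.M_le; show st.W ≤ V; omega
  K := h.K_le
  N := h.N_le
  M := by have := h.M_le; show st.M ≤ V; omega
  i := hi
  r := hr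
  j := hj
  l := Nat.zero_le _
  A := Nat.zero_le _
  B := Nat.zero_le _
  F := Nat.zero_le _
  n := by have := h.pow_le (k := 2) (by norm_num); show σ.mistakes ≤ V; omega
  inp := h.inp_le
  out := ho
  C a := by have := h.pow_le (k := 2) (by norm_num); have := h.C_le a; show st.C a ≤ V; omega
  c a := by have := h.pow_le (k := 2) (by norm_num); have := h.c_le a; show st.c a ≤ V; omega
  P a := by
    have := h.pow_le (k := 5) (by norm_num)
    have : σ.pos a ≤ st.M ^ 5 := hσ.pos_le_pow hn a
    show σ.pos a ≤ V
    omega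
  Q a := by
    have := h.pow_le (k := 5) (by norm_num)
    have : σ.neg a ≤ st.M ^ 5 := hσ.neg_le_pow hn a
    show σ.neg a ≤ V
    omega

/-- The state after accumulating `k` coordinates. -/
def dotState (st : State) (i j r : ℕ) (σ : Perceptron) (out : ℕ → ℕ) (k : ℕ) : State :=
  { st.search i r j σ out with
    l := k
    A := st.data.dotPos σ i j k
    B := st.data.dotNeg σ i j k
    F := st.data.gap i j k }

section Step

variable (h : st.Sized V) {i r j : ℕ} {σ : Perceptron} {out : ℕ → ℕ} (hi : i ≤ V) (hr : r ≤ V)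
  (hj : j + 1 ≤ V) (hσ : st.data.Tame σ) (hn : σ.mistakes ≤ st.M ^ 2) (ho : ∀ a, out a ≤ V)

include h hi hr hj hσ hn ho

theorem dotState_ok {k : ℕ} (hk : k ≤ st.W) : (dotState st i j r σ out k).Ok V :=
  have hok := h.ok hi hr (by omega : j ≤ V) hσ hn ho
  have hV := h.large
  { hok with
    l := hk.trans hok.W
    A := by
      have : st.data.dotPos σ i j k ≤ 2 * st.M ^ 9 :=
        CoocData.dotPos_le h.C_le h.W_le hσ hn i j hk
      show st.data.dotPos σ i j k ≤ V
      omega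
    B := by
      have : st.data.dotNeg σ i j k ≤ 2 * st.M ^ 9 :=
        CoocData.dotNeg_le h.C_le h.W_le hσ hn i j hk
      show st.data.dotNeg σ i j k ≤ V
      omega
    F := by
      have : st.data.gap i j k ≤ 2 * st.M ^ 9 :=
        CoocData.gap_le h.C_le h.one_le h.W_le i j hk
      show st.data.gap i j k ≤ V
      omega }

theorem dotStep_reach {k : ℕ} (hk : k < st.W) :
    Reach (V ^ 60) dotStep 244 (dotState st i j r σ out k).mem
      (dotState st i j r σ out (k + 1)).mem := by
  have hV := h.two_le
  have h0 := dotState_ok h hi hr hj hσ hn ho hk.le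
  have h1 := dotState_ok h hi hr hj hσ hn ho hk
  have hs1 : st.data.dotPos σ i j (k + 1) = st.data.dotPos σ i j k + _ :=
    Finset.sum_range_succ _ _
  have hs2 : st.data.dotNeg σ i j (k + 1) = st.data.dotNeg σ i j k + _ :=
    Finset.sum_range_succ _ _
  have hs3 : st.data.gap i j (k + 1) = st.data.gap i j k + _ :=
    Finset.sum_range_succ _ _
  have hA : ({ dotState st i j r σ out k with A := st.data.dotPos σ i j (k + 1) } : State).Ok V :=
    { h0 with A := h1.A }
  have hB : ({ dotState st i j r σ out k with
      A := st.data.dotPos σ i j (k + 1)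
      B := st.data.dotNeg σ i j (k + 1) } : State).Ok V :=
    { hA with B := h1.B }
  have hF : ({ dotState st i j r σ out k with
      A := st.data.dotPos σ i j (k + 1)
      B := st.data.dotNeg σ i j (k + 1)
      F := st.data.gap i j (k + 1) } : State).Ok V :=
    { hB with F := h1.F }
  have e1 := Reach.assign hV h0.bdd 8
    (add eA (add (mul (.cell 4 eL) (eRow eI)) (mul (.cell 5 eL) (eRow eJ))))
  rw [State.setReg_A] at e1
  have e1' := reach_congr e1 (st' := { dotState st i j r σ out k with
    A := st.data.dotPos σ i j (k + 1) }) (by rw [hs1]; rfl)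
  have e2 := Reach.assign hV hA.bdd 9
    (add eB (add (mul (.cell 4 eL) (eRow eJ)) (mul (.cell 5 eL) (eRow eI))))
  rw [State.setReg_B] at e2
  have e2' := reach_congr e2 (st' := { dotState st i j r σ out k with
      A := st.data.dotPos σ i j (k + 1)
      B := st.data.dotNeg σ i j (k + 1) }) (by rw [hs2]; rfl)
  have e3 := Reach.assign hV hB.bdd 10
    (add eF (add (sub (eRow eI) (eRow eJ)) (sub (eRow eJ) (eRow eI))))
  rw [State.setReg_F] at e3
  have e3' := reach_congr e3 (st' := { dotState st i j r σ out k with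
      A := st.data.dotPos σ i j (k + 1)
      B := st.data.dotNeg σ i j (k + 1)
      F := st.data.gap i j (k + 1) }) (by rw [hs3]; rfl)
  have e4 := Reach.assign hV hF.bdd 7 (add eL (.lit 1))
  rw [State.setReg_l] at e4
  exact e1'.seq (e2'.seq (e3'.seq e4))

theorem dotLoop_reach :
    Reach (V ^ 60) (.loop (sub eW eL) dotStep) (st.W * 248 + 4) (st.search i r j σ out).mem
      (dotState st i j r σ out st.W).mem := by
  refine Reach.loop_of_eq (τ := 244) (fun k => (dotState st i j r σ out k).mem) st.W 3 rfl
      rfl rfl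
      (fun k hk => Expr.fits h.two_le (dotState_ok h hi hr hj hσ hn ho hk).bdd _ rfl (by decide))
      (fun k hk => ?_) ?_ (fun k hk => dotStep_reach h hi hr hj hσ hn ho hk)
  · show st.W - k ≠ 0
    omega
  · show st.W - st.W = 0
    omega

/-- The state after updating `k` coordinates. -/
def updateState (st : State) (i j r : ℕ) (σ : Perceptron) (out : ℕ → ℕ) (k : ℕ) : State :=
  { dotState st i j r σ out st.W with
    l := k
    P := (st.data.update σ i j k).pos
    Q := (st.data.update σ i j k).neg }

theorem updateState_ok {k : ℕ} (hk : k ≤ st.W) : (updateState st i j r σ out k).Ok V :=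
  have hok := dotState_ok h hi hr hj hσ hn ho le_rfl
  -- One more mistake at most doubles the bound `M ^ 2`, which gives `2 * M ^ 5`.
  have hb : (σ.mistakes + 1) * st.M ^ 3 ≤ V := by
    have h1 := h.large
    have h2 : (σ.mistakes + 1) * st.M ^ 3 ≤ (st.M ^ 2 + st.M ^ 2) * st.M ^ 3 :=
      Nat.mul_le_mul_right _ (add_le_add hn (Nat.one_le_pow _ _ h.one_le))
    have h3 : (st.M ^ 2 + st.M ^ 2) * st.M ^ 3 = 2 * st.M ^ 5 := by ring
    have h4 : st.M ^ 5 ≤ st.M ^ 9 := Nat.pow_le_pow_right h.one_le (by norm_num)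
    omega
  { hok with
    l := hk.trans hok.W
    P := fun l => (CoocData.update_pos_le h.C_le hσ i j k l).trans hb
    Q := fun l => (CoocData.update_neg_le h.C_le hσ i j k l).trans hb }

theorem updateStep_reach {k : ℕ} (hk : k < st.W) :
    Reach (V ^ 60) updateStep 303 (updateState st i j r σ out k).mem
      (updateState st i j r σ out (k + 1)).mem := by
  have hV := h.two_le
  have h0 := updateState_ok h hi hr hj hσ hn ho hk.le
  have h1 := updateState_ok h hi hr hj hσ hn ho hk
  have hp : Function.update (st.data.update σ i j k).pos k
      ((st.data.update σ i j k).pos k + st.data.row i k) = (st.data.update σ i j (k + 1)).pos := by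
    funext l
    simp only [Function.update_apply, CoocData.update, lt_self_iff_false, if_false]
    by_cases hl : l = k
    · subst hl; simp
    · have : l < k + 1 ↔ l < k := by omega
      simp only [hl, if_false, this]
  have hq : Function.update (st.data.update σ i j k).neg k
      ((st.data.update σ i j k).neg k + st.data.row j k) = (st.data.update σ i j (k + 1)).neg := by
    funext l
    simp only [Function.update_apply, CoocData.update, lt_self_iff_false, if_false]
    by_cases hl : l = k
    · subst hl; simp
    · have : l < k + 1 ↔ l < k := by omega
      simp only [hl, if_false, this]
  have hP : ({ updateState st i j r σ out k with
      P := (st.data.update σ i j (k + 1)).pos } : State).Ok V := { h0 with P := h1.P }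
  have hQ : ({ updateState st i j r σ out k with
      P := (st.data.update σ i j (k + 1)).pos
      Q := (st.data.update σ i j (k + 1)).neg } : State).Ok V := { hP with Q := h1.Q }
  have e1 := Reach.store hV h0.bdd 4 eL (add (.cell 4 eL) (eRow eI))
  rw [State.setCell_P] at e1
  have e1' := reach_congr e1 (st' := { updateState st i j r σ out k with
      P := (st.data.update σ i j (k + 1)).pos }) (by rw [← hp]; rfl)
  have e2 := Reach.store hV hP.bdd 5 eL (add (.cell 5 eL) (eRow eJ))
  rw [State.setCell_Q] at e2
  have e2' := reach_congr e2 (st' := { updateState st i j r σ out k with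
      P := (st.data.update σ i j (k + 1)).pos
      Q := (st.data.update σ i j (k + 1)).neg }) (by rw [← hq]; rfl)
  have e3 := Reach.assign hV hQ.bdd 7 (add eL (.lit 1))
  rw [State.setReg_l] at e3
  exact e1'.seq (e2'.seq e3)

theorem updateAll_reach :
    Reach (V ^ 60) updateAll (st.W * 310 + 200)
      ({ dotState st i j r σ out st.W with l := 0 } : State).mem
      ({ updateState st i j r σ out st.W with l := 0, n := σ.mistakes + 1 } : State).mem := by
  have hV := h.two_le
  have e1 : Reach (V ^ 60) (.loop (sub eW eL) updateStep) (st.W * 307 + 4)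
      ({ dotState st i j r σ out st.W with l := 0 } : State).mem
      (updateState st i j r σ out st.W).mem := by
    refine Reach.loop_of_eq (τ := 303) (fun k => (updateState st i j r σ out k).mem) st.W 3 rfl
      rfl rfl
      (fun k hk => Expr.fits hV (updateState_ok h hi hr hj hσ hn ho hk).bdd _ rfl (by decide))
      (fun k hk => ?_) ?_ (fun k hk => updateStep_reach h hi hr hj hσ hn ho hk)
    · show st.W - k ≠ 0
      omega
    · show st.W - st.W = 0
      omega
  have hu := updateState_ok h hi hr hj hσ hn ho (le_refl st.W)
  have hl : ({ updateState st i j r σ out st.W with l := 0 } : State).Ok V :=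
    { hu with l := Nat.zero_le _ }
  have e2 := Reach.assign hV hu.bdd 7 (.lit 0)
  rw [State.setReg_l] at e2
  have e3 := Reach.assign hV hl.bdd 11 (add eMist (.lit 1))
  rw [State.setReg_n] at e3
  exact (e1.seq (e2.seq e3)).mono (by omega)

omit h hi hr hj hσ hn ho in
theorem advance_reach (hV : 2 ≤ V) {s : State} (hs : s.Ok V) :
    Reach (V ^ 60) advance 244 s.mem
      ({ s with A := 0, B := 0, F := 0, j := s.j + 1 } : State).mem := by
  have h1 : ({ s with A := 0 } : State).Ok V := { hs with A := Nat.zero_le _ }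
  have h2 : ({ s with A := 0, B := 0 } : State).Ok V := { h1 with B := Nat.zero_le _ }
  have h3 : ({ s with A := 0, B := 0, F := 0 } : State).Ok V := { h2 with F := Nat.zero_le _ }
  have e1 := Reach.assign hV hs.bdd 8 (.lit 0)
  have e2 := Reach.assign hV h1.bdd 9 (.lit 0)
  have e3 := Reach.assign hV h2.bdd 10 (.lit 0)
  have e4 := Reach.assign hV h3.bdd 6 (add eJ (.lit 1))
  rw [State.setReg_A] at e1
  rw [State.setReg_B] at e2
  rw [State.setReg_F] at e3
  rw [State.setReg_j] at e4
  exact e1.seq (e2.seq (e3.seq e4))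

theorem perceptronStep_reach :
    Reach (V ^ 60) perceptronStep (st.W * 560 + 700) (st.search i r j σ out).mem
      (st.search i r (j + 1) (st.data.step i σ j) out).mem := by
  have hV := h.two_le
  have hd := dotState_ok h hi hr hj hσ hn ho (le_refl st.W)
  have e1 := dotLoop_reach h hi hr hj hσ hn ho
  have hl : ({ dotState st i j r σ out st.W with l := 0 } : State).Ok V :=
    { hd with l := Nat.zero_le _ }
  have e2 := Reach.assign hV hd.bdd 7 (.lit 0)
  rw [State.setReg_l] at e2
  have hf := Expr.fits hV hl.bdd (q := 60) eViolation rfl (by decide)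
  -- The accumulators now hold the full sums, so the tested expression evaluates to `violation` by
  -- definition.
  by_cases hv : st.data.violation σ i j = 0
  · have e3 := (Reach.cond_false (p := updateAll) hf hv (Reach.skip (B := V ^ 60))).mono
      (τ' := 62) (by decide)
    have := (e1.seq (e2.seq (e3.seq (advance_reach hV hl)))).mono
      (τ' := st.W * 560 + 700) (by omega)
    refine reach_congr this ?_
    rw [show st.data.step i σ j = σ from if_pos hv]
    rfl
  · have e3 := Reach.cond_true (q := .skip) hf hv (updateAll_reach h hi hr hj hσ hn ho)
    have hu := updateState_ok h hi hr hj hσ hn ho (le_refl st.W)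
    have hu' : ({ updateState st i j r σ out st.W with
        l := 0, n := σ.mistakes + 1 } : State).Ok V :=
      { hu with
        l := Nat.zero_le _
        n := by
          have := h.pow_le (k := 2) (by norm_num)
          show σ.mistakes + 1 ≤ V
          omega }
    have := (e1.seq (e2.seq (e3.seq (advance_reach hV hu')))).mono
      (τ' := st.W * 560 + 700) (by
        have : eViolation.cost ≤ 60 := by decide
        omega)
    refine reach_congr this ?_
    rw [show st.data.step i σ j = _ from if_neg hv]
    rfl

end Step

end NovelWordProgram

namespace NovelWordProgram

open WordRAM WordRAM.Expr

variable {V : ℕ} {st : State}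

theorem perceptronRound_reach (h : st.Sized V) {i r : ℕ} {σ : Perceptron} {out : ℕ → ℕ}
    (hi : i ≤ V) (hr : r + 1 ≤ V) (hσ : st.data.Tame σ) (hn : σ.mistakes + st.W ≤ st.M ^ 2)
    (ho : ∀ a, out a ≤ V) :
    Reach (V ^ 60) perceptronRound (st.W * (st.W * 560 + 710) + 200)
      (st.search i r 0 σ out).mem
      (st.search i (r + 1) 0 (st.data.pass i σ st.W) out).mem := by
  have hV := h.two_le
  have hM := h.M_le
  have hW := h.W_le
  have ht : ∀ k, st.data.Tame (st.data.pass i σ k) := CoocData.tame_pass h.C_le hσ i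
  have hm : ∀ k ≤ st.W, (st.data.pass i σ k).mistakes ≤ st.M ^ 2 := fun k hk => by
    have := CoocData.mistakes_pass_le (d := st.data) i σ k
    omega
  have hok : ∀ k ≤ st.W, (st.search i r k (st.data.pass i σ k) out).Ok V := fun k hk =>
    h.ok hi (by omega) (by omega) (ht k) (hm k hk) ho
  have e1 : Reach (V ^ 60) (.loop (sub eW eJ) perceptronStep)
      (st.W * (3 + 1 + (st.W * 560 + 700)) + (3 + 1)) (st.search i r 0 σ out).mem
      (st.search i r st.W (st.data.pass i σ st.W) out).mem := by
    refine Reach.loop_of_eq (fun k => (st.search i r k (st.data.pass i σ k) out).mem) st.W 3 rfl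
      rfl rfl (fun k hk => Expr.fits hV (hok k hk).bdd _ rfl (by decide))
      (fun k hk => ?_) ?_ (fun k hk => ?_)
    · show st.W - k ≠ 0
      omega
    · show st.W - st.W = 0
      omega
    · exact perceptronStep_reach h hi (by omega) (by omega) (ht k) (hm k hk.le) ho
  have e2 := Reach.assign hV (hok st.W le_rfl).bdd 6 (.lit 0)
  rw [State.setReg_j] at e2
  have h2 := h.ok hi (by omega : r ≤ V) (Nat.zero_le V) (ht st.W) (hm st.W le_rfl) ho
  have e3 := Reach.assign hV h2.bdd 5 (add eR (.lit 1))
  rw [State.setReg_r] at e3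
  exact (e1.seq (e2.seq e3)).mono (by
    rw [add_assoc]
    exact Nat.add_le_add (Nat.mul_le_mul_left _ (by linarith)) (by norm_num))

/-- The direction after resetting `k` coordinates. -/
def resetTo (σ : Perceptron) (k : ℕ) : Perceptron where
  pos l := if l < k then 0 else σ.pos l
  neg l := if l < k then 0 else σ.neg l
  mistakes := σ.mistakes

theorem tame_resetTo {d : CoocData} {σ : Perceptron} (hσ : d.Tame σ) (k : ℕ) :
    d.Tame (resetTo σ k) := by
  refine ⟨fun l => ?_, fun l => ?_, fun l hl => ?_, fun l hl => ?_⟩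
  · have := hσ.pos_le l
    simp only [resetTo]
    split_ifs <;> omega
  · have := hσ.neg_le l
    simp only [resetTo]
    split_ifs <;> omega
  · simp [resetTo, hσ.pos_eq l hl]
  · simp [resetTo, hσ.neg_eq l hl]

theorem resetStep_reach (h : st.Sized V) {i r : ℕ} {σ : Perceptron} {out : ℕ → ℕ}
    (hi : i ≤ V) (hr : r ≤ V) (hσ : st.data.Tame σ) (hn : σ.mistakes ≤ st.M ^ 2)
    (ho : ∀ a, out a ≤ V) {k : ℕ} (hk : k < st.W) :
    Reach (V ^ 60) resetStep 303 ({ st.search i r 0 (resetTo σ k) out with l := k } : State).mem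
      ({ st.search i r 0 (resetTo σ (k + 1)) out with l := k + 1 } : State).mem := by
  have hV := h.two_le
  have hk' : k ≤ V := by have := h.M_le; have := h.W_le; omega
  have h0 : ({ st.search i r 0 (resetTo σ k) out with l := k } : State).Ok V :=
    { h.ok hi hr (Nat.zero_le V) (tame_resetTo hσ k) hn ho with l := hk' }
  have h1 := h.ok hi hr (Nat.zero_le V) (tame_resetTo hσ (k + 1)) hn ho
  have hp : Function.update (resetTo σ k).pos k 0 = (resetTo σ (k + 1)).pos := by
    funext l
    simp only [Function.update_apply, resetTo]
    split_ifs <;> first | rfl | omega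
  have hq : Function.update (resetTo σ k).neg k 0 = (resetTo σ (k + 1)).neg := by
    funext l
    simp only [Function.update_apply, resetTo]
    split_ifs <;> first | rfl | omega
  have hP : ({ st.search i r 0 (resetTo σ k) out with
      l := k
      P := (resetTo σ (k + 1)).pos } : State).Ok V := { h0 with P := h1.P }
  have hQ : ({ st.search i r 0 (resetTo σ k) out with
      l := k
      P := (resetTo σ (k + 1)).pos
      Q := (resetTo σ (k + 1)).neg } : State).Ok V := { hP with Q := h1.Q }
  have e1 := Reach.store hV h0.bdd 4 eL (.lit 0)
  rw [State.setCell_P] at e1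
  have e1' := reach_congr e1 (st' := { st.search i r 0 (resetTo σ k) out with
      l := k
      P := (resetTo σ (k + 1)).pos }) (by rw [← hp]; rfl)
  have e2 := Reach.store hV hP.bdd 5 eL (.lit 0)
  rw [State.setCell_Q] at e2
  have e2' := reach_congr e2 (st' := { st.search i r 0 (resetTo σ k) out with
      l := k
      P := (resetTo σ (k + 1)).pos
      Q := (resetTo σ (k + 1)).neg }) (by rw [← hq]; rfl)
  have e3 := Reach.assign hV hQ.bdd 7 (add eL (.lit 1))
  rw [State.setReg_l] at e3
  exact e1'.seq (e2'.seq e3)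

/-- The entry that is output for word `i`: nonzero if and only if the word is accepted. -/
def _root_.CoocData.mark (d : CoocData) (i : ℕ) : ℕ :=
  d.c i * (numRounds d.M - (d.rounds i (numRounds d.M)).mistakes)

theorem mark_le (h : st.Sized V) (i : ℕ) : st.data.mark i ≤ V := by
  have h1 := h.pow_le (k := 3) (by norm_num)
  have h2 : st.data.mark i ≤ st.M ^ 2 * st.M :=
    Nat.mul_le_mul (h.c_le i) ((Nat.sub_le _ _).trans (numRounds_le _))
  have h3 : st.M ^ 2 * st.M = st.M ^ 3 := by ring
  omega

theorem searchWord_reach (h : st.Sized V) {i : ℕ} {out : ℕ → ℕ}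
    (hi : i + 1 ≤ V) (ho : ∀ a, out a ≤ V) :
    Reach (V ^ 60) searchWord
      (numRounds st.M * (st.W * (st.W * 560 + 710) + 210) + (st.W * 307 + 400))
      (st.search i 0 0 .init out).mem
      (st.search (i + 1) 0 0 .init (Function.update out i (st.data.mark i))).mem := by
  have hV := h.two_le
  have hM := h.M_le
  have hW := h.W_le
  have hT := numRounds_le st.M
  set T := numRounds st.M with hTdef
  have ht : ∀ k, st.data.Tame (st.data.rounds i k) := CoocData.tame_rounds h.C_le i
  have hm : ∀ k ≤ T, (st.data.rounds i k).mistakes ≤ st.M ^ 2 := fun k hk => by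
    have h1 : (st.data.rounds i k).mistakes ≤ k * st.W := CoocData.mistakes_rounds_le i k
    have h2 : k * st.W ≤ st.M * st.M := Nat.mul_le_mul (hk.trans hT) hW
    rw [sq]
    exact h1.trans h2
  have hok : ∀ k ≤ T, (st.search i k 0 (st.data.rounds i k) out).Ok V := fun k hk =>
    h.ok (by omega) (by omega) (Nat.zero_le _) (ht k) (hm k hk) ho
  have e1 : Reach (V ^ 60) (.loop (sub eM (mul (mul (mul eR eR) eR) eR)) perceptronRound)
      (T * (9 + 1 + (st.W * (st.W * 560 + 710) + 200)) + (9 + 1))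
      (st.search i 0 0 .init out).mem
      (st.search i T 0 (st.data.rounds i T) out).mem := by
    refine Reach.loop_of_eq (fun k => (st.search i k 0 (st.data.rounds i k) out).mem) T 9 rfl
      rfl rfl (fun k hk => Expr.fits hV (hok k hk).bdd _ rfl (by decide))
      (fun k hk => ?_) ?_ (fun k hk => ?_)
    -- No root is computed: the loop stops at the first `r` with `M ≤ r ^ 4`, which is `numRounds
    -- M`.
    · have := pow_lt_of_lt_numRounds hk
      show st.M - k * k * k * k ≠ 0
      omega
    · have : st.M ≤ T * T * T * T := le_numRounds_pow st.M
      show st.M - T * T * T * T = 0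
      omega
    · refine perceptronRound_reach h (by omega) (by omega) (ht k) ?_ ho
      have h1 : (st.data.rounds i k).mistakes ≤ k * st.W := CoocData.mistakes_rounds_le i k
      have h2 : (k + 1) * st.W ≤ st.M * st.M := Nat.mul_le_mul (by omega) hW
      rw [Nat.succ_mul] at h2
      rw [sq]
      omega
  set σ := st.data.rounds i T with hσdef
  set out' := Function.update out i (st.data.mark i) with hout'
  have ho' : ∀ a, out' a ≤ V := fun a => by
    rw [hout', Function.update_apply]
    split_ifs
    · exact mark_le h i
    · exact ho a
  have hTV : T ≤ V := by omega
  have hiV : i ≤ V := by omega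
  have hnT := hm T le_rfl
  have e2 := Reach.store hV (hok T le_rfl).bdd 1 eI (mul (.cell 3 eI) (sub eR eMist))
  rw [State.setCell_out] at e2
  have e2' := reach_congr e2 (st' := st.search i T 0 σ out') rfl
  have hr : ∀ k ≤ st.W,
      ({ st.search i T 0 (resetTo σ k) out' with l := k } : State).Ok V := fun k hk =>
    { h.ok hiV hTV (Nat.zero_le V) (tame_resetTo (ht T) k) hnT ho' with
      l := by show k ≤ V; omega }
  have e3 : Reach (V ^ 60) (.loop (sub eW eL) resetStep) (st.W * (3 + 1 + 303) + (3 + 1))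
      (st.search i T 0 σ out').mem
      ({ st.search i T 0 (resetTo σ st.W) out' with l := st.W } : State).mem := by
    refine Reach.loop_of_eq
      (fun k => ({ st.search i T 0 (resetTo σ k) out' with l := k } : State).mem) st.W 3 rfl
      rfl rfl (fun k hk => Expr.fits hV (hr k hk).bdd _ rfl (by decide))
      (fun k hk => ?_) ?_ (fun k hk => ?_)
    · show st.W - k ≠ 0
      omega
    · show st.W - st.W = 0
      omega
    · exact resetStep_reach h (by omega) hTV (ht T) hnT ho' hk
  -- Only the first `W` cells are cleared; by `Tame` the direction vanishes beyond them, so the next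
  -- word starts from the initial perceptron.
  have hz : (resetTo σ st.W).pos = fun _ => 0 := by
    funext l
    simp only [resetTo]
    split_ifs with hl
    · rfl
    · exact (ht T).pos_eq l (not_lt.1 hl)
  have hz' : (resetTo σ st.W).neg = fun _ => 0 := by
    funext l
    simp only [resetTo]
    split_ifs with hl
    · rfl
    · exact (ht T).neg_eq l (not_lt.1 hl)
  have e3' := reach_congr e3 (st' := { st.search i T 0 .init out' with
      l := st.W, n := σ.mistakes }) (by
    apply State.ext <;> first | rfl | exact hz | exact hz')
  have h4 : ({ st.search i T 0 .init out' with l := st.W, n := σ.mistakes } : State).Ok V :=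
    { hr st.W le_rfl with P := fun _ => Nat.zero_le _, Q := fun _ => Nat.zero_le _ }
  have h5 : ({ st.search i T 0 .init out' with n := σ.mistakes } : State).Ok V :=
    { h4 with l := Nat.zero_le _ }
  have h6 : ({ st.search i 0 0 .init out' with n := σ.mistakes } : State).Ok V :=
    { h5 with r := Nat.zero_le _ }
  have h7 : (st.search i 0 0 .init out').Ok V := { h6 with n := Nat.zero_le _ }
  have e4 := Reach.assign hV h4.bdd 7 (.lit 0)
  have e5 := Reach.assign hV h5.bdd 5 (.lit 0)
  have e6 := Reach.assign hV h6.bdd 11 (.lit 0)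
  have e7 := Reach.assign hV h7.bdd 4 (add eI (.lit 1))
  rw [State.setReg_l] at e4
  rw [State.setReg_r] at e5
  rw [State.setReg_n] at e6
  rw [State.setReg_i] at e7
  refine (e1.seq (e2'.seq (e3'.seq (e4.seq (e5.seq (e6.seq e7)))))).mono ?_
  rw [add_assoc]
  exact Nat.add_le_add (Nat.mul_le_mul_left _ (by linarith)) (by omega)

theorem searchAll_reach (h : st.Sized V) :
    Reach (V ^ 60) searchAll
      (st.W * (numRounds st.M * (st.W * (st.W * 560 + 710) + 210) + (st.W * 307 + 404)) + 4)
      (st.search 0 0 0 .init fun _ => 0).mem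
      (st.search st.W 0 0 .init fun a => if a < st.W then st.data.mark a else 0).mem := by
  have hV := h.two_le
  have hM := h.M_le
  have hW := h.W_le
  let out : ℕ → ℕ → ℕ := fun k a => if a < k then st.data.mark a else 0
  have ho : ∀ k a, out k a ≤ V := fun k a => by
    simp only [out]
    split_ifs
    · exact mark_le h a
    · exact Nat.zero_le _
  have hs : ∀ k, Function.update (out k) k (st.data.mark k) = out (k + 1) := fun k => by
    funext a
    simp only [Function.update_apply, out]
    by_cases ha : a = k
    · subst ha; simp
    · have : a < k + 1 ↔ a < k := by omega
      simp only [ha, if_false, this]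
  refine (Reach.loop_of_eq (τ := numRounds st.M * (st.W * (st.W * 560 + 710) + 210) +
      (st.W * 307 + 400)) (fun k => (st.search k 0 0 .init (out k)).mem) st.W 3 rfl
      ?_ rfl (fun k hk => Expr.fits hV (h.ok (by omega) (Nat.zero_le V) (Nat.zero_le V)
        CoocData.tame_init (Nat.zero_le _) (ho k)).bdd _ rfl (by decide))
      (fun k hk => ?_) ?_ (fun k hk => ?_)).mono
      (Nat.add_le_add (Nat.mul_le_mul_left _ (by linarith)) le_rfl)
  · have : out 0 = fun _ => 0 := by
      funext a
      simp [out]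
    simp only [this]
  · show st.W - k ≠ 0
    omega
  · show st.W - st.W = 0
    omega
  · simp only [← hs k]
    exact searchWord_reach h (by omega) (ho k)

/-! ### The whole program: input, counts and running time -/

/-- The program. -/
def main : Program :=
  .cond (sub (add eM (.lit 1)) (mul (mul (mul (add (add eW eN) (.lit 1)) (add (add eW eN) (.lit 1)))
      (add (add eW eN) (.lit 1))) (add (add eW eN) (.lit 1))))
    (.seq countAll searchAll) .skip

/-- The initial state. -/
def initial (W K N M : ℕ) (inp : ℕ → ℕ) : State where
  W := W
  K := K
  N := N
  M := M
  i := 0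
  r := 0
  j := 0
  l := 0
  A := 0
  B := 0
  F := 0
  n := 0
  inp := inp
  out _ := 0
  C _ := 0
  c _ := 0
  P _ := 0
  Q _ := 0

/-- The contents of the input array. -/
def corpusArray {W N M : ℕ} (D : Corpus W N M) (i : ℕ) : ℕ :=
  ∑ m : Fin M, ∑ t : Fin N, if (m : ℕ) * N + (t : ℕ) = i then (D m t : ℕ) else 0

theorem input_eq {W N M : ℕ} (K : ℕ) (D : Corpus W N M) :
    input K D = (initial W K N M (corpusArray D)).mem := by
  have hr : ∀ y, (input K D).reg y = (initial W K N M (corpusArray D)).mem.reg y := by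
    intro y
    simp only [input, State.mem, initial]
    split <;> split <;> first | rfl | simp_all
  have ha : ∀ y, (input K D).arr y = (initial W K N M (corpusArray D)).mem.arr y := by
    intro y
    funext x
    simp only [input, State.mem, initial]
    split
    · rfl
    · split <;> first | rfl | simp_all
  have e : ∀ s s' : Memory, s.reg = s'.reg → s.arr = s'.arr → s = s' := by
    rintro ⟨_, _⟩ ⟨_, _⟩ rfl rfl
    rfl
  exact e _ _ (funext hr) (funext ha)

theorem corpusArray_le {W N M : ℕ} (D : Corpus W N M) (a : ℕ) : corpusArray D a ≤ M * (N * W) := by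
  refine (Finset.sum_le_card_nsmul _ _ (N * W) fun m _ => ?_).trans (by simp)
  refine (Finset.sum_le_card_nsmul _ _ W fun t _ => ?_).trans (by simp)
  split_ifs
  · exact (D m t).2.le
  · exact Nat.zero_le _

/-- Quotient and remainder by `N` recover document and position from the address, so a single
summand survives. The existence of `t` makes `N` positive. -/
theorem corpusArray_eq {W N M : ℕ} (D : Corpus W N M) (m : Fin M) (t : Fin N) :
    corpusArray D ((m : ℕ) * N + t) = D m t := by
  have key : ∀ (m' : Fin M) (t' : Fin N), (m' : ℕ) * N + t' = m * N + t → m' = m ∧ t' = t := by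
    intro m' t' h
    have hN : 0 < N := t.pos
    have h1 : ((m' : ℕ) * N + t') / N = ((m : ℕ) * N + t) / N := by rw [h]
    have h2 : ((m' : ℕ) * N + t') % N = ((m : ℕ) * N + t) % N := by rw [h]
    rw [add_comm, Nat.add_mul_div_right _ _ hN, add_comm ((m : ℕ) * N),
      Nat.add_mul_div_right _ _ hN, Nat.div_eq_of_lt t'.2, Nat.div_eq_of_lt t.2] at h1
    rw [Nat.mul_add_mod_self_right, Nat.mul_add_mod_self_right, Nat.mod_eq_of_lt t'.2,
      Nat.mod_eq_of_lt t.2] at h2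
    exact ⟨Fin.ext (by omega), Fin.ext h2⟩
  unfold corpusArray
  rw [Finset.sum_eq_single m, Finset.sum_eq_single t]
  · simp
  · intro t' _ h
    rw [if_neg fun h' => h (key m t' h').2]
  · simp
  · intro m' _ h
    exact Finset.sum_eq_zero fun t' _ => if_neg fun h' => h (key m' t' h').1
  · simp

end NovelWordProgram

/-- A weighted sum of co-occurrence counts is a sum over the pairs of positions. -/
theorem sum_mul_cooccurrence {W N M : ℕ} {R : Type*} [CommSemiring R] (D : Corpus W N M)
    (h : Fin W → Fin W → R) :
    ∑ i, ∑ j, h i j * (cooccurrence D i j : R) =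
      ∑ m : Fin M, ∑ s : Fin N, ∑ t : Fin N, if s ≠ t then h (D m s) (D m t) else 0 := by
  have e : ∀ i j, h i j * (cooccurrence D i j : R) = ∑ m : Fin M, ∑ s : Fin N, ∑ t : Fin N,
      if s ≠ t ∧ D m s = i ∧ D m t = j then h i j else 0 := by
    intro i j
    simp only [cooccurrence, Matrix.of_apply, Nat.cast_sum, Finset.mul_sum]
    refine Finset.sum_congr rfl fun m _ => Finset.sum_congr rfl fun s _ =>
      Finset.sum_congr rfl fun t _ => ?_
    split_ifs <;> simp
  simp only [e]
  have h1 : ∀ i, ∑ j, ∑ m : Fin M, ∑ s : Fin N, ∑ t : Fin N,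
      (if s ≠ t ∧ D m s = i ∧ D m t = j then h i j else 0) =
      ∑ m : Fin M, ∑ s : Fin N, ∑ t : Fin N,
        if s ≠ t ∧ D m s = i then h i (D m t) else 0 := by
    intro i
    rw [Finset.sum_comm]
    refine Finset.sum_congr rfl fun m _ => ?_
    rw [Finset.sum_comm]
    refine Finset.sum_congr rfl fun s _ => ?_
    rw [Finset.sum_comm]
    refine Finset.sum_congr rfl fun t _ => ?_
    rw [Finset.sum_eq_single (D m t)]
    · simp
    · intro j _ hj
      rw [if_neg]
      rintro ⟨_, _, h⟩
      exact hj h.symm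
    · simp
  simp only [h1]
  rw [Finset.sum_comm]
  refine Finset.sum_congr rfl fun m _ => ?_
  rw [Finset.sum_comm]
  refine Finset.sum_congr rfl fun s _ => ?_
  rw [Finset.sum_comm]
  refine Finset.sum_congr rfl fun t _ => ?_
  rw [Finset.sum_eq_single (D m s)]
  · simp
  · intro i _ hi
    rw [if_neg]
    rintro ⟨_, h⟩
    exact hi h.symm
  · simp

namespace NovelWordProgram

open WordRAM WordRAM.Expr

/-- Used with both address maps, for the matrix entries and for the row sums. It is the reason why
the output depends on the corpus only through the co-occurrence counts. -/
theorem hits_corpusArray {W N M : ℕ} (D : Corpus W N M) (g : ℕ → ℕ → ℕ) (a : ℕ) :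
    hits g (corpusArray D) N M a =
      ∑ i : Fin W, ∑ j : Fin W, (if g i j = a then 1 else 0) * cooccurrence D i j := by
  have := sum_mul_cooccurrence D (fun i j : Fin W => if g i j = a then (1 : ℕ) else 0)
  simp only [Nat.cast_id] at this
  rw [this]
  simp only [hits, hitsIn, hitsAt, Finset.sum_range]
  refine Finset.sum_congr rfl fun m _ => Finset.sum_congr rfl fun s _ =>
    Finset.sum_congr rfl fun t _ => ?_
  simp only [hit, corpusArray_eq, ne_eq, Fin.val_inj]
  split_ifs <;> simp_all

/-- By the guard, every product of four factors that are at most `W + N + 1` is at most `M`. This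
absorbs the factors `N²` of the counting and `W³` of the search; the summand `61` pays for the test
of the guard. -/
theorem time_bound {W K N M T : ℕ}
    (h : (W + N + 1) * (W + N + 1) * (W + N + 1) * (W + N + 1) ≤ M) (hT : T ≤ M) :
    (M * (N * (N * 410 + 210) + 210) + 200) +
      (W * (T * (W * (W * 560 + 710) + 210) + (W * 307 + 404)) + 4) + 61 ≤
        10000 * (W + M + K + N + 1) ^ 2 := by
  have hX : ∀ x y z w : ℕ, x ≤ W + N + 1 → y ≤ W + N + 1 → z ≤ W + N + 1 → w ≤ W + N + 1 →
      x * y * z * w ≤ M := fun x y z w hx hy hz hw =>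
    (Nat.mul_le_mul (Nat.mul_le_mul (Nat.mul_le_mul hx hy) hz) hw).trans h
  have h1 : N * (N * 410 + 210) + 210 ≤ 830 * M := by
    have a1 := hX N N 1 1 (by omega) (by omega) (by omega) (by omega)
    have a2 := hX N 1 1 1 (by omega) (by omega) (by omega) (by omega)
    have a3 := hX 1 1 1 1 (by omega) (by omega) (by omega) (by omega)
    nlinarith
  have h2 : W * (W * (W * 560 + 710) + 210) ≤ 1480 * M := by
    have a1 := hX W W W 1 (by omega) (by omega) (by omega) (by omega)
    have a2 := hX W W 1 1 (by omega) (by omega) (by omega) (by omega)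
    have a3 := hX W 1 1 1 (by omega) (by omega) (by omega) (by omega)
    nlinarith
  have h3 : W * (W * 307 + 404) ≤ 711 * M := by
    have a2 := hX W W 1 1 (by omega) (by omega) (by omega) (by omega)
    have a3 := hX W 1 1 1 (by omega) (by omega) (by omega) (by omega)
    nlinarith
  have h4 : M * (N * (N * 410 + 210) + 210) ≤ M * (830 * M) := Nat.mul_le_mul_left _ h1
  have h5 : W * (T * (W * (W * 560 + 710) + 210) + (W * 307 + 404)) ≤
      M * (1480 * M) + 711 * M := by
    calc W * (T * (W * (W * 560 + 710) + 210) + (W * 307 + 404))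
        = T * (W * (W * (W * 560 + 710) + 210)) + W * (W * 307 + 404) := by ring
      _ ≤ M * (1480 * M) + 711 * M := add_le_add (Nat.mul_le_mul hT h2) h3
  have h6 : (M + 1) ^ 2 ≤ (W + M + K + N + 1) ^ 2 := Nat.pow_le_pow_left (by omega) 2
  nlinarith

theorem main_outputs (W K N M : ℕ) (D : Corpus W N M) :
    Outputs main 720 K D (10000 * (W + M + K + N + 1) ^ 2)
      (recoverNovelWords W K N M (cooccurrence D)) := by
  unfold Outputs
  obtain ⟨X, hXdef⟩ : ∃ X, X = W + M + K + N + 2 := ⟨_, rfl⟩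
  rw [← hXdef]
  have hX : 2 ≤ X := by omega
  have hpow : ∀ k ≤ 12, X ^ k ≤ X ^ 12 := fun k hk => Nat.pow_le_pow_right (by omega) hk
  have hX1 : X ≤ X ^ 12 := Nat.le_self_pow (by norm_num) X
  have hV : 2 ≤ X ^ 12 := by omega
  have hinp : ∀ a, corpusArray D a ≤ X ^ 12 := fun a => by
    refine (corpusArray_le D a).trans ?_
    calc M * (N * W) ≤ X * (X * X) :=
          Nat.mul_le_mul (by omega) (Nat.mul_le_mul (by omega) (by omega))
      _ = X ^ 3 := by ring
      _ ≤ X ^ 12 := hpow 3 (by norm_num)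
  set st := initial W K N M (corpusArray D) with hst
  have hok : st.Ok (X ^ 12) :=
    { W := by show W ≤ _; omega
      K := by show K ≤ _; omega
      N := by show N ≤ _; omega
      M := by show M ≤ _; omega
      i := Nat.zero_le _
      r := Nat.zero_le _
      j := Nat.zero_le _
      l := Nat.zero_le _
      A := Nat.zero_le _
      B := Nat.zero_le _
      F := Nat.zero_le _
      n := Nat.zero_le _
      inp := hinp
      out := fun _ => Nat.zero_le _
      C := fun _ => Nat.zero_le _
      c := fun _ => Nat.zero_le _
      P := fun _ => Nat.zero_le _
      Q := fun _ => Nat.zero_le _ }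
  -- Memory contents stay below `X ^ 12`, which exceeds `2 * M ^ 9 + 2`, and evaluating an
  -- expression of cost at most `60` raises this to the power `60` at most.
  rw [input_eq, ← hst, show (720 : ℕ) = 12 * 60 from rfl, pow_mul]
  have hf := Expr.fits hV hok.bdd (q := 60)
    (sub (add eM (.lit 1)) (mul (mul (mul (add (add eW eN) (.lit 1)) (add (add eW eN) (.lit 1)))
      (add (add eW eN) (.lit 1))) (add (add eW eN) (.lit 1)))) rfl (by decide)
  by_cases hM : (W + N + 1) * (W + N + 1) * (W + N + 1) * (W + N + 1) ≤ M
  · have hM1 : 1 ≤ M := le_trans (by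
      have : 1 ≤ W + N + 1 := by omega
      exact Nat.mul_le_mul (Nat.mul_le_mul (Nat.mul_le_mul this this) this) this) hM
    have hle : ∀ x y : ℕ, x ≤ W + N + 1 → y ≤ W + N + 1 → x * y ≤ M := fun x y hx hy => by
      have : x * y * 1 * 1 ≤ (W + N + 1) * (W + N + 1) * (W + N + 1) * (W + N + 1) :=
        Nat.mul_le_mul (Nat.mul_le_mul (Nat.mul_le_mul hx hy) (by omega)) (by omega)
      omega
    have hNN : N * N ≤ M := hle N N (by omega) (by omega)
    have hWM : W ≤ M := by
      have := hle W 1 (by omega) (by omega)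
      omega
    have hMNN : M * (N * N) ≤ M ^ 2 := by
      rw [sq]
      exact Nat.mul_le_mul_left _ hNN
    have hMX : M ^ 2 + M + 1 ≤ X ^ 12 := by
      have h1 : (M + 1) ^ 2 ≤ X ^ 2 := Nat.pow_le_pow_left (by omega) 2
      have h2 : X ^ 2 ≤ X ^ 12 := hpow 2 (by norm_num)
      have h3 : M ^ 2 + M + 1 ≤ (M + 1) ^ 2 := by
        rw [add_sq]
        omega
      exact h3.trans (h1.trans h2)
    have e1 := countAll_reach hV st hok rfl rfl rfl rfl rfl (by show N + 1 ≤ _; omega)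
      (by show M * (N * N) + M + 1 ≤ _; omega)
    set st' : State := { st with
      C := hits (pairAddr W) (corpusArray D) N M
      c := hits wordAddr (corpusArray D) N M } with hst'
    have hs : st'.Sized (X ^ 12) :=
      { large := by
          show 2 * M ^ 9 + 2 ≤ X ^ 12
          have h1 : (M + 1) ^ 9 ≤ X ^ 9 := Nat.pow_le_pow_left (by omega) 9
          have h2 : M ^ 9 + 1 ^ 9 ≤ (M + 1) ^ 9 := pow_add_pow_le (by omega) (by omega) (by norm_num)
          have h3 : X ^ 10 ≤ X ^ 12 := hpow 10 (by norm_num)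
          have h4 : 2 * X ^ 9 ≤ X * X ^ 9 := Nat.mul_le_mul_right _ hX
          have h5 : X * X ^ 9 = X ^ 10 := (pow_succ' X 9).symm
          omega
        one_le := hM1
        W_le := hWM
        C_le := fun a => (hits_le _ _ _ _ _).trans hMNN
        c_le := fun a => (hits_le _ _ _ _ _).trans hMNN
        K_le := hok.K
        N_le := hok.N
        inp_le := hinp }
    have e2 := searchAll_reach hs
    -- The summand `1` makes the truncated difference nonzero also when the guard holds with
    -- equality.
    have e3 := Reach.cond_true (q := .skip) hf (by
      show M + 1 - (W + N + 1) * (W + N + 1) * (W + N + 1) * (W + N + 1) ≠ 0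
      omega) (e1.seq e2)
    obtain ⟨t, ht, hr⟩ := e3
    refine ⟨t, _, hr, ht.trans ?_, ?_⟩
    · refine le_trans ?_ (time_bound (K := K) hM (numRounds_le M))
      rw [add_comm]
      exact add_le_add le_rfl (by decide)
    · have hd : st'.data = coocData M (cooccurrence D) := by
        simp only [State.data, coocData, hst', hst, initial, CoocData.mk.injEq, true_and]
        exact ⟨funext fun a => hits_corpusArray D _ a, funext fun a => hits_corpusArray D _ a⟩
      ext i
      show (if (i : ℕ) < W then st'.data.mark i else 0) ≠ 0 ↔ _
      rw [if_pos i.2, hd]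
      exact ⟨fun h => ⟨hM, h⟩, fun h => h.2⟩
  · have e3 := Reach.cond_false (p := .seq countAll searchAll) hf (by
      show M + 1 - (W + N + 1) * (W + N + 1) * (W + N + 1) * (W + N + 1) = 0
      omega) Reach.skip
    obtain ⟨t, ht, hr⟩ := e3.mono (τ' := 62) (by decide)
    refine ⟨t, _, hr, ht.trans ?_, ?_⟩
    · have : 1 ≤ (W + M + K + N + 1) ^ 2 := Nat.one_le_pow _ _ (by omega)
      omega
    -- The output array is still zero, so both sets are empty.
    · ext i
      refine ⟨fun h => absurd rfl h, fun h => absurd h.1 hM⟩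

end NovelWordProgram

/-! ## Analysis of the perceptron -/

namespace CoocData

variable (d : CoocData)

/-- The normalized row of a word. -/
noncomputable def point (i l : ℕ) : ℝ := (d.row i l : ℝ) / d.M

/-- The direction of the perceptron. -/
noncomputable def direction (σ : Perceptron) (l : ℕ) : ℝ := ((σ.pos l : ℝ) - σ.neg l) / d.M

/-- Word `j` occurs and its row is not close to that of word `i`. -/
def Far (i j : ℕ) : Prop :=
  d.c j ≠ 0 ∧ d.M * d.M * d.M < d.gap i j d.W * d.gap i j d.W * d.gap i j d.W * d.gap i j d.W

variable {d}

/-- Direction and points each carry a factor `1 / M`, which turns the integer margin `M ^ 2` into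
the margin `1`. -/
theorem dotPos_sub_dotNeg (hM : 1 ≤ d.M) (σ : Perceptron) (i j k : ℕ) :
    (d.dotPos σ i j k : ℝ) - d.dotNeg σ i j k =
      d.M ^ 2 * ∑ l ∈ Finset.range k, d.direction σ l * (d.point i l - d.point j l) := by
  have hM' : (d.M : ℝ) ≠ 0 := by positivity
  simp only [dotPos, dotNeg, Nat.cast_sum, ← Finset.sum_sub_distrib, Finset.mul_sum]
  refine Finset.sum_congr rfl fun l _ => ?_
  simp only [direction, point]
  push_cast
  field_simp
  ring

/-- A product of natural numbers is nonzero if all factors are, and a truncated difference if it is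
strictly positive. The `+ 1` in the last factor counts equality as a violation, so a test is passed
only with margin above `1`. -/
theorem violation_ne_zero_iff (hM : 1 ≤ d.M) (σ : Perceptron) (i j : ℕ) :
    d.violation σ i j ≠ 0 ↔ d.Far i j ∧
      ∑ l ∈ Finset.range d.W, d.direction σ l * (d.point i l - d.point j l) ≤ 1 := by
  have h := dotPos_sub_dotNeg hM σ i j d.W
  have hM2 : (0 : ℝ) < (d.M : ℝ) ^ 2 := by positivity
  have key : d.dotPos σ i j d.W ≤ d.dotNeg σ i j d.W + d.M * d.M ↔
      ∑ l ∈ Finset.range d.W, d.direction σ l * (d.point i l - d.point j l) ≤ 1 := by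
    rw [← Nat.cast_le (α := ℝ)]
    push_cast
    constructor
    · intro h'
      by_contra! hlt
      have := mul_lt_mul_of_pos_left hlt hM2
      nlinarith
    · intro h'
      have := mul_le_mul_of_nonneg_left h' hM2.le
      nlinarith
  rw [← key, Far, violation, mul_ne_zero_iff, mul_ne_zero_iff]
  refine and_congr (and_congr Iff.rfl ?_) ?_ <;> omega

theorem point_nonneg (i l : ℕ) : 0 ≤ d.point i l := by
  unfold point
  positivity

theorem point_le_one {i l : ℕ} (h : d.C (i * d.W + l) ≤ d.c i) : d.point i l ≤ 1 := by
  unfold point row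
  refine div_le_one_of_le₀ ?_ (Nat.cast_nonneg _)
  exact_mod_cast Nat.div_le_of_le_mul (by rw [mul_comm]; exact Nat.mul_le_mul_right _ h)

theorem direction_update (σ : Perceptron) (i j : ℕ) {l : ℕ} (hl : l < d.W) :
    d.direction (d.update σ i j d.W) l =
      d.direction σ l + (d.point i l - d.point j l) := by
  simp only [direction, update, hl, if_true, point]
  push_cast
  ring

theorem abs_point_sub_le (hC : ∀ i < d.W, ∀ l < d.W, d.C (i * d.W + l) ≤ d.c i) {i j l : ℕ}
    (hi : i < d.W) (hj : j < d.W) (hl : l < d.W) : |d.point i l - d.point j l| ≤ 1 := by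
  have h1 := point_nonneg (d := d) i l
  have h2 := point_nonneg (d := d) j l
  have h3 := point_le_one (hC i hi l hl)
  have h4 := point_le_one (hC j hj l hl)
  rw [abs_le]
  constructor <;> linarith

/-- If a property of the perceptron is preserved by updates, it holds throughout. -/
theorem rounds_induction {i : ℕ} {p : Perceptron → Prop} (h0 : p .init)
    (h1 : ∀ σ, ∀ j < d.W, p σ → d.violation σ i j ≠ 0 → p (d.update σ i j d.W)) (r : ℕ) :
    p (d.rounds i r) := by
  have hstep : ∀ σ, ∀ j < d.W, p σ → p (d.step i σ j) := fun σ j hj hσ => by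
    unfold step
    split_ifs with h
    · exact hσ
    · exact h1 σ j hj hσ h
  have hpass : ∀ σ k, k ≤ d.W → p σ → p (d.pass i σ k) := by
    intro σ k hk hσ
    induction k with
    | zero => exact hσ
    | succ k ih => exact hstep _ _ hk (ih (by omega))
  induction r with
  | zero => exact h0
  | succ r ih => exact hpass _ _ le_rfl ih

/-- The points have coordinates in `[0, 1]`, so a mistake moves each coordinate of the direction by
at most `1`. -/
theorem abs_direction_le (hC : ∀ i < d.W, ∀ l < d.W, d.C (i * d.W + l) ≤ d.c i) {i : ℕ}
    (hi : i < d.W) (r : ℕ) :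
    ∀ l < d.W, |d.direction (d.rounds i r) l| ≤ (d.rounds i r).mistakes := by
  refine rounds_induction (p := fun σ => ∀ l < d.W, |d.direction σ l| ≤ σ.mistakes) ?_ ?_ r
  · intro l _
    simp [direction, Perceptron.init]
  · intro σ j hj hσ _ l hl
    rw [direction_update σ i j hl]
    refine (abs_add_le _ _).trans ?_
    have h1 := hσ l hl
    have h2 := abs_point_sub_le hC hi hj hl
    simp only [update]
    push_cast
    linarith

/-- The perceptron makes few mistakes if a direction separates the row of word `i` from all rows
that are not close to it. -/
theorem mistakes_le (hM : 1 ≤ d.M) (hC : ∀ i < d.W, ∀ l < d.W, d.C (i * d.W + l) ≤ d.c i) {i : ℕ}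
    (hi : i < d.W) (g : ℕ → ℝ)
    (hg : ∀ j < d.W, d.Far i j →
      1 ≤ ∑ l ∈ Finset.range d.W, g l * (d.point i l - d.point j l)) (r : ℕ) :
    ((d.rounds i r).mistakes : ℝ) ≤ (d.W + 2) * ∑ l ∈ Finset.range d.W, g l ^ 2 := by
  -- The perceptron invariants. A mistake adds at least `1` to the inner product with `g`; to the
  -- squared norm it adds at most `2` from the cross term, by the violated margin, and at most `W`
  -- from the difference of points.
  have key : ((d.rounds i r).mistakes : ℝ) ≤
      ∑ l ∈ Finset.range d.W, g l * d.direction (d.rounds i r) l ∧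
      ∑ l ∈ Finset.range d.W, d.direction (d.rounds i r) l ^ 2 ≤
        (d.W + 2) * (d.rounds i r).mistakes := by
    refine rounds_induction (p := fun σ => (σ.mistakes : ℝ) ≤
      ∑ l ∈ Finset.range d.W, g l * d.direction σ l ∧
      ∑ l ∈ Finset.range d.W, d.direction σ l ^ 2 ≤ (d.W + 2) * σ.mistakes) ?_ ?_ r
    · simp [direction, Perceptron.init]
    · rintro σ j hj ⟨h1, h2⟩ hv
      obtain ⟨hf, hv⟩ := (violation_ne_zero_iff hM σ i j).1 hv
      have e1 : ∑ l ∈ Finset.range d.W, g l * d.direction (d.update σ i j d.W) l =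
          ∑ l ∈ Finset.range d.W, g l * d.direction σ l +
            ∑ l ∈ Finset.range d.W, g l * (d.point i l - d.point j l) := by
        rw [← Finset.sum_add_distrib]
        refine Finset.sum_congr rfl fun l hl => ?_
        rw [direction_update σ i j (Finset.mem_range.1 hl)]
        ring
      have e2 : ∑ l ∈ Finset.range d.W, d.direction (d.update σ i j d.W) l ^ 2 =
          ∑ l ∈ Finset.range d.W, d.direction σ l ^ 2 +
            2 * ∑ l ∈ Finset.range d.W, d.direction σ l * (d.point i l - d.point j l) +
            ∑ l ∈ Finset.range d.W, (d.point i l - d.point j l) ^ 2 := by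
        rw [Finset.mul_sum, ← Finset.sum_add_distrib, ← Finset.sum_add_distrib]
        refine Finset.sum_congr rfl fun l hl => ?_
        rw [direction_update σ i j (Finset.mem_range.1 hl)]
        ring
      have e3 : ∑ l ∈ Finset.range d.W, (d.point i l - d.point j l) ^ 2 ≤ d.W := by
        refine (Finset.sum_le_card_nsmul _ _ 1 fun l hl => ?_).trans (by simp)
        exact (sq_le_one_iff_abs_le_one _).2
          (abs_point_sub_le hC hi hj (Finset.mem_range.1 hl))
      have e4 := hg j hj hf
      refine ⟨?_, ?_⟩
      · rw [e1]
        simp only [update]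
        push_cast
        linarith
      · rw [e2]
        simp only [update]
        push_cast
        linarith
  obtain ⟨h1, h2⟩ := key
  set n : ℝ := ((d.rounds i r).mistakes : ℝ)
  have hn : 0 ≤ n := Nat.cast_nonneg _
  -- By Cauchy-Schwarz the two invariants give `n² ≤ ‖g‖² * (W + 2) * n`, and `n` cancels unless it
  -- is zero.
  have h3 := Finset.sum_mul_sq_le_sq_mul_sq (Finset.range d.W) g (d.direction (d.rounds i r))
  have hG : 0 ≤ ∑ l ∈ Finset.range d.W, g l ^ 2 := Finset.sum_nonneg fun _ _ => sq_nonneg _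
  have h4 : n ^ 2 ≤ (∑ l ∈ Finset.range d.W, g l ^ 2) * ((d.W + 2) * n) :=
    (pow_le_pow_left₀ hn h1 2).trans (h3.trans (mul_le_mul_of_nonneg_left h2 hG))
  rcases hn.eq_or_lt with h0 | h0
  · rw [← h0]
    positivity
  · have : n * n ≤ ((d.W + 2) * ∑ l ∈ Finset.range d.W, g l ^ 2) * n := by nlinarith
    exact le_of_mul_le_mul_right this h0

/-- A round without a mistake never changes the direction, so one and the same direction passes the
tests against all words. -/
theorem pass_eq_or_lt (i : ℕ) (σ : Perceptron) (k : ℕ) :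
    (d.pass i σ k = σ ∧ ∀ j < k, d.violation σ i j = 0) ∨
      σ.mistakes < (d.pass i σ k).mistakes := by
  induction k with
  | zero => exact Or.inl ⟨rfl, by simp⟩
  | succ k ih =>
      have hmono : ∀ τ : Perceptron, τ.mistakes ≤ (d.step i τ k).mistakes := fun τ => by
        unfold step
        split_ifs
        · exact le_rfl
        · exact Nat.le_succ _
      rcases ih with ⟨h1, h2⟩ | h
      · by_cases hv : d.violation σ i k = 0
        · left
          refine ⟨?_, fun j hj => ?_⟩
          · show d.step i (d.pass i σ k) k = σ
            rw [h1, step, if_pos hv]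
          · rcases Nat.lt_succ_iff_lt_or_eq.1 hj with h | rfl
            · exact h2 j h
            · exact hv
        · right
          show _ < (d.step i (d.pass i σ k) k).mistakes
          rw [h1, step, if_neg hv]
          exact Nat.lt_succ_self _
      · exact Or.inr (h.trans_le (hmono _))

/-- The perceptron makes a mistake in every round if the row of word `i` is almost a convex
combination of rows that are not close to it. -/
theorem le_mistakes {ι : Type*} [Fintype ι] (hM : 1 ≤ d.M)
    (hC : ∀ i < d.W, ∀ l < d.W, d.C (i * d.W + l) ≤ d.c i) {i : ℕ} (hi : i < d.W) (w : ι → ℝ)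
    (hw : ∀ k, 0 ≤ w k) (hw1 : ∑ k, w k = 1) (a : ι → ℕ) (ha : ∀ k, a k < d.W)
    (hf : ∀ k, d.Far i (a k)) {δ : ℝ}
    (hδ : ∀ l < d.W, |d.point i l - ∑ k, w k * d.point (a k) l| ≤ δ) (T : ℕ)
    (hT : (T : ℝ) * d.W * d.W * δ < 1) {r : ℕ} (hr : r ≤ T) : r ≤ (d.rounds i r).mistakes := by
  induction r with
  | zero => exact Nat.zero_le _
  | succ r ih =>
      have ih := ih (by omega)
      rcases pass_eq_or_lt (d := d) i (d.rounds i r) d.W with ⟨-, h⟩ | h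
      -- After a round without a mistake, `u` has margin at least `1` against every row of the
      -- combination, hence also on the weighted average. That average involves only the error of
      -- the combination, and `u` has entries at most `T * W`, so it is at most `T * W * W * δ < 1`.
      · exfalso
        set u := d.direction (d.rounds i r)
        have h1 : ∀ k, 1 ≤ ∑ l ∈ Finset.range d.W, u l * (d.point i l - d.point (a k) l) :=
          fun k => by
            by_contra! hlt
            exact (violation_ne_zero_iff hM _ _ _).2 ⟨hf k, hlt.le⟩ (h (a k) (ha k))
        have h2 : 1 ≤ ∑ k, w k * ∑ l ∈ Finset.range d.W, u l * (d.point i l - d.point (a k) l) :=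
          calc (1 : ℝ) = ∑ k, w k * 1 := by simp [hw1]
            _ ≤ _ := Finset.sum_le_sum fun k _ => mul_le_mul_of_nonneg_left (h1 k) (hw k)
        have h3 : ∑ k, w k * ∑ l ∈ Finset.range d.W, u l * (d.point i l - d.point (a k) l) =
            ∑ l ∈ Finset.range d.W, u l * (d.point i l - ∑ k, w k * d.point (a k) l) := by
          simp only [Finset.mul_sum]
          rw [Finset.sum_comm]
          refine Finset.sum_congr rfl fun l _ => ?_
          calc ∑ k, w k * (u l * (d.point i l - d.point (a k) l))
              = u l * (∑ k, w k) * d.point i l - u l * ∑ k, w k * d.point (a k) l := by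
                rw [Finset.mul_sum, Finset.mul_sum, Finset.sum_mul, ← Finset.sum_sub_distrib]
                refine Finset.sum_congr rfl fun k _ => ?_
                ring
            _ = _ := by
                rw [hw1]
                ring
        have h4 : ∑ l ∈ Finset.range d.W, u l * (d.point i l - ∑ k, w k * d.point (a k) l) ≤
            T * d.W * d.W * δ := by
          refine (Finset.sum_le_card_nsmul _ _ ((T * d.W : ℝ) * δ) fun l hl => ?_).trans ?_
          · have hl := Finset.mem_range.1 hl
            refine (le_abs_self _).trans ?_
            rw [abs_mul]
            refine mul_le_mul ?_ (hδ l hl) (abs_nonneg _) (by positivity)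
            refine (abs_direction_le hC hi r l hl).trans ?_
            have := (mistakes_rounds_le (d := d) i r).trans
              (Nat.mul_le_mul_right d.W (by omega : r ≤ T))
            exact_mod_cast this
          · rw [Finset.card_range, nsmul_eq_mul]
            exact le_of_eq (by ring)
        linarith
      · show r + 1 ≤ (d.pass i (d.rounds i r) d.W).mistakes
        omega

end CoocData

/-! ## Geometry of separable topic models -/

namespace TopicModel

variable {W K : ℕ} (T : TopicModel W K)

instance : IsProbabilityMeasure T.prior := T.prior_prob

/-- The probability that two positions of a document carry two given words. -/
noncomputable def cooc (i j : Fin W) : ℝ := ∑ k, ∑ l, T.topic i k * T.corr k l * T.topic j l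

/-- The probability of a word. -/
noncomputable def freq (i : Fin W) : ℝ := ∑ j, T.cooc i j

/-- The conditional distribution of the second word, given the first one. -/
noncomputable def condRow (i j : Fin W) : ℝ := T.cooc i j / T.freq i

/-- The conditional distribution of the second word, given the topic of the first one. -/
noncomputable def topicRow (k : Fin K) (j : Fin W) : ℝ := (∑ l, T.corr k l * T.topic j l) / T.mean k

/-- The conditional distribution of the topic, given the word. -/
noncomputable def topicWeight (i : Fin W) (k : Fin K) : ℝ := T.topic i k * T.mean k / T.freq i

theorem integrable_of_continuous {f : (Fin K → ℝ) → ℝ} (hf : Continuous f) {C : ℝ}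
    (h : ∀ θ ∈ stdSimplex ℝ (Fin K), |f θ| ≤ C) : Integrable f T.prior :=
  Integrable.of_bound hf.aestronglyMeasurable C (T.prior_simplex.mono h)

theorem integrable_mul (k l : Fin K) : Integrable (fun θ => θ k * θ l) T.prior := by
  refine T.integrable_of_continuous (C := 1) (by fun_prop) fun θ hθ => ?_
  have hk := mem_Icc_of_mem_stdSimplex hθ k
  have hl := mem_Icc_of_mem_stdSimplex hθ l
  rw [abs_of_nonneg (mul_nonneg hk.1 hl.1)]
  exact mul_le_one₀ hk.2 hl.1 hl.2

theorem mean_pos' (k : Fin K) : 0 < T.mean k := T.mean_pos k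

/-- The topic proportions sum to `1` almost surely, so summing out the second topic leaves the mean.
-/
theorem sum_corr (k : Fin K) : ∑ l, T.corr k l = T.mean k := by
  simp only [corr, Matrix.of_apply, mean]
  rw [← integral_finsetSum _ fun l _ => T.integrable_mul k l]
  refine integral_congr_ae (T.prior_simplex.mono fun θ hθ => ?_)
  simp only
  rw [← Finset.mul_sum, hθ.2, mul_one]

theorem freq_eq (i : Fin W) : T.freq i = ∑ k, T.topic i k * T.mean k := by
  unfold freq cooc
  rw [Finset.sum_comm]
  refine Finset.sum_congr rfl fun k _ => ?_
  rw [Finset.sum_comm]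
  simp only [← Finset.mul_sum, T.topic_sum, mul_one, T.sum_corr]

theorem freq_nonneg (i : Fin W) : 0 ≤ T.freq i := by
  rw [freq_eq]
  exact Finset.sum_nonneg fun k _ => mul_nonneg (T.topic_nonneg i k) (T.mean_pos k).le

theorem freq_pos_of_topic_pos {i : Fin W} {k : Fin K} (h : 0 < T.topic i k) : 0 < T.freq i := by
  rw [freq_eq]
  exact Finset.sum_pos' (fun k _ => mul_nonneg (T.topic_nonneg i k) (T.mean_pos k).le)
    ⟨k, Finset.mem_univ k, mul_pos h (T.mean_pos k)⟩

theorem topicWeight_nonneg (i : Fin W) (k : Fin K) : 0 ≤ T.topicWeight i k :=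
  div_nonneg (mul_nonneg (T.topic_nonneg i k) (T.mean_pos k).le) (T.freq_nonneg i)

theorem sum_topicWeight {i : Fin W} (hi : 0 < T.freq i) : ∑ k, T.topicWeight i k = 1 := by
  simp only [topicWeight, ← Finset.sum_div, ← freq_eq]
  exact div_self hi.ne'

/-- This is Bayes' rule through the topic of the first word: the factors `mean k` cancel. It places
every row of positive frequency in the convex hull of the topic points. -/
theorem condRow_eq (i j : Fin W) :
    T.condRow i j = ∑ k, T.topicWeight i k * T.topicRow k j := by
  simp only [condRow, cooc, topicWeight, topicRow, Finset.sum_div]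
  refine Finset.sum_congr rfl fun k _ => ?_
  have := (T.mean_pos' k).ne'
  rw [Finset.mul_sum]
  refine Finset.sum_congr rfl fun l _ => ?_
  field_simp

theorem condRow_eq_topicRow {i : Fin W} (hi : 0 < T.freq i) {k : Fin K}
    (h : ∀ l, l ≠ k → T.topicWeight i l = 0) : T.condRow i = T.topicRow k := by
  have h1 : T.topicWeight i k = 1 := by
    rw [← T.sum_topicWeight hi, Finset.sum_eq_single k (fun l _ hl => h l hl) (by simp)]
  funext j
  rw [condRow_eq, Finset.sum_eq_single k (fun l _ hl => by rw [h l hl, zero_mul]) (by simp), h1,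
    one_mul]

theorem _root_.IsNovelWord.condRow_eq {i : Fin W} {k : Fin K} (h : IsNovelWord T.topic i k) :
    T.condRow i = T.topicRow k :=
  T.condRow_eq_topicRow (T.freq_pos_of_topic_pos h.1) fun l hl => by
    simp [topicWeight, h.2 l hl]

/-- The weights are nonnegative with sum `1`, so a weight of at least `1` leaves nothing for the
other topics. -/
theorem topicWeight_eq_one_of_le {i : Fin W} (hi : 0 < T.freq i) {k : Fin K}
    (h : 1 ≤ T.topicWeight i k) : ∀ l, l ≠ k → T.topicWeight i l = 0 := by
  intro l hl
  have h1 := T.sum_topicWeight hi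
  have h2 := Finset.add_le_sum (s := Finset.univ) (f := T.topicWeight i)
    (fun k _ => T.topicWeight_nonneg i k) (Finset.mem_univ k) (Finset.mem_univ l) hl.symm
  have h3 := T.topicWeight_nonneg i l
  linarith

theorem normCorr_apply (k l : Fin K) :
    T.normCorr k l = T.corr k l / (T.mean k * T.mean l) := by
  simp only [normCorr, Matrix.mul_diagonal, Matrix.diagonal_mul]
  field_simp

/-- In a separable model with simplicial normalized correlations, the distribution of a topic can
be separated from those of the other topics. -/
theorem exists_separating (hβ : IsSeparableTopics T.topic) (hR : IsSimplicialMatrix T.normCorr)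
    (k : Fin K) :
    ∃ g : Fin W → ℝ, ∀ l, l ≠ k → 1 ≤ ∑ x, g x * (T.topicRow k x - T.topicRow l x) := by
  obtain ⟨γ, hγ, hR⟩ := hR
  set S : Set (EuclideanSpace ℝ (Fin K)) :=
    (fun j : Fin K => WithLp.toLp 2 (T.normCorr j)) '' {j | j ≠ k} with hS
  have hfin : S.Finite := (Set.toFinite _).image _
  have hk : (WithLp.toLp 2 (T.normCorr k) : EuclideanSpace ℝ (Fin K)) ∉ convexHull ℝ S := by
    intro hmem
    have := hR k _ hmem
    rw [dist_self] at this
    linarith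
  have hcl : IsClosed (convexHull ℝ S) := hfin.isClosed_convexHull ℝ
  -- The hull of finitely many points is closed, so the separation is strict and the gap `c` below
  -- is positive.
  obtain ⟨f, u, hf, hu⟩ := geometric_hahn_banach_closed_point (convex_convexHull ℝ S)
    hcl hk
  set z := (InnerProductSpace.toDual ℝ (EuclideanSpace ℝ (Fin K))).symm f with hz
  have hfz : ∀ l, f (WithLp.toLp 2 (T.normCorr l)) = ∑ m, z m * T.normCorr l m := by
    intro l
    rw [← InnerProductSpace.toDual_symm_apply (𝕜 := ℝ), PiLp.inner_apply]
    refine Finset.sum_congr rfl fun m _ => ?_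
    simp [hz, mul_comm]
  set c := f (WithLp.toLp 2 (T.normCorr k)) - u with hc
  have hc0 : 0 < c := by linarith
  choose a ha using hβ
  -- Only coordinates of the chosen novel words are used. At `a m` the point of topic `l'` equals
  -- `normCorr l' m * mean m * topic (a m) m`; the denominators remove these factors and scale the
  -- gap to `1`.
  refine ⟨fun x => ∑ m, if a m = x then z m / (T.mean m * T.topic x m * c) else 0, fun l hl => ?_⟩
  have hrow : ∀ l', ∑ x, (∑ m, if a m = x then z m / (T.mean m * T.topic x m * c) else 0) *
      T.topicRow l' x = f (WithLp.toLp 2 (T.normCorr l')) / c := by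
    intro l'
    simp only [Finset.sum_mul]
    rw [Finset.sum_comm, hfz, Finset.sum_div]
    refine Finset.sum_congr rfl fun m _ => ?_
    rw [Finset.sum_eq_single (a m) (fun x _ hx => by rw [if_neg hx.symm, zero_mul]) (by simp),
      if_pos rfl, topicRow,
      Finset.sum_eq_single m (fun m' _ hm' => by rw [(ha m).2 m' hm', mul_zero]) (by simp),
      normCorr_apply]
    have h1 := (T.mean_pos' m).ne'
    have h2 := (T.mean_pos' l').ne'
    have h3 := (ha m).1.ne'
    field_simp
  simp only [mul_sub, Finset.sum_sub_distrib]
  rw [hrow, hrow, ← sub_div, one_le_div hc0]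
  have := hf _ (subset_convexHull ℝ S ⟨l, hl, rfl⟩)
  simp only at this
  linarith

/-- Expand the row of `j` into topic points: the term of topic `k` vanishes, and every other term
contributes at least its weight. -/
theorem one_sub_topicWeight_le {k : Fin K} {g : Fin W → ℝ}
    (hg : ∀ l, l ≠ k → 1 ≤ ∑ x, g x * (T.topicRow k x - T.topicRow l x)) {j : Fin W}
    (hj : 0 < T.freq j) :
    1 - T.topicWeight j k ≤ ∑ x, g x * (T.topicRow k x - T.condRow j x) := by
  have h1 := T.sum_topicWeight hj
  have e : ∑ x, g x * (T.topicRow k x - T.condRow j x) =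
      ∑ l, T.topicWeight j l * ∑ x, g x * (T.topicRow k x - T.topicRow l x) := by
    simp only [Finset.mul_sum]
    rw [Finset.sum_comm]
    refine Finset.sum_congr rfl fun x _ => ?_
    rw [condRow_eq]
    calc g x * (T.topicRow k x - ∑ l, T.topicWeight j l * T.topicRow l x)
        = g x * ((∑ l, T.topicWeight j l) * T.topicRow k x -
          ∑ l, T.topicWeight j l * T.topicRow l x) := by rw [h1, one_mul]
      _ = _ := by
        rw [Finset.sum_mul, ← Finset.sum_sub_distrib, Finset.mul_sum]
        refine Finset.sum_congr rfl fun l _ => ?_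
        ring
  rw [e, ← h1, ← Finset.add_sum_erase _ _ (Finset.mem_univ k), add_sub_cancel_left,
    ← Finset.add_sum_erase _ _ (Finset.mem_univ k)]
  simp only [sub_self, mul_zero, Finset.sum_const_zero, zero_add]
  refine Finset.sum_le_sum fun l hl => ?_
  exact le_mul_of_one_le_right (T.topicWeight_nonneg j l) (hg l (Finset.ne_of_mem_erase hl))

/-- The row of a novel word can be separated from all different rows. -/
theorem exists_separating_novel (hβ : IsSeparableTopics T.topic)
    (hR : IsSimplicialMatrix T.normCorr) {i : Fin W} (hi : i ∈ novelWords T.topic) :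
    ∃ g : Fin W → ℝ, ∀ j, 0 < T.freq j → T.condRow j = T.condRow i ∨
      2 ≤ ∑ x, g x * (T.condRow i x - T.condRow j x) := by
  obtain ⟨k, hk⟩ := hi
  obtain ⟨g, hg⟩ := T.exists_separating hβ hR k
  rw [hk.condRow_eq]
  set s : Fin W → ℝ := fun j => ∑ x, g x * (T.topicRow k x - T.condRow j x) with hs
  -- One scaling factor that raises all positive gaps `s j` to at least `2`; the excess over the
  -- margin `1` is spent on the statistical error.
  set t : ℝ := ∑ j, |2 / s j| with ht
  refine ⟨fun x => t * g x, fun j hj => ?_⟩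
  have h1 := T.one_sub_topicWeight_le hg hj
  rcases le_or_gt 1 (T.topicWeight j k) with h | h
  · exact Or.inl (T.condRow_eq_topicRow hj (T.topicWeight_eq_one_of_le hj h))
  · right
    have hsj : 0 < s j := by
      simp only [hs]
      linarith
    simp only [mul_assoc, ← Finset.mul_sum]
    have h2 : |2 / s j| ≤ t :=
      Finset.single_le_sum (f := fun j => |2 / s j|) (fun _ _ => abs_nonneg _) (Finset.mem_univ j)
    have h3 := (le_abs_self _).trans h2
    rwa [div_le_iff₀ hsj] at h3

/-- The row of a word that is not novel is a convex combination of different rows. -/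
theorem exists_convex_combination (hβ : IsSeparableTopics T.topic)
    (hR : IsSimplicialMatrix T.normCorr) {i : Fin W} (hf : 0 < T.freq i)
    (hi : i ∉ novelWords T.topic) :
    ∃ (w : Fin K → ℝ) (a : Fin K → Fin W), (∀ k, 0 ≤ w k) ∧ ∑ k, w k = 1 ∧
      (∀ k, 0 < T.freq (a k)) ∧ (∀ k, T.condRow (a k) ≠ T.condRow i) ∧
      ∀ x, T.condRow i x = ∑ k, w k * T.condRow (a k) x := by
  choose a ha using hβ
  have hrow : ∀ k, T.condRow (a k) = T.topicRow k := fun k => (ha k).condRow_eq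
  refine ⟨T.topicWeight i, a, T.topicWeight_nonneg i, T.sum_topicWeight hf,
    fun k => T.freq_pos_of_topic_pos (ha k).1, fun k heq => ?_, fun x => ?_⟩
  -- If the row were the point of topic `k`, the separation would force weight `1` on `k`, and the
  -- word would be novel.
  · obtain ⟨g, hg⟩ := T.exists_separating (fun k => ⟨a k, ha k⟩) hR k
    have h1 := T.one_sub_topicWeight_le hg hf
    rw [← heq, hrow k] at h1
    simp only [sub_self, mul_zero, Finset.sum_const_zero, sub_nonpos] at h1
    have h2 := T.topicWeight_eq_one_of_le hf h1
    have h3 : ∀ l, l ≠ k → T.topic i l = 0 := fun l hl => by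
      have := h2 l hl
      simpa [topicWeight, (T.mean_pos' l).ne', hf.ne'] using this
    refine hi ⟨k, lt_of_le_of_ne (T.topic_nonneg i k) fun h0 => ?_, h3⟩
    rw [topicWeight, ← h0, zero_mul, zero_div] at h1
    linarith
  · simp only [hrow]
    exact T.condRow_eq i x

end TopicModel

/-! ## Concentration of the co-occurrence counts -/

/-- For independent letters with law `q`, the probability of the letters `i` and `j` at the
positions `s` and `t`. -/
theorem sum_prod_mul_indicator {ι κ R : Type*} [Fintype ι] [DecidableEq ι] [Fintype κ]
    [DecidableEq κ] [CommSemiring R] (q : κ → R) (hq : ∑ w, q w = 1) {s t : ι} (hst : s ≠ t)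
    (i j : κ) :
    ∑ d : ι → κ, (if d s = i ∧ d t = j then 1 else 0) * ∏ r, q (d r) = q i * q j := by
  -- The indicator factors over positions, so the sum over `d` becomes a product of one-position
  -- sums; unconstrained positions contribute `1`.
  have h1 : ∀ d : ι → κ, (if d s = i ∧ d t = j then (1 : R) else 0) * ∏ r, q (d r) =
      ∏ r, ((if r = s then (if d r = i then 1 else 0) else 1) *
        (if r = t then (if d r = j then 1 else 0) else 1) * q (d r)) := by
    intro d
    rw [Finset.prod_mul_distrib, Finset.prod_mul_distrib, Finset.prod_ite_eq',
      Finset.prod_ite_eq']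
    simp only [Finset.mem_univ, if_true]
    split_ifs <;> simp_all
  have h2 := Finset.prod_univ_sum (fun _ : ι => (Finset.univ : Finset κ)) (fun r w =>
    (if r = s then (if w = i then (1 : R) else 0) else 1) *
        (if r = t then (if w = j then 1 else 0) else 1) * q w)
  rw [Fintype.piFinset_univ] at h2
  simp only [h1]
  rw [← h2]
  have h3 : ∀ r, ∑ w, (if r = s then (if w = i then (1 : R) else 0) else 1) *
      (if r = t then (if w = j then 1 else 0) else 1) * q w =
      (if r = s then q i else 1) * (if r = t then q j else 1) := by
    intro r
    by_cases hs : r = s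
    · have ht : r ≠ t := fun h => hst (hs.symm.trans h)
      simp [hs, hst]
    · by_cases ht : r = t
      · simp [ht, hst.symm]
      · simp [hs, ht, hq]
  simp only [h3]
  rw [Finset.prod_mul_distrib, Finset.prod_ite_eq', Finset.prod_ite_eq']
  simp

/-- The number of ordered pairs of distinct positions that carry the words `i` and `j`. -/
noncomputable def pairCount {W N : ℕ} (i j : Fin W) (d : Fin N → Fin W) : ℝ :=
  ∑ s : Fin N, ∑ t : Fin N, if s ≠ t ∧ d s = i ∧ d t = j then 1 else 0

theorem cooccurrence_eq_sum_pairCount {W N M : ℕ} (D : Corpus W N M) (i j : Fin W) :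
    (cooccurrence D i j : ℝ) = ∑ m, pairCount i j (D m) := by
  simp only [cooccurrence, Matrix.of_apply, pairCount]
  push_cast
  rfl

theorem pairCount_nonneg {W N : ℕ} (i j : Fin W) (d : Fin N → Fin W) : 0 ≤ pairCount i j d :=
  Finset.sum_nonneg fun _ _ => Finset.sum_nonneg fun _ _ => by split_ifs <;> norm_num

theorem pairCount_le {W N : ℕ} (i j : Fin W) (d : Fin N → Fin W) :
    pairCount i j d ≤ N * N := by
  refine (Finset.sum_le_card_nsmul _ _ (N : ℝ) fun s _ => ?_).trans (by simp)
  refine (Finset.sum_le_card_nsmul _ _ (1 : ℝ) fun t _ => ?_).trans (by simp)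
  split_ifs <;> norm_num

namespace TopicModel

variable {W K : ℕ} (T : TopicModel W K)

/-- The probability of a document. -/
noncomputable def docWeight {N : ℕ} (d : Fin N → Fin W) : ℝ :=
  ∫ θ, ∏ t, T.topic.mulVec θ (d t) ∂T.prior

theorem mulVec_nonneg {θ : Fin K → ℝ} (hθ : θ ∈ stdSimplex ℝ (Fin K)) (w : Fin W) :
    0 ≤ T.topic.mulVec θ w := by
  simp only [Matrix.mulVec, dotProduct]
  exact Finset.sum_nonneg fun k _ => mul_nonneg (T.topic_nonneg w k) (hθ.1 k)

theorem sum_mulVec {θ : Fin K → ℝ} (hθ : θ ∈ stdSimplex ℝ (Fin K)) :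
    ∑ w, T.topic.mulVec θ w = 1 := by
  simp only [Matrix.mulVec, dotProduct]
  rw [Finset.sum_comm]
  simp only [← Finset.sum_mul, T.topic_sum, one_mul]
  exact hθ.2

theorem mulVec_le_one {θ : Fin K → ℝ} (hθ : θ ∈ stdSimplex ℝ (Fin K)) (w : Fin W) :
    T.topic.mulVec θ w ≤ 1 := by
  rw [← T.sum_mulVec hθ]
  exact Finset.single_le_sum (f := fun w => T.topic.mulVec θ w)
    (fun w _ => T.mulVec_nonneg hθ w) (Finset.mem_univ w)

theorem continuous_mulVec (w : Fin W) : Continuous fun θ : Fin K → ℝ => T.topic.mulVec θ w := by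
  simp only [Matrix.mulVec, dotProduct]
  fun_prop

theorem integrable_prod_mulVec {N : ℕ} (d : Fin N → Fin W) :
    Integrable (fun θ => ∏ t, T.topic.mulVec θ (d t)) T.prior := by
  refine T.integrable_of_continuous (C := 1)
    (continuous_finsetProd _ fun t _ => T.continuous_mulVec (d t)) fun θ hθ => ?_
  rw [abs_of_nonneg (Finset.prod_nonneg fun t _ => T.mulVec_nonneg hθ _)]
  exact Finset.prod_le_one (fun t _ => T.mulVec_nonneg hθ _) fun t _ => T.mulVec_le_one hθ _

theorem docWeight_nonneg {N : ℕ} (d : Fin N → Fin W) : 0 ≤ T.docWeight d :=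
  integral_nonneg_of_ae (T.prior_simplex.mono fun _ hθ =>
    Finset.prod_nonneg fun _ _ => T.mulVec_nonneg hθ _)

theorem docLaw_eq (N : ℕ) : T.docLaw N =
    ∑ d : Fin N → Fin W, ENNReal.ofReal (T.docWeight d) • Measure.dirac d := by
  refine Finset.sum_congr rfl fun d _ => ?_
  congr 1
  rw [docWeight, ofReal_integral_eq_lintegral_ofReal (T.integrable_prod_mulVec d)
    (T.prior_simplex.mono fun θ hθ => Finset.prod_nonneg fun t _ => T.mulVec_nonneg hθ _)]
  refine lintegral_congr_ae (T.prior_simplex.mono fun θ hθ => ?_)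
  simp only
  rw [ENNReal.ofReal_prod_of_nonneg fun t _ => T.mulVec_nonneg hθ _]

theorem integral_docLaw {N : ℕ} (f : (Fin N → Fin W) → ℝ) :
    ∫ d, f d ∂T.docLaw N = ∑ d, f d * T.docWeight d := by
  rw [docLaw_eq, integral_finsetSum_measure]
  · refine Finset.sum_congr rfl fun d _ => ?_
    rw [integral_smul_measure, integral_dirac, ENNReal.toReal_ofReal (T.docWeight_nonneg d),
      smul_eq_mul, mul_comm]
  · intro d _
    exact Integrable.smul_measure (integrable_dirac (by simp)) ENNReal.ofReal_ne_top

/-- A sum over documents is an expectation over topic proportions. -/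
theorem sum_mul_docWeight {N : ℕ} (f : (Fin N → Fin W) → ℝ) :
    ∑ d, f d * T.docWeight d =
      ∫ θ, ∑ d : Fin N → Fin W, f d * ∏ t, T.topic.mulVec θ (d t) ∂T.prior := by
  rw [integral_finsetSum _ fun d _ => (T.integrable_prod_mulVec d).const_mul _]
  exact Finset.sum_congr rfl fun d _ => (integral_const_mul _ _).symm

theorem sum_docWeight (N : ℕ) : ∑ d : Fin N → Fin W, T.docWeight d = 1 := by
  have h := T.sum_mul_docWeight (N := N) fun _ => 1
  simp only [one_mul] at h
  rw [h, integral_congr_ae (g := fun _ => 1), integral_const, probReal_univ, one_smul]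
  refine T.prior_simplex.mono fun θ hθ => ?_
  have h2 := Finset.prod_univ_sum (fun _ : Fin N => (Finset.univ : Finset (Fin W)))
    (fun _ w => T.topic.mulVec θ w)
  rw [Fintype.piFinset_univ] at h2
  simp only
  rw [← h2]
  simp [T.sum_mulVec hθ]

instance isProbabilityMeasure_docLaw (N : ℕ) : IsProbabilityMeasure (T.docLaw N) := by
  constructor
  rw [docLaw_eq, Measure.finsetSum_apply]
  simp only [Measure.smul_apply, measure_univ, smul_eq_mul, mul_one]
  rw [← ENNReal.ofReal_sum_of_nonneg fun d _ => T.docWeight_nonneg d, T.sum_docWeight,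
    ENNReal.ofReal_one]

instance isProbabilityMeasure_corpusLaw (N M : ℕ) : IsProbabilityMeasure (T.corpusLaw N M) := by
  unfold corpusLaw
  infer_instance

theorem cooc_eq_integral (i j : Fin W) :
    T.cooc i j = ∫ θ, T.topic.mulVec θ i * T.topic.mulVec θ j ∂T.prior := by
  have h : ∀ θ : Fin K → ℝ, T.topic.mulVec θ i * T.topic.mulVec θ j =
      ∑ k, ∑ l, T.topic i k * T.topic j l * (θ k * θ l) := by
    intro θ
    simp only [Matrix.mulVec, dotProduct, Finset.sum_mul_sum]
    refine Finset.sum_congr rfl fun k _ => Finset.sum_congr rfl fun l _ => ?_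
    ring
  simp only [h]
  rw [integral_finsetSum _ fun k _ => integrable_finsetSum _ fun l _ =>
    (T.integrable_mul k l).const_mul _]
  refine Finset.sum_congr rfl fun k _ => ?_
  rw [integral_finsetSum _ fun l _ => (T.integrable_mul k l).const_mul _]
  refine Finset.sum_congr rfl fun l _ => ?_
  rw [integral_const_mul]
  simp only [corr, Matrix.of_apply]
  ring

/-- Given `θ` the positions are independent, so each of the `N * (N - 1)` ordered pairs contributes
the product of two word probabilities, whose mean over the prior is `cooc`. -/
theorem integral_pairCount (N : ℕ) (i j : Fin W) :
    ∫ d, pairCount i j d ∂T.docLaw N = N * (N - 1) * T.cooc i j := by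
  rw [integral_docLaw, sum_mul_docWeight, cooc_eq_integral, ← integral_const_mul]
  refine integral_congr_ae (T.prior_simplex.mono fun θ hθ => ?_)
  simp only [pairCount, Finset.sum_mul]
  set q := T.topic.mulVec θ
  rw [Finset.sum_comm]
  have h : ∀ s : Fin N, ∑ d : Fin N → Fin W, ∑ t,
      (if s ≠ t ∧ d s = i ∧ d t = j then (1 : ℝ) else 0) * ∏ r, q (d r) = (N - 1) * (q i * q j) := by
    intro s
    rw [Finset.sum_comm]
    have h1 : ∀ t, ∑ d : Fin N → Fin W, (if s ≠ t ∧ d s = i ∧ d t = j then (1 : ℝ) else 0) *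
        ∏ r, q (d r) = if s = t then 0 else q i * q j := by
      intro t
      by_cases hst : s = t
      · simp [hst]
      · simp only [ne_eq, hst, not_false_eq_true, true_and, if_false]
        exact sum_prod_mul_indicator q (T.sum_mulVec hθ) hst i j
    simp only [h1]
    have h2 : ∀ t, (if s = t then 0 else q i * q j) = q i * q j - if s = t then q i * q j else 0 :=
      fun t => by split_ifs <;> simp
    simp only [h2, Finset.sum_sub_distrib]
    simp
    ring
  simp only [h]
  simp
  ring

theorem memLp_of_corpus {N M : ℕ} (f : Corpus W N M → ℝ) : MemLp f 2 (T.corpusLaw N M) :=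
  MemLp.of_bound (Measurable.of_discrete).aestronglyMeasurable
    (∑ D, ‖f D‖) (ae_of_all _ fun D =>
      Finset.single_le_sum (f := fun D => ‖f D‖) (fun _ _ => norm_nonneg _) (Finset.mem_univ D))

theorem memLp_of_doc {N : ℕ} (f : (Fin N → Fin W) → ℝ) : MemLp f 2 (T.docLaw N) :=
  MemLp.of_bound (Measurable.of_discrete).aestronglyMeasurable
    (∑ D, ‖f D‖) (ae_of_all _ fun D =>
      Finset.single_le_sum (f := fun D => ‖f D‖) (fun _ _ => norm_nonneg _) (Finset.mem_univ D))

theorem integral_cooccurrence (N M : ℕ) (i j : Fin W) :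
    ∫ D, (cooccurrence D i j : ℝ) ∂T.corpusLaw N M = M * (N * (N - 1)) * T.cooc i j := by
  simp only [cooccurrence_eq_sum_pairCount]
  rw [integral_finsetSum]
  · have h : ∀ m : Fin M, ∫ D : Corpus W N M, pairCount i j (D m) ∂T.corpusLaw N M =
        N * (N - 1) * T.cooc i j := by
      intro m
      rw [← T.integral_pairCount N i j]
      exact integral_comp_eval (μ := fun _ : Fin M => T.docLaw N) (i := m)
        (f := fun d => pairCount i j d) (Measurable.of_discrete).aestronglyMeasurable
    simp only [h]
    simp
    ring
  · intro m _
    exact (T.memLp_of_corpus _).integrable (by norm_num)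

/-- The documents are independent, so the variances of their pair counts add up, and each pair count
lies in `[0, N²]`. -/
theorem variance_cooccurrence_le (N M : ℕ) (i j : Fin W) :
    ProbabilityTheory.variance (fun D => (cooccurrence D i j : ℝ)) (T.corpusLaw N M) ≤
      M * N ^ 4 := by
  have h : (fun D : Corpus W N M => (cooccurrence D i j : ℝ)) =
      ∑ m : Fin M, fun D : Corpus W N M => pairCount i j (D m) := by
    funext D
    rw [cooccurrence_eq_sum_pairCount, Finset.sum_apply]
  rw [h, corpusLaw, ProbabilityTheory.variance_sum_pi (X := fun _ d => pairCount i j d)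
    fun _ => T.memLp_of_doc _]
  refine (Finset.sum_le_card_nsmul _ _ ((N : ℝ) ^ 4) fun m _ => ?_).trans (by simp)
  refine (ProbabilityTheory.variance_le_sq_of_bounded (a := 0) (b := N * N)
    (ae_of_all _ fun d => ⟨pairCount_nonneg i j d, pairCount_le i j d⟩)
    (Measurable.of_discrete).aemeasurable).trans ?_
  have : (0 : ℝ) ≤ (N : ℝ) ^ 4 := by positivity
  nlinarith

/-- A nonnegative variable of mean zero vanishes almost surely. Words of frequency zero are thereby
recognized exactly, not just up to a small error. -/
theorem ae_cooccurrence_eq_zero (N M : ℕ) {i j : Fin W} (h : T.cooc i j = 0) :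
    ∀ᵐ D ∂T.corpusLaw N M, cooccurrence D i j = 0 := by
  have h1 := T.integral_cooccurrence N M i j
  rw [h, mul_zero, integral_eq_zero_iff_of_nonneg (fun _ => Nat.cast_nonneg _)
    ((T.memLp_of_corpus _).integrable (by norm_num))] at h1
  exact h1.mono fun D hD => by simpa using hD

/-- The counts are close to their expectations, and vanish if these do. -/
def Concentrated {N M : ℕ} (η : ℝ) (D : Corpus W N M) : Prop :=
  ∀ i j, |(cooccurrence D i j : ℝ) / (M * (N * (N - 1))) - T.cooc i j| < η ∧
    (T.cooc i j = 0 → cooccurrence D i j = 0)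

/-- Chebyshev's inequality; two positions per document make the normalization at least `M`. -/
theorem measure_deviation_le {N M : ℕ} (hN : 2 ≤ N) (hM : 1 ≤ M) {η : ℝ} (hη : 0 < η)
    (i j : Fin W) :
    T.corpusLaw N M {D | η ≤ |(cooccurrence D i j : ℝ) / (M * (N * (N - 1))) - T.cooc i j|} ≤
      ENNReal.ofReal (N ^ 4 / (η ^ 2 * M)) := by
  have hN' : (2 : ℝ) ≤ N := by exact_mod_cast hN
  have hM' : (1 : ℝ) ≤ M := by exact_mod_cast hM
  have hNN : (1 : ℝ) ≤ N * (N - 1) := by nlinarith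
  set S : ℝ := M * (N * (N - 1)) with hS
  have hS1 : (M : ℝ) ≤ S := le_mul_of_one_le_right (by linarith) hNN
  have hS0 : 0 < S := by linarith
  have h := ProbabilityTheory.meas_ge_le_variance_div_sq
    (T.memLp_of_corpus (M := M) (N := N) fun D => (cooccurrence D i j : ℝ))
    (c := η * S) (by positivity)
  rw [integral_cooccurrence, ← hS] at h
  refine le_trans (le_of_eq ?_) (h.trans (ENNReal.ofReal_le_ofReal ?_))
  · congr 1
    ext D
    simp only [Set.mem_ofPred_eq]
    have : (cooccurrence D i j : ℝ) / S - T.cooc i j =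
        ((cooccurrence D i j : ℝ) - S * T.cooc i j) / S := by
      field_simp
    rw [this, abs_div, abs_of_pos hS0, le_div_iff₀ hS0]
  · refine (div_le_div_of_nonneg_right (T.variance_cooccurrence_le N M i j)
      (sq_nonneg _)).trans ?_
    rw [div_le_div_iff₀ (by positivity) (by positivity)]
    have h1 : (M : ℝ) * M ≤ S ^ 2 := by nlinarith
    have h2 : 0 ≤ (N : ℝ) ^ 4 * η ^ 2 := by positivity
    nlinarith [mul_le_mul_of_nonneg_left h1 h2]

end TopicModel

/-! ### Growth of the number of rounds and the concentration event -/

theorem tendsto_numRounds : Tendsto numRounds atTop atTop := by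
  refine tendsto_atTop.2 fun b => ?_
  filter_upwards [eventually_gt_atTop (b * b * b * b)] with M hM
  by_contra! h
  have h1 := le_numRounds_pow M
  have h2 : numRounds M * numRounds M * numRounds M * numRounds M ≤ b * b * b * b :=
    Nat.mul_le_mul (Nat.mul_le_mul (Nat.mul_le_mul h.le h.le) h.le) h.le
  omega

/-- The fourth power of the number of rounds is at most `16 * M`, so its square is at most `4 * √M`.
This is the rate in Chebyshev's inequality for an error inversely proportional to the number of
rounds. -/
theorem tendsto_numRounds_sq_div :
    Tendsto (fun M : ℕ => (numRounds M : ℝ) ^ 2 / M) atTop (𝓝 0) := by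
  have h1 : Tendsto (fun M : ℕ => 4 / √(M : ℝ)) atTop (𝓝 0) :=
    (Real.tendsto_sqrt_atTop.comp tendsto_natCast_atTop_atTop).const_div_atTop 4
  refine squeeze_zero' (Eventually.of_forall fun M => by positivity) ?_ h1
  filter_upwards [eventually_ge_atTop 1] with M hM
  have hM' : (0 : ℝ) < M := by exact_mod_cast hM
  have h2 : (numRounds M : ℝ) ^ 4 ≤ 16 * M := by exact_mod_cast numRounds_pow_four_le hM
  have h3 : (numRounds M : ℝ) ^ 2 ≤ 4 * √(M : ℝ) := by
    refine le_of_sq_le_sq ?_ (by positivity)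
    rw [mul_pow, Real.sq_sqrt hM'.le]
    nlinarith
  rw [div_le_div_iff₀ hM' (by positivity)]
  have h4 := Real.mul_self_sqrt hM'.le
  nlinarith [Real.sqrt_nonneg (M : ℝ)]

namespace TopicModel

variable {W K : ℕ} (T : TopicModel W K)

/-- The counts concentrate up to an error of the order of the inverse number of rounds. -/
theorem tendsto_measure_concentrated {N : ℕ} (hN : 2 ≤ N) {κ : ℝ} (hκ : 0 < κ) :
    Tendsto (fun M : ℕ => T.corpusLaw N M {D | T.Concentrated (κ / numRounds M) D})
      atTop (𝓝 1) := by
  have hbound : ∀ᶠ M : ℕ in atTop,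
      1 - ∑ _i : Fin W, ∑ _j : Fin W,
          ENNReal.ofReal (N ^ 4 / κ ^ 2 * ((numRounds M : ℝ) ^ 2 / M)) ≤
        T.corpusLaw N M {D | T.Concentrated (κ / numRounds M) D} := by
    filter_upwards [eventually_ge_atTop 1, tendsto_numRounds.eventually_ge_atTop 1] with M hM hT
    have hT' : (0 : ℝ) < numRounds M := by exact_mod_cast hT
    have hM' : (0 : ℝ) < M := by exact_mod_cast hM
    rw [tsub_le_iff_right, ← prob_add_prob_compl
      (μ := T.corpusLaw N M) (s := {D | T.Concentrated (κ / numRounds M) D})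
      (MeasurableSet.of_discrete)]
    refine add_le_add le_rfl ?_
    -- A union bound over the pairs of words, whose number is fixed; failures of the exact vanishing
    -- have probability zero.
    have hsub : {D : Corpus W N M | T.Concentrated (κ / numRounds M) D}ᶜ ⊆
        ⋃ i : Fin W, ⋃ j : Fin W,
          {D | κ / numRounds M ≤ |(cooccurrence D i j : ℝ) / (M * (N * (N - 1))) - T.cooc i j|} ∪
          {D | ¬ (T.cooc i j = 0 → cooccurrence D i j = 0)} := by
      intro D hD
      simp only [Set.mem_compl_iff, Set.mem_ofPred_eq, Concentrated, not_forall, not_and_or] at hD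
      obtain ⟨i, j, h⟩ := hD
      refine Set.mem_iUnion.2 ⟨i, Set.mem_iUnion.2 ⟨j, ?_⟩⟩
      rcases h with h | h
      · exact Or.inl (not_lt.1 h)
      · exact Or.inr (by simpa using h)
    refine (measure_mono hsub).trans ((measure_iUnion_fintype_le _ _).trans
      (Finset.sum_le_sum fun i _ => (measure_iUnion_fintype_le _ _).trans
        (Finset.sum_le_sum fun j _ => (measure_union_le _ _).trans ?_)))
    have hz : T.corpusLaw N M {D | ¬ (T.cooc i j = 0 → cooccurrence D i j = 0)} = 0 := by
      by_cases h0 : T.cooc i j = 0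
      · have := T.ae_cooccurrence_eq_zero N M h0
        rw [ae_iff] at this
        simpa [h0] using this
      · simp [h0]
    rw [hz, add_zero]
    refine (T.measure_deviation_le hN hM (div_pos hκ hT') i j).trans (le_of_eq ?_)
    congr 1
    field_simp
  have hlim : Tendsto (fun M : ℕ => 1 - ∑ _i : Fin W, ∑ _j : Fin W,
      ENNReal.ofReal (N ^ 4 / κ ^ 2 * ((numRounds M : ℝ) ^ 2 / M))) atTop (𝓝 1) := by
    have h1 : Tendsto (fun M : ℕ => ENNReal.ofReal (N ^ 4 / κ ^ 2 * ((numRounds M : ℝ) ^ 2 / M)))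
        atTop (𝓝 0) := by
      have := ENNReal.tendsto_ofReal (tendsto_numRounds_sq_div.const_mul ((N : ℝ) ^ 4 / κ ^ 2))
      simpa using this
    have h2 : Tendsto (fun M : ℕ => ∑ _i : Fin W, ∑ _j : Fin W,
        ENNReal.ofReal (N ^ 4 / κ ^ 2 * ((numRounds M : ℝ) ^ 2 / M))) atTop
        (𝓝 (∑ _i : Fin W, ∑ _j : Fin W, 0)) :=
      tendsto_finsetSum _ fun _ _ => tendsto_finsetSum _ fun _ _ => h1
    have h3 := ENNReal.Tendsto.sub (tendsto_const_nhds (x := (1 : ENNReal))) h2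
      (Or.inl ENNReal.one_ne_top)
    simpa using h3
  exact tendsto_of_tendsto_of_tendsto_of_le_of_le' hlim tendsto_const_nhds hbound
    (Eventually.of_forall fun M => prob_le_one)

end TopicModel

/-! ## Consistency of the search -/

theorem coocData_C {W : ℕ} (M : ℕ) (A : Matrix (Fin W) (Fin W) ℕ) (i j : Fin W) :
    (coocData M A).C ((i : ℕ) * W + j) = A i j := by
  have key : ∀ i' j' : Fin W, (i' : ℕ) * W + j' = i * W + j → i' = i ∧ j' = j := by
    intro i' j' h
    have hW : 0 < W := j.pos
    have h1 : ((i' : ℕ) * W + j') / W = ((i : ℕ) * W + j) / W := by rw [h]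
    rw [add_comm, Nat.add_mul_div_right _ _ hW, add_comm ((i : ℕ) * W),
      Nat.add_mul_div_right _ _ hW, Nat.div_eq_of_lt j'.2, Nat.div_eq_of_lt j.2] at h1
    obtain rfl : i' = i := Fin.ext (by omega)
    exact ⟨rfl, Fin.ext (by omega)⟩
  simp only [coocData]
  rw [Finset.sum_eq_single i, Finset.sum_eq_single j]
  · simp
  · intro j' _ h
    rw [if_neg fun h' => h (key i j' h').2, zero_mul]
  · simp
  · intro i' _ h
    exact Finset.sum_eq_zero fun j' _ => by rw [if_neg fun h' => h (key i' j' h').1, zero_mul]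
  · simp

theorem coocData_c {W : ℕ} (M : ℕ) (A : Matrix (Fin W) (Fin W) ℕ) (i : Fin W) :
    (coocData M A).c i = ∑ j, A i j := by
  simp only [coocData]
  rw [Finset.sum_eq_single i]
  · simp
  · intro i' _ h
    exact Finset.sum_eq_zero fun j' _ => by rw [if_neg fun h' => h (Fin.ext h'), zero_mul]
  · simp

theorem coocData_C_le_c {W : ℕ} (M : ℕ) (A : Matrix (Fin W) (Fin W) ℕ) :
    ∀ i < (coocData M A).W, ∀ l < (coocData M A).W,
      (coocData M A).C (i * (coocData M A).W + l) ≤ (coocData M A).c i := by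
  intro i hi l hl
  have h1 := coocData_C M A ⟨i, hi⟩ ⟨l, hl⟩
  have h2 := coocData_c M A ⟨i, hi⟩
  simp only at h1 h2
  rw [h2]
  refine (le_of_eq h1).trans ?_
  exact Finset.single_le_sum (f := fun j => A ⟨i, hi⟩ j) (fun _ _ => Nat.zero_le _)
    (Finset.mem_univ _)

namespace CoocData

variable {d : CoocData}

theorem gap_eq (hM : 1 ≤ d.M) (i j k : ℕ) :
    (d.gap i j k : ℝ) = d.M * ∑ l ∈ Finset.range k, |d.point i l - d.point j l| := by
  have hM' : (0 : ℝ) < d.M := by exact_mod_cast hM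
  simp only [gap, Nat.cast_sum, Finset.mul_sum]
  refine Finset.sum_congr rfl fun l _ => ?_
  simp only [point]
  rw [← sub_div, abs_div, abs_of_pos hM', mul_div_cancel₀ _ hM'.ne']
  push_cast
  rcases le_total (d.row i l) (d.row j l) with h | h
  · rw [Nat.sub_eq_zero_of_le h, Nat.cast_sub h, Nat.cast_zero, zero_add,
      abs_of_nonpos (sub_nonpos.2 (Nat.cast_le.2 h)), neg_sub]
  · rw [Nat.sub_eq_zero_of_le h, Nat.cast_sub h, Nat.cast_zero, add_zero,
      abs_of_nonneg (sub_nonneg.2 (Nat.cast_le.2 h))]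

/-- The gap is `M` times the `ℓ¹` distance `s`, so a far pair has `M * s ^ 4 > 1`. This is
impossible if `M ≤ t ^ 4` and `t * s ≤ 1`. -/
theorem not_far (hM : 1 ≤ d.M) {i j : ℕ}
    (h : (numRounds d.M : ℝ) * ∑ l ∈ Finset.range d.W, |d.point i l - d.point j l| ≤ 1) :
    ¬ d.Far i j := by
  rintro ⟨-, hlt⟩
  have hM' : (0 : ℝ) < d.M := by exact_mod_cast hM
  set t : ℝ := (numRounds d.M : ℝ) with ht
  set s := ∑ l ∈ Finset.range d.W, |d.point i l - d.point j l| with hs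
  have hs0 : 0 ≤ s := Finset.sum_nonneg fun _ _ => abs_nonneg _
  have h1 : (d.M : ℝ) ≤ t * t * t * t := by
    rw [ht]
    exact_mod_cast le_numRounds_pow d.M
  have h2 : (d.M * d.M * d.M : ℝ) < d.M * s * (d.M * s) * (d.M * s) * (d.M * s) := by
    rw [hs, ← gap_eq hM]
    exact_mod_cast hlt
  have h3 : (t * s) ^ 4 ≤ 1 := pow_le_one₀ (by positivity) h
  have h4 : (d.M : ℝ) * s ^ 4 ≤ 1 := by
    calc (d.M : ℝ) * s ^ 4 ≤ (t * t * t * t) * s ^ 4 :=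
          mul_le_mul_of_nonneg_right h1 (by positivity)
      _ = (t * s) ^ 4 := by ring
      _ ≤ 1 := h3
  have h5 : (0 : ℝ) ≤ d.M * d.M * d.M := by positivity
  have h6 := mul_le_mul_of_nonneg_left h4 h5
  nlinarith

theorem far_of_le (hM : 1 ≤ d.M) {i j : ℕ} (hj : d.c j ≠ 0) {s : ℝ} (hs : 0 ≤ s)
    (h : s ≤ ∑ l ∈ Finset.range d.W, |d.point i l - d.point j l|) (hsM : 1 < s ^ 4 * d.M) :
    d.Far i j := by
  refine ⟨hj, ?_⟩
  have hM' : (0 : ℝ) < d.M := by exact_mod_cast hM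
  have h1 : (d.M * s : ℝ) ≤ d.gap i j d.W := by
    rw [gap_eq hM]
    exact mul_le_mul_of_nonneg_left h hM'.le
  have h2 : (d.M * s : ℝ) ^ 4 ≤ (d.gap i j d.W : ℝ) ^ 4 :=
    pow_le_pow_left₀ (by positivity) h1 4
  have h3 : (d.M * d.M * d.M : ℝ) < (d.M * s : ℝ) ^ 4 := by
    have h4 : (0 : ℝ) < d.M * d.M * d.M := by positivity
    have h5 := mul_lt_mul_of_pos_left hsM h4
    nlinarith
  have h6 : ((d.M * d.M * d.M : ℕ) : ℝ) <
      ((d.gap i j d.W * d.gap i j d.W * d.gap i j d.W * d.gap i j d.W : ℕ) : ℝ) := by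
    push_cast
    refine h3.trans_le (h2.trans (le_of_eq (by ring)))
  exact_mod_cast h6

/-- The integer row is the floor of `M` times the exact quotient. -/
theorem abs_point_sub_div_le (hM : 1 ≤ d.M) (i l : ℕ) :
    |d.point i l - (d.C (i * d.W + l) : ℝ) / d.c i| ≤ 1 / d.M := by
  have hM' : (0 : ℝ) < d.M := by exact_mod_cast hM
  set x : ℝ := (d.C (i * d.W + l) : ℝ) / d.c i with hx
  have hx0 : 0 ≤ x := by positivity
  have h1 : (d.row i l : ℝ) = ⌊(d.M : ℝ) * x⌋₊ := by
    rw [hx, ← mul_div_assoc, ← Nat.cast_mul, Nat.floor_div_eq_div]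
    rfl
  have h2 := Nat.floor_le (by positivity : 0 ≤ (d.M : ℝ) * x)
  have h3 := Nat.lt_floor_add_one ((d.M : ℝ) * x)
  rw [← h1] at h2 h3
  have h4 : d.point i l - x = ((d.row i l : ℝ) - d.M * x) / d.M := by
    rw [point]
    field_simp
  rw [h4, abs_div, abs_of_pos hM']
  refine div_le_div_of_nonneg_right ?_ hM'.le
  rw [abs_le]
  constructor <;> linarith

end CoocData

namespace TopicModel

variable {W K : ℕ} (T : TopicModel W K)

/-- The normalized rows of the counts are close to the conditional distributions of the model. -/
def Close (M : ℕ) (ε : ℝ) (d : CoocData) : Prop :=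
  d.W = W ∧ d.M = M ∧ (∀ i < d.W, ∀ l < d.W, d.C (i * d.W + l) ≤ d.c i) ∧
    ∀ i : Fin W, (d.c i ≠ 0 ↔ 0 < T.freq i) ∧
      (0 < T.freq i → ∀ l : Fin W, |d.point i l - T.condRow i l| ≤ ε)

theorem cooc_eq_zero_of_freq {i : Fin W} (h : T.freq i = 0) (j : Fin W) : T.cooc i j = 0 := by
  have h1 : ∀ k, T.topic i k = 0 := by
    intro k
    rw [freq_eq, Finset.sum_eq_zero_iff_of_nonneg fun k _ =>
      mul_nonneg (T.topic_nonneg i k) (T.mean_pos' k).le] at h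
    exact (mul_eq_zero.1 (h k (Finset.mem_univ k))).resolve_right (T.mean_pos' k).ne'
  simp [cooc, h1]

theorem close_of_concentrated {N M : ℕ} (hN : 2 ≤ N) (hM : 1 ≤ M) {η φ : ℝ} (hη : 0 < η)
    (hφ : 0 < φ) (hφi : ∀ i, 0 < T.freq i → φ ≤ T.freq i) (hηφ : W * η < φ) {D : Corpus W N M}
    (hD : T.Concentrated η D) :
    T.Close M ((W + 1) * η / φ + 1 / M) (coocData M (cooccurrence D)) := by
  refine ⟨rfl, rfl, coocData_C_le_c _ _, fun i => ?_⟩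
  have hN' : (2 : ℝ) ≤ N := by exact_mod_cast hN
  have hM' : (1 : ℝ) ≤ M := by exact_mod_cast hM
  have hS : (0 : ℝ) < M * (N * (N - 1)) := by
    have : (0 : ℝ) < N - 1 := by linarith
    positivity
  set S : ℝ := M * (N * (N - 1)) with hSdef
  have hsum : |((coocData M (cooccurrence D)).c i : ℝ) / S - T.freq i| ≤ W * η := by
    rw [coocData_c, Nat.cast_sum, Finset.sum_div, freq, ← Finset.sum_sub_distrib]
    refine (Finset.abs_sum_le_sum_abs _ _).trans
      ((Finset.sum_le_card_nsmul _ _ η fun j _ => ((hD i j).1).le).trans (by simp))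
  have hact : (coocData M (cooccurrence D)).c i ≠ 0 ↔ 0 < T.freq i := by
    constructor
    · intro hc
      refine lt_of_le_of_ne (T.freq_nonneg i) fun h0 => hc ?_
      rw [coocData_c]
      exact Finset.sum_eq_zero fun j _ => (hD i j).2 (T.cooc_eq_zero_of_freq h0.symm j)
    -- A word of positive frequency must occur: otherwise its frequency, at least `φ`, would be at
    -- most the total error `W * η`.
    · intro hf hc
      rw [hc, Nat.cast_zero, zero_div, zero_sub, abs_neg, abs_of_pos hf] at hsum
      have := hφi i hf
      linarith
  refine ⟨hact, fun hf l => ?_⟩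
  have hc0 : (0 : ℝ) < (coocData M (cooccurrence D)).c i := by
    exact_mod_cast Nat.pos_of_ne_zero (hact.2 hf)
  have h1 := CoocData.abs_point_sub_div_le (d := coocData M (cooccurrence D)) hM i l
  have h2 : (coocData M (cooccurrence D)).C (i * W + l) = cooccurrence D i l :=
    coocData_C M _ i l
  have h3 := coocData_C_le_c M (cooccurrence D) i i.2 l l.2
  change |_ - ((coocData M (cooccurrence D)).C (i * W + l) : ℝ) / _| ≤ 1 / (M : ℝ) at h1
  change (coocData M (cooccurrence D)).C (i * W + l) ≤ _ at h3
  rw [h2] at h1 h3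
  set a : ℝ := (cooccurrence D i l : ℝ) / S with ha
  set q : ℝ := ((coocData M (cooccurrence D)).c i : ℝ) / S with hq
  have hq0 : 0 < q := div_pos hc0 hS
  have haq : (cooccurrence D i l : ℝ) / (coocData M (cooccurrence D)).c i = a / q := by
    rw [ha, hq]
    field_simp
  have ha0 : 0 ≤ a := by positivity
  have haleq : a ≤ q := div_le_div_of_nonneg_right (by exact_mod_cast h3) hS.le
  have hE := (hD i l).1.le
  change |a - _| ≤ η at hE
  have h4 : |a / q - T.condRow i l| ≤ (W + 1) * η / φ := by
    -- The error of a quotient splits into that of the numerator, at most `η`, and that of the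
    -- denominator, at most `W * η`, the latter with a factor `a / q ≤ 1`.
    have e : a / q - T.condRow i l = ((a - T.cooc i l) + a / q * (T.freq i - q)) / T.freq i := by
      rw [condRow]
      field_simp
      ring
    rw [e, abs_div, abs_of_pos hf]
    refine div_le_div₀ (by positivity) ?_ hφ (hφi i hf)
    refine (abs_add_le _ _).trans ?_
    rw [abs_mul, abs_of_nonneg (div_nonneg ha0 hq0.le), abs_sub_comm (T.freq i)]
    have h5 : a / q * |q - T.freq i| ≤ 1 * (W * η) :=
      mul_le_mul ((div_le_one hq0).2 haleq) hsum (abs_nonneg _) zero_le_one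
    linarith
  rw [haq] at h1
  calc |(coocData M (cooccurrence D)).point i l - T.condRow i l|
      ≤ |(coocData M (cooccurrence D)).point i l - a / q| + |a / q - T.condRow i l| :=
        abs_sub_le _ _ _
    _ ≤ (W + 1) * η / φ + 1 / M := by linarith

/-- The accuracy, in units of the inverse number of rounds, that suffices for the search. -/
noncomputable def accuracy (W : ℕ) : ℝ := 1 / (2 * ((W : ℝ) + 1) ^ 2)

theorem accuracy_pos (W : ℕ) : 0 < accuracy W := by
  unfold accuracy
  positivity

/-- This is the hypothesis of `le_mistakes` for a combination error of `2 * accuracy W` over the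
number of rounds; `two_mul_mul_accuracy_le` plays the same role for `not_far`. -/
theorem two_mul_sq_mul_accuracy_lt (W : ℕ) : 2 * (W : ℝ) ^ 2 * accuracy W < 1 := by
  unfold accuracy
  rw [mul_one_div, div_lt_one (by positivity)]
  have : (0 : ℝ) ≤ W := Nat.cast_nonneg _
  nlinarith

theorem two_mul_mul_accuracy_le (W : ℕ) : 2 * (W : ℝ) * accuracy W ≤ 1 := by
  unfold accuracy
  rw [mul_one_div, div_le_one (by positivity)]
  have : (0 : ℝ) ≤ W := Nat.cast_nonneg _
  nlinarith

theorem tendsto_div_numRounds (x : ℝ) :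
    Tendsto (fun M : ℕ => x / numRounds M) atTop (𝓝 0) :=
  (tendsto_natCast_atTop_atTop.comp tendsto_numRounds).const_div_atTop x

variable {T}

theorem Close.abs_point_sub_sub_le {M : ℕ} {ε : ℝ} {d : CoocData} (h : T.Close M ε d)
    {i j : Fin W} (hi : 0 < T.freq i) (hj : 0 < T.freq j) (l : Fin W) :
    |(d.point i l - d.point j l) - (T.condRow i l - T.condRow j l)| ≤ 2 * ε := by
  have h1 := (h.2.2.2 i).2 hi l
  have h2 := (h.2.2.2 j).2 hj l
  rw [abs_le] at h1 h2 ⊢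
  constructor <;> linarith

/-- Novel words are accepted. -/
theorem eventually_mark_ne_zero (hβ : IsSeparableTopics T.topic)
    (hR : IsSimplicialMatrix T.normCorr) {i : Fin W} (hi : i ∈ novelWords T.topic) :
    ∀ᶠ M : ℕ in atTop, ∀ d, T.Close M (accuracy W / numRounds M) d → d.mark i ≠ 0 := by
  obtain ⟨g, hg⟩ := T.exists_separating_novel hβ hR hi
  have hfi : 0 < T.freq i := by
    obtain ⟨k, hk⟩ := hi
    exact T.freq_pos_of_topic_pos hk.1
  have ht1 := (tendsto_div_numRounds (2 * accuracy W * ∑ x, |g x|)).eventually_le_const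
    (zero_lt_one (α := ℝ))
  have ht2 := (tendsto_natCast_atTop_atTop (R := ℝ)).comp tendsto_numRounds
    |>.eventually_gt_atTop ((W + 2) * ∑ x, g x ^ 2)
  filter_upwards [ht1, ht2, eventually_ge_atTop 1, tendsto_numRounds.eventually_ge_atTop 1]
    with M h1 h2 hM hT d hd
  obtain ⟨rfl, rfl, hC, hrow⟩ := id hd
  have hT' : (0 : ℝ) < numRounds d.M := by exact_mod_cast hT
  -- The perceptron indexes coordinates by natural numbers, so the direction is extended by zero.
  let g' : ℕ → ℝ := fun l => if h : l < d.W then g ⟨l, h⟩ else 0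
  have hg' : ∀ x : Fin d.W, g' x = g x := fun x => by simp [g']
  have hmist := CoocData.mistakes_le hM hC i.2 g' (fun j hj hfar => ?_) (numRounds d.M)
  · simp only [Finset.sum_range, hg'] at hmist
    have hlt := hmist.trans_lt h2
    simp only [Function.comp_apply, Nat.cast_lt] at hlt
    exact mul_ne_zero ((hrow i).1.2 hfi) (by omega)
  · set j' : Fin d.W := ⟨j, hj⟩ with hj'
    have hfj : 0 < T.freq j' := (hrow j').1.1 hfar.1
    have habs := hd.abs_point_sub_sub_le hfi hfj
    change ∀ l : Fin d.W, |(d.point i l - d.point j l) - _| ≤ _ at habs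
    -- A row with the same limit is too close to be tested; for any other row the margin `2` of the
    -- limit loses at most `1`.
    rcases hg j' hfj with heq | hge
    · refine absurd hfar (CoocData.not_far hM ?_)
      rw [Finset.sum_range]
      have hb : ∑ l : Fin d.W, |d.point i l - d.point j l| ≤
          d.W * (2 * (accuracy d.W / numRounds d.M)) := by
        refine (Finset.sum_le_card_nsmul _ _ (2 * (accuracy d.W / numRounds d.M))
          fun l _ => ?_).trans (by simp)
        have := habs l
        rwa [heq, sub_self, sub_zero] at this
      calc (numRounds d.M : ℝ) * ∑ l : Fin d.W, |d.point i l - d.point j l|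
          ≤ numRounds d.M * (d.W * (2 * (accuracy d.W / numRounds d.M))) :=
            mul_le_mul_of_nonneg_left hb hT'.le
        _ = 2 * d.W * accuracy d.W := by
            field_simp
        _ ≤ 1 := two_mul_mul_accuracy_le d.W
    · rw [Finset.sum_range]
      simp only [hg']
      have hb : ∑ x, g x * (T.condRow i x - T.condRow j' x) -
          ∑ x : Fin d.W, g x * (d.point i x - d.point j x) ≤
            2 * accuracy d.W * (∑ x, |g x|) / numRounds d.M := by
        rw [← Finset.sum_sub_distrib, mul_div_right_comm, Finset.mul_sum]
        refine Finset.sum_le_sum fun x _ => ?_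
        have h3 := habs x
        rw [← mul_sub]
        refine (le_abs_self _).trans ?_
        rw [abs_mul, abs_sub_comm, mul_comm, mul_div_assoc]
        exact mul_le_mul_of_nonneg_right h3 (abs_nonneg _)
      linarith

/-- Words that are not novel are not accepted. -/
theorem eventually_mark_eq_zero (hβ : IsSeparableTopics T.topic)
    (hR : IsSimplicialMatrix T.normCorr) {i : Fin W} (hi : i ∉ novelWords T.topic) :
    ∀ᶠ M : ℕ in atTop, ∀ d, T.Close M (accuracy W / numRounds M) d → d.mark i = 0 := by
  by_cases hfi : 0 < T.freq i
  swap
  -- A word of frequency zero does not occur, and the factor `c i` in `mark` rejects it.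
  · refine Eventually.of_forall fun M d hd => ?_
    have : d.c i = 0 := by
      by_contra h
      exact hfi ((hd.2.2.2 i).1.1 h)
    rw [CoocData.mark, this, zero_mul]
  obtain ⟨w, a, hw, hw1, ha, hne, hrow'⟩ := T.exists_convex_combination hβ hR hfi hi
  set s : Fin K → ℝ := fun k => ∑ l, |T.condRow i l - T.condRow (a k) l| with hs
  have hs0 : ∀ k, 0 < s k := by
    intro k
    obtain ⟨l, hl⟩ := Function.ne_iff.1 (hne k)
    exact Finset.sum_pos' (fun _ _ => abs_nonneg _)
      ⟨l, Finset.mem_univ l, abs_pos.2 (sub_ne_zero.2 hl.symm)⟩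
  have ht1 : ∀ᶠ M : ℕ in atTop, ∀ k, 2 * W * accuracy W / numRounds M ≤ s k / 2 :=
    eventually_all.2 fun k => (tendsto_div_numRounds _).eventually_le_const (half_pos (hs0 k))
  have ht2 : ∀ᶠ M : ℕ in atTop, ∀ k, 1 < (s k / 2) ^ 4 * (M : ℝ) :=
    eventually_all.2 fun k => ((tendsto_natCast_atTop_atTop (R := ℝ)).const_mul_atTop
      (pow_pos (half_pos (hs0 k)) 4)).eventually_gt_atTop 1
  filter_upwards [ht1, ht2, eventually_ge_atTop 1, tendsto_numRounds.eventually_ge_atTop 1]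
    with M h1 h2 hM hT d hd
  obtain ⟨rfl, rfl, hC, hrow⟩ := id hd
  have hT' : (0 : ℝ) < numRounds d.M := by exact_mod_cast hT
  -- The limit distances `s k` are positive and fixed, so eventually at least half of each remains,
  -- above the vanishing threshold. Topics of weight zero are included, since every `a k` has a row
  -- different from that of `i`.
  have hfar : ∀ k, d.Far i (a k) := by
    intro k
    refine CoocData.far_of_le hM ((hrow (a k)).1.2 (ha k)) (half_pos (hs0 k)).le ?_ (h2 k)
    rw [Finset.sum_range]
    have hb : s k - ∑ l : Fin d.W, |d.point i l - d.point (a k) l| ≤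
        2 * d.W * accuracy d.W / numRounds d.M := by
      simp only [hs]
      rw [← Finset.sum_sub_distrib]
      refine (Finset.sum_le_card_nsmul _ _ (2 * (accuracy d.W / numRounds d.M))
        fun l _ => ?_).trans (le_of_eq ?_)
      · refine (abs_sub_abs_le_abs_sub _ _).trans ?_
        rw [abs_sub_comm]
        exact hd.abs_point_sub_sub_le hfi (ha k) l
      · rw [Finset.card_univ, Fintype.card_fin, nsmul_eq_mul]
        ring
    have := h1 k
    linarith
  have hδ : ∀ l < d.W, |d.point i l - ∑ k, w k * d.point (a k) l| ≤
      2 * (accuracy d.W / numRounds d.M) := by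
    intro l hl
    set l' : Fin d.W := ⟨l, hl⟩
    have e : d.point i l - ∑ k, w k * d.point (a k) l =
        (d.point i l - T.condRow i l') -
          ∑ k, w k * (d.point (a k) l - T.condRow (a k) l') := by
      simp only [mul_sub, Finset.sum_sub_distrib]
      rw [hrow' l']
      ring
    rw [e]
    refine (abs_sub _ _).trans ?_
    have b1 := (hrow i).2 hfi l'
    have b2 : |∑ k, w k * (d.point (a k) l - T.condRow (a k) l')| ≤
        accuracy d.W / numRounds d.M := by
      refine (Finset.abs_sum_le_sum_abs _ _).trans ?_
      calc ∑ k, |w k * (d.point (a k) l - T.condRow (a k) l')|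
          ≤ ∑ k, w k * (accuracy d.W / numRounds d.M) := by
            refine Finset.sum_le_sum fun k _ => ?_
            rw [abs_mul, abs_of_nonneg (hw k)]
            exact mul_le_mul_of_nonneg_left ((hrow (a k)).2 (ha k) l') (hw k)
        _ = _ := by rw [← Finset.sum_mul, hw1, one_mul]
    change |d.point i l - _| ≤ _ at b1
    linarith
  have hle := CoocData.le_mistakes hM hC i.2 w hw hw1 (fun k => (a k : ℕ)) (fun k => (a k).2) hfar
    hδ (numRounds d.M) (by
      have := two_mul_sq_mul_accuracy_lt d.W
      refine lt_of_eq_of_lt ?_ this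
      field_simp) le_rfl
  rw [CoocData.mark, Nat.sub_eq_zero_of_le hle, mul_zero]

variable (T)

/-- The vocabulary is finite. The summand `1` keeps the bound positive even if there are no words.
-/
theorem exists_freq_bound : ∃ φ : ℝ, 0 < φ ∧ ∀ i, 0 < T.freq i → φ ≤ T.freq i := by
  have hs : 0 ≤ ∑ i, |(T.freq i)⁻¹| := Finset.sum_nonneg fun _ _ => abs_nonneg _
  have hs' : 0 < 1 + ∑ i, |(T.freq i)⁻¹| := by linarith
  refine ⟨(1 + ∑ i, |(T.freq i)⁻¹|)⁻¹, inv_pos.2 hs', fun i hi => ?_⟩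
  have h1 : |(T.freq i)⁻¹| ≤ ∑ i, |(T.freq i)⁻¹| :=
    Finset.single_le_sum (f := fun i => |(T.freq i)⁻¹|) (fun _ _ => abs_nonneg _)
      (Finset.mem_univ i)
  rw [abs_of_pos (inv_pos.2 hi)] at h1
  refine inv_le_of_inv_le₀ hi ?_
  linarith

theorem tendsto_numRounds_div :
    Tendsto (fun M : ℕ => (numRounds M : ℝ) / M) atTop (𝓝 0) := by
  refine squeeze_zero' (Eventually.of_forall fun M => by positivity) ?_ tendsto_numRounds_sq_div
  filter_upwards [tendsto_numRounds.eventually_ge_atTop 1] with M hT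
  have hT' : (1 : ℝ) ≤ numRounds M := by exact_mod_cast hT
  exact div_le_div_of_nonneg_right (by nlinarith) (Nat.cast_nonneg _)

/-- The search finds exactly the novel words, with probability tending to `1`. -/
theorem tendsto_recoverNovelWords {N : ℕ} (hN : 2 ≤ N) (hβ : IsSeparableTopics T.topic)
    (hR : IsSimplicialMatrix T.normCorr) :
    Tendsto (fun M : ℕ => T.corpusLaw N M
      {D | recoverNovelWords W K N M (cooccurrence D) = novelWords T.topic}) atTop (𝓝 1) := by
  obtain ⟨φ, hφ, hφi⟩ := T.exists_freq_bound
  -- Chosen so that the error of the frequencies uses half of the accuracy; the other half covers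
  -- the rounding error `1 / M`.
  set κ : ℝ := accuracy W * φ / (2 * (W + 1)) with hκ
  have hacc := accuracy_pos W
  have hκ0 : 0 < κ := by positivity
  have hmark : ∀ᶠ M : ℕ in atTop, ∀ i : Fin W, ∀ d, T.Close M (accuracy W / numRounds M) d →
      (d.mark i ≠ 0 ↔ i ∈ novelWords T.topic) := by
    refine eventually_all.2 fun i => ?_
    by_cases hi : i ∈ novelWords T.topic
    · exact (eventually_mark_ne_zero hβ hR hi).mono fun M h d hd => iff_of_true (h d hd) hi
    · exact (eventually_mark_eq_zero hβ hR hi).mono fun M h d hd =>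
        iff_of_false (fun h' => h' (h d hd)) hi
  have hsub : ∀ᶠ M : ℕ in atTop,
      T.corpusLaw N M {D | T.Concentrated (κ / numRounds M) D} ≤ T.corpusLaw N M
        {D | recoverNovelWords W K N M (cooccurrence D) = novelWords T.topic} := by
    have ht1 := (tendsto_div_numRounds (W * κ)).eventually_lt_const hφ
    have ht2 := tendsto_numRounds_div.eventually_le_const (half_pos hacc)
    filter_upwards [hmark, ht1, ht2, eventually_ge_atTop 1,
      tendsto_numRounds.eventually_ge_atTop 1,
      eventually_ge_atTop ((W + N + 1) * (W + N + 1) * (W + N + 1) * (W + N + 1))]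
      with M hm h1 h2 hM hT hMW
    have hT' : (0 : ℝ) < numRounds M := by exact_mod_cast hT
    have hM' : (0 : ℝ) < M := by exact_mod_cast hM
    refine measure_mono fun D hD => ?_
    have hclose := T.close_of_concentrated hN hM (div_pos hκ0 hT') hφ hφi
      (by rwa [← mul_div_assoc]) hD
    have hle : (W + 1) * (κ / numRounds M) / φ + 1 / M ≤ accuracy W / numRounds M := by
      have e1 : (W + 1) * (κ / numRounds M) / φ = accuracy W / 2 / numRounds M := by
        rw [hκ]
        field_simp
      have e2 : (1 : ℝ) / M ≤ accuracy W / 2 / numRounds M := by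
        rw [div_le_div_iff₀ hM' hT', one_mul]
        rwa [div_le_iff₀ hM'] at h2
      have e3 : accuracy W / numRounds M =
          accuracy W / 2 / numRounds M + accuracy W / 2 / numRounds M := by ring
      linarith
    have hclose' : T.Close M (accuracy W / numRounds M) (coocData M (cooccurrence D)) :=
      ⟨hclose.1, hclose.2.1, hclose.2.2.1, fun i => ⟨(hclose.2.2.2 i).1,
        fun hi l => ((hclose.2.2.2 i).2 hi l).trans hle⟩⟩
    ext i
    exact (and_iff_right hMW).trans (hm i _ hclose')
  exact tendsto_of_tendsto_of_tendsto_of_le_of_le' (T.tendsto_measure_concentrated hN hκ0)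
    tendsto_const_nhds hsub (Eventually.of_forall fun M => prob_le_one)

end TopicModel

/-! ### The main theorem -/

theorem lemma2 :
    ∃ (p : WordRAM.Program) (c C : ℕ)
      (recover : ∀ W K N M : ℕ, Matrix (Fin W) (Fin W) ℕ → Set (Fin W)),
      (∀ (W K N M : ℕ) (D : Corpus W N M),
        WordRAM.Outputs p c K D (C * (W + M + K + N + 1) ^ 2)
          (recover W K N M (cooccurrence D))) ∧
      (∀ (W K N : ℕ) (T : TopicModel W K), 2 ≤ N → IsSeparableTopics T.topic →
        IsSimplicialMatrix T.normCorr →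
        Tendsto
          (fun M : ℕ => T.corpusLaw N M
            {D | recover W K N M (cooccurrence D) = novelWords T.topic})
          atTop (𝓝 1)) :=
  ⟨NovelWordProgram.main, 720, 10000, recoverNovelWords, NovelWordProgram.main_outputs,
    fun _ _ _ T hN hβ hR => T.tendsto_recoverNovelWords hN hβ hR⟩
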